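/- Let $\hbar>0$, write phase space points as $x=(p,q)\in\mathbb R^2$, and let $\hat x=(\hat p,\hat q)$ with $\hat p=-i\hbar\,\frac{d}{dq}$ and $\hat q$ multiplication by $q$ in $L^2(\mathbb R)$. The Weyl quantisation of a symbol $A(p,q)$ is the operator $\hat A$ with integral kernel $K_A(q,q')=\frac1{2\pi\hbar}\int e^{\frac i\hbar(q-q')p}A\big(p,\tfrac{q+q'}2\big)\,dp$ (for polynomial $A$: on Schwartz functions, with the integral over $q'$ carried out before the one over $p$). The characteristic function of a density operator $\hat\rho$ is $\chi_{\hat\rho}(\xi)=\operatorname{tr}\big[e^{\frac i\hbar\xi\cdot\hat x}\hat\rho\big]$, $\xi\in\mathbb R^2$. For a real symmetric $2\times2$ matrix $G$, a (centred) Gaussian state with covariance matrix $G$ is a density operator whose characteristic function is $e^{-\frac1{4\hbar}\xi\cdot G\xi}$. For $z>1$, $\coth^{-1}(z)=\frac12\ln\frac{z+1}{z-1}$. Let $\Omega=\begin{pmatrix}0&-1\\1&0\end{pmatrix}$. **(1)** Let $Q$ be a real symmetric positive definite $2\times2$ matrix, $H(x)=\frac12x\cdot Qx$ and $\omega=\sqrt{\det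 Q}$. The closure $\hat H$ in $L^2(\mathbb R)$ of the operator $\frac12\hat x\cdot Q\hat x$ on Schwartz functions is self-adjoint and acts on Schwartz functions as the Weyl quantisation of $H$. For every $\beta>0$ there is exactly one bounded operator $e^{-\beta\hat H}$ (the time-one value of a strongly continuous semigroup with generator $-\beta\hat H$); its Weyl symbol is $$A(\beta,x)=\frac1{\cosh(\omega\hbar\beta/2)}\,\exp\Big(-\frac{2\tanh(\omega\hbar\beta/2)}{\omega\hbar}H(x)\Big),$$ it is of trace class, and $$Z(\beta):=\operatorname{tr}e^{-\beta\hat H}=\frac1{2\sinh(\hbar\omega\beta/2)}.$$ Furthermore $\hat\rho_\beta:=e^{-\beta\hat H}/Z(\beta)$ is a density operator with characteristic function $$\chi_{\hat\rho_\beta}(\xi)=\exp\Big(-\frac1{4\hbar}\,\frac{\omega}{\tanh(\omega\hbar\beta/2)}\,\xi\cdot Q^{-1}\xi\Big),$$ that is, a Gaussian state with covariance matrix $\frac{\omega}{\tanh(\omega\hbar\beta/2)}Q^{-1}$. **(2)** Let $G$ be a real symmetric $2\times2$ matrix with $G+i\Omega\ge0$ and $\det G>1$, and let $\hat\rho$ be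 a Gaussian state with covariance matrix $G$. Put $z=\sqrt{\det G}$, $Q=\frac{2z}{\hbar}\coth^{-1}(z)\,G^{-1}$, $\omega=\sqrt{\det Q}$, $H(x)=\frac12x\cdot Qx$ and $Z=\frac1{2\sinh(\hbar\omega/2)}$. Then $Q$ is positive definite, and it is the only positive definite symmetric matrix $R$ with $G=\frac{\sqrt{\det R}}{\tanh(\sqrt{\det R}\,\hbar/2)}R^{-1}$; moreover $z=\frac1{\tanh(\omega\hbar/2)}$, $Z=\frac12\sqrt{z^2-1}$, $$\hat\rho=\frac1Z\,e^{-\hat H},$$ and $\ln\hat\rho=-\hat H-\ln Z$, in the sense that the operator $-\hat H-\ln Z$ is the only self-adjoint operator $B$ with $e^{B}=\hat\rho$. -/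

import Mathlib

open MeasureTheory Filter Topology
open scoped SchwartzMap Matrix ComplexOrder

noncomputable section

namespace WeylCalculus

/-- The Hilbert space `L²(ℝ)` of complex square-integrable functions on the line. -/
abbrev L2 : Type := Lp ℂ 2 (volume : Measure ℝ)

/-! ### Position, momentum and quadratic Hamiltonians -/

/-- The momentum operator `-iħ d/dq` on Schwartz functions. -/
def momentum (ħ : ℝ) : 𝓢(ℝ, ℂ) →L[ℂ] 𝓢(ℝ, ℂ) :=
  (-(Complex.I * (ħ : ℂ))) • SchwartzMap.derivCLM ℂ ℂ

/-- The position operator, multiplication by `q`, on Schwartz functions. -/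
def position : 𝓢(ℝ, ℂ) →L[ℂ] 𝓢(ℝ, ℂ) :=
  SchwartzMap.smulLeftCLM ℂ (fun q : ℝ => (q : ℂ))

theorem momentum_apply (ħ : ℝ) (ψ : 𝓢(ℝ, ℂ)) (q : ℝ) :
    momentum ħ ψ q = -(Complex.I * (ħ : ℂ)) * deriv ψ q := by
  simp [momentum]

theorem position_apply (ψ : 𝓢(ℝ, ℂ)) (q : ℝ) : position ψ q = (q : ℂ) * ψ q := by
  have h : Function.HasTemperateGrowth (fun q : ℝ => (q : ℂ)) := by fun_prop
  simp [position, SchwartzMap.smulLeftCLM_apply_apply h]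

/-- The vector `x̂ = (p̂, q̂)`: the index `0` is momentum and the index `1` is position, in
accordance with the ordering `x = (p, q)` of phase space coordinates. -/
def xOp (ħ : ℝ) : Fin 2 → (𝓢(ℝ, ℂ) →L[ℂ] 𝓢(ℝ, ℂ)) := ![momentum ħ, position]

/-- The inclusion of Schwartz functions in `L²(ℝ)`. -/
def schwartzToL2 : 𝓢(ℝ, ℂ) →ₗ[ℂ] L2 :=
  (SchwartzMap.toLpCLM ℂ ℂ 2 (volume : Measure ℝ)).toLinearMap

theorem schwartzToL2_injective : Function.Injective schwartzToL2 :=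
  SchwartzMap.injective_toLp 2 (volume : Measure ℝ)

/-- An operator on Schwartz functions, as a densely defined operator in `L²(ℝ)` whose domain is
the space of Schwartz functions. -/
def onSchwartz (A : 𝓢(ℝ, ℂ) →L[ℂ] 𝓢(ℝ, ℂ)) : L2 →ₗ.[ℂ] L2 where
  domain := LinearMap.range schwartzToL2
  toFun := (schwartzToL2 ∘ₗ A.toLinearMap) ∘ₗ
    (LinearEquiv.ofInjective schwartzToL2 schwartzToL2_injective).symm.toLinearMap

theorem onSchwartz_apply (A : 𝓢(ℝ, ℂ) →L[ℂ] 𝓢(ℝ, ℂ)) (ψ : 𝓢(ℝ, ℂ)) :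
    onSchwartz A ⟨schwartzToL2 ψ, ψ, rfl⟩ = schwartzToL2 (A ψ) := by
  have h : (LinearEquiv.ofInjective schwartzToL2 schwartzToL2_injective).symm
      ⟨schwartzToL2 ψ, ψ, rfl⟩ = ψ := by
    rw [LinearEquiv.symm_apply_eq]
    rfl
  change schwartzToL2 (A ((LinearEquiv.ofInjective schwartzToL2 schwartzToL2_injective).symm
      ⟨schwartzToL2 ψ, ψ, rfl⟩)) = _
  rw [h]

/-- The operator `Ĥ = ½ x̂ · Q x̂` in `L²(ℝ)`: the closure of this expression on Schwartz
functions. -/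
def hamiltonian (ħ : ℝ) (Q : Matrix (Fin 2) (Fin 2) ℝ) : L2 →ₗ.[ℂ] L2 :=
  (onSchwartz ((1 / 2 : ℂ) • ∑ j, ∑ k, (Q j k : ℂ) • (xOp ħ j ∘L xOp ħ k))).closure

/-- The operator `ξ · x̂ = ξ₀ p̂ + ξ₁ q̂` in `L²(ℝ)`: the closure of this expression on Schwartz
functions. -/
def linearObservable (ħ : ℝ) (ξ : Fin 2 → ℝ) : L2 →ₗ.[ℂ] L2 :=
  (onSchwartz (∑ j, (ξ j : ℂ) • xOp ħ j)).closure

/-- The quadratic form `H(x) = ½ x · Q x`. -/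
def quadForm (Q : Matrix (Fin 2) (Fin 2) ℝ) (x : Fin 2 → ℝ) : ℝ := (1 / 2) * (x ⬝ᵥ Q *ᵥ x)

/-! ### Exponentials and logarithms of unbounded operators -/

universe u

section Exp

variable {E : Type u} [NormedAddCommGroup E] [InnerProductSpace ℂ E] [CompleteSpace E]

/-- `(S t)`, `t ≥ 0`, is a strongly continuous semigroup whose infinitesimal generator is exactly
the (unbounded) operator `L`. -/
structure IsSemigroupGeneratedBy (L : E →ₗ.[ℂ] E) (S : ℝ → E →L[ℂ] E) : Prop where
  zero : S 0 = 1
  add : ∀ s t : ℝ, 0 ≤ s → 0 ≤ t → S (s + t) = S s ∘L S t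
  continuousOn : ∀ ψ : E, ContinuousOn (fun t => S t ψ) (Set.Ici 0)
  generator : ∀ ψ φ : E, (ψ, φ) ∈ L.graph ↔
    Tendsto (fun t : ℝ => ((t⁻¹ : ℝ) : ℂ) • (S t ψ - ψ)) (𝓝[>] 0) (𝓝 φ)

/-- The bounded operator `T` is `e^L`: the value at time one of the strongly continuous semigroup
`e^{tL}` generated by `L`. -/
def IsExp (L : E →ₗ.[ℂ] E) (T : E →L[ℂ] E) : Prop :=
  ∃ S : ℝ → E →L[ℂ] E, IsSemigroupGeneratedBy L S ∧ S 1 = T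

/-- The (unbounded) operator `B` is `ln T`: it is self-adjoint and `e^B = T`. -/
def IsLog (T : E →L[ℂ] E) (B : E →ₗ.[ℂ] E) : Prop := IsSelfAdjoint B ∧ IsExp B T

/-- The operator `L + c`, with the domain of `L`. -/
def addScalar (L : E →ₗ.[ℂ] E) (c : ℂ) : E →ₗ.[ℂ] E :=
  (c • (LinearMap.id : E →ₗ[ℂ] E)) +ᵥ L

/-! ### Trace class operators and states -/

/-- `T` is of trace class: `∑ ⟨b i, |T| b i⟩` converges in orthonormal bases. -/
def IsTraceClass (T : E →L[ℂ] E) : Prop :=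
  ∀ (ι : Type u) (b : HilbertBasis ι ℂ E), Summable fun i => inner ℂ (b i) (CFC.abs T (b i))

/-- `T` is of trace class and `tr T = c`. -/
def HasTrace (T : E →L[ℂ] E) (c : ℂ) : Prop :=
  IsTraceClass T ∧
    ∀ (ι : Type u) (b : HilbertBasis ι ℂ E), HasSum (fun i => inner ℂ (b i) (T (b i))) c

/-- Density operators: positive trace class operators of trace one. -/
def IsDensityOperator (ρ : E →L[ℂ] E) : Prop := ρ.IsPositive ∧ HasTrace ρ 1

end Exp

/-- `χ` is the characteristic function `χ(ξ) = tr [e^{(i/ħ) ξ · x̂} ρ]` of `ρ`. -/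
def HasCharFun (ħ : ℝ) (ρ : L2 →L[ℂ] L2) (χ : (Fin 2 → ℝ) → ℂ) : Prop :=
  ∀ ξ : Fin 2 → ℝ, ∃ V : L2 →L[ℂ] L2,
    IsExp ((Complex.I / (ħ : ℂ)) • linearObservable ħ ξ) V ∧ HasTrace (V ∘L ρ) (χ ξ)

/-- `ρ` is a (centred) Gaussian state with covariance matrix `G`: a density operator with
characteristic function `exp (-(1/(4ħ)) ξ · G ξ)`. -/
def IsGaussianState (ħ : ℝ) (G : Matrix (Fin 2) (Fin 2) ℝ) (ρ : L2 →L[ℂ] L2) : Prop :=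
  IsDensityOperator ρ ∧
    HasCharFun ħ ρ (fun ξ => (Real.exp (-(1 / (4 * ħ)) * (ξ ⬝ᵥ G *ᵥ ξ)) : ℂ))

/-- The matrix `Ω` of the symplectic form on phase space, for which `[x̂ⱼ, x̂ₖ] = iħ Ωⱼₖ`. -/
def Ω : Matrix (Fin 2) (Fin 2) ℝ := !![0, -1; 1, 0]

/-- The uncertainty relation `G + iΩ ≥ 0`. In particular `G` is then symmetric. -/
def UncertaintyRelation (G : Matrix (Fin 2) (Fin 2) ℝ) : Prop :=
  (G.map (fun r : ℝ => (r : ℂ)) + Complex.I • Ω.map (fun r : ℝ => (r : ℂ))).PosSemidef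

/-! ### Weyl quantisation -/

/-- The kernel
`K_A(q, q') = (2πħ)⁻¹ ∫ e^{(i/ħ)(q - q')p} A(p, (q + q')/2) dp` of the Weyl quantisation of `A`. -/
def weylKernel (ħ : ℝ) (A : (Fin 2 → ℝ) → ℂ) (q q' : ℝ) : ℂ :=
  (1 / (2 * Real.pi * ħ) : ℝ) *
    ∫ p : ℝ, Complex.exp (Complex.I / ħ * ((q - q') * p)) * A ![p, (q + q') / 2]

/-- The function `A` is the Weyl symbol of the bounded operator `T`: `T` is the integral operator
with kernel `K_A`, where all integrals converge absolutely. -/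
def HasWeylSymbol (ħ : ℝ) (T : L2 →L[ℂ] L2) (A : (Fin 2 → ℝ) → ℂ) : Prop :=
  (∀ q : ℝ, Integrable fun p : ℝ => A ![p, q]) ∧
    ∀ ψ : L2, ∀ᵐ q : ℝ, Integrable (fun q' : ℝ => weylKernel ħ A q q' * ψ q') ∧
      T ψ q = ∫ q' : ℝ, weylKernel ħ A q q' * ψ q'

/-- The unbounded operator `T` acts on Schwartz functions as the Weyl quantisation of the symbol
`A`, which may grow polynomially:
`(T ψ)(q) = (2πħ)⁻¹ ∫ (∫ e^{(i/ħ)(q - q')p} A(p, (q + q')/2) ψ(q') dq') dp`.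
The kernel `K_A` is a distribution here, so the integral over `q'` is taken first. -/
def ActsAsWeylQuantization (ħ : ℝ) (T : L2 →ₗ.[ℂ] L2) (A : (Fin 2 → ℝ) → ℂ) : Prop :=
  ∀ ψ : 𝓢(ℝ, ℂ), ∃ φ : L2, (schwartzToL2 ψ, φ) ∈ T.graph ∧
    ∀ᵐ q : ℝ,
      (∀ p : ℝ, Integrable fun q' : ℝ =>
        Complex.exp (Complex.I / ħ * ((q - q') * p)) * A ![p, (q + q') / 2] * ψ q') ∧
      (Integrable fun p : ℝ => ∫ q' : ℝ,
        Complex.exp (Complex.I / ħ * ((q - q') * p)) * A ![p, (q + q') / 2] * ψ q') ∧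
      φ q = (1 / (2 * Real.pi * ħ) : ℝ) * ∫ p : ℝ, ∫ q' : ℝ,
        Complex.exp (Complex.I / ħ * ((q - q') * p)) * A ![p, (q + q') / 2] * ψ q'

/-- The inverse hyperbolic cotangent, for `z > 1`. -/
def arcoth (z : ℝ) : ℝ := (1 / 2) * Real.log ((z + 1) / (z - 1))

end WeylCalculus

end

/-! Everything rests on diagonalising `Ĥ` explicitly. For positive definite `Q`, put `ω = √det Q`
and `ν = (ω + i Q₀₁)/Q₀₀`. The Gaussian `exp(-ν q²/(2ħ))` is annihilated by the ladder operator `a`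
built from `ħ d/dq + ν q`, and on Schwartz functions `½ x̂·Qx̂ = ħω(a†a + ½)` (`quadOp_eq`). The
excited states are complete because the coherent states are total and attain equality in Bessel's
inequality. Hence the closure `Ĥ` is exactly the maximal diagonal operator with eigenvalues `ħω(n +
½)` (`isDiagonal_hamiltonian`). Self-adjointness and the existence and uniqueness of `e^{-βĤ}` are
then facts about diagonal operators.

With `τ = ħωβ/2` and `r = e^{-2τ}`, the Gibbs operator has eigenvalues `e^{-τ} rⁿ`, so its trace is
a geometric series. It maps the coherent state at `z` to `e^{-τ}` times the one at `rz`. A single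
Gaussian integral shows that the Weyl kernel of the claimed symbol does the same, with `tanh τ = (1
- r)/(1 + r)` (`integral_mehler_coh`, `hasWeylSymbol_mehler`).

The operator `e^{(i/ħ)ξ·x̂}` is an explicit translation with a phase, and a Stone type argument
makes it the only exponential of its generator (`isExp_linearObservable_iff`). It shifts coherent
states by a complex number `α(ξ)`, and its diagonal elements in the eigenbasis are Laguerre
functions of `|α|²`. Their generating function yields the characteristic function
(`hasTrace_weyl_comp`), and `|α|²` is proportional to `ξ·Q⁻¹ξ`.

For the second part, a Gaussian average of Weyl operators is a rank one operator between coherent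
states, so a density operator is determined by its characteristic function
(`IsDensityOperator.ext`). The choice of `Q` makes the covariance matrix of the thermal state equal
to `G`, whence `ρ = e^{-Ĥ}/Z`. The logarithm is unique because the eigenvalues of `ρ` are simple: a
semigroup with time-one value `ρ` commutes with `ρ`, so it is diagonal in the same basis, and
self-adjointness of its generator excludes the additive ambiguity `2πik` (`IsDiagonal.isLog_iff`).
-/

noncomputable section
namespace WeylCalculus
universe u

/-! ### Generators of strongly continuous semigroups -/

/-- If `t ↦ V t x` is right differentiable with derivative `W t x` for `x` in a set `Γ`, then the
right derivative at `0` persists on the closure of `Γ`, provided that `V t` is bounded for each `t`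
and `W t` is bounded uniformly for small `t`. -/
theorem tendsto_slope_of_mem_closure {X Y : Type*} [NormedAddCommGroup X] [NormedSpace ℂ X]
    [NormedAddCommGroup Y] [NormedSpace ℂ Y] {V W : ℝ → X →L[ℂ] Y} {Γ : Set X} {C : ℝ}
    (hV : ∀ x ∈ Γ, ContinuousOn (fun t => V t x) (Set.Ici 0))
    (hder : ∀ x ∈ Γ, ∀ t, 0 ≤ t → HasDerivWithinAt (fun t => V t x) (W t x) (Set.Ici t) t)
    (hC : ∀ t ∈ Set.Icc (0 : ℝ) 1, ‖W t‖ ≤ C) {x : X} {y : Y} (hx : x ∈ closure Γ)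
    (hW : Tendsto (fun t => W t x) (𝓝[≥] 0) (𝓝 y)) :
    Tendsto (fun t : ℝ => ((t⁻¹ : ℝ) : ℂ) • (V t x - V 0 x)) (𝓝[>] 0) (𝓝 y) := by
  have hC0 : 0 ≤ C := (norm_nonneg _).trans (hC 0 ⟨le_rfl, zero_le_one⟩)
  rw [Metric.tendsto_nhds]
  intro ε hε
  have h1 : ∀ᶠ t in 𝓝[≥] (0 : ℝ), ‖W t x - y‖ < ε / 2 := by
    have := (Metric.tendsto_nhds.1 hW) (ε / 2) (half_pos hε)
    simpa [dist_eq_norm] using this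
  obtain ⟨δ, hδ, hδ'⟩ := mem_nhdsGE_iff_exists_Ico_subset.1 h1
  have key : ∀ t ∈ Set.Ioo 0 (min δ 1), ‖V t x - V 0 x - t • y‖ ≤ ε / 2 * t := by
    intro t ht
    have ht1 : t < δ := lt_of_lt_of_le ht.2 (min_le_left _ _)
    have ht2 : t < 1 := lt_of_lt_of_le ht.2 (min_le_right _ _)
    -- Differentiability of `V · x` is not known at `x` itself. The mean value inequality is used at
    -- `z ∈ Γ` with the extra error `C * ‖z - x‖`; the resulting bound is closed in `z` and the
    -- error vanishes at `z = x`.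
    have hclosed : IsClosed {z : X | ‖V t z - V 0 z - t • y‖ ≤ (C * ‖z - x‖ + ε / 2) * t} :=
      isClosed_le (by fun_prop) (by fun_prop)
    have hsub : Γ ⊆ {z : X | ‖V t z - V 0 z - t • y‖ ≤ (C * ‖z - x‖ + ε / 2) * t} := by
      intro z hz
      have := norm_image_sub_le_of_norm_deriv_right_le_segment
        (f := fun s : ℝ => V s z - s • y) (f' := fun s => W s z - y)
        (C := C * ‖z - x‖ + ε / 2) (a := 0) (b := t) ?_ ?_ ?_ t ⟨ht.1.le, le_rfl⟩
      · simp only [Set.mem_ofPred_eq]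
        calc _ = ‖V t z - t • y - (V 0 z - (0 : ℝ) • y)‖ := by congr 1; simp; abel
          _ ≤ _ := this
          _ = _ := by ring
      · exact ((hV z hz).mono Set.Icc_subset_Ici_self).sub (by fun_prop)
      · intro s hs
        have h2 : HasDerivWithinAt (fun s : ℝ => s • y) ((1 : ℝ) • y) (Set.Ici s) s :=
          (hasDerivAt_id s).hasDerivWithinAt.smul_const y
        rw [one_smul] at h2
        exact (hder z hz s hs.1).sub h2
      · intro s hs
        have e : W s z - y = W s (z - x) + (W s x - y) := by rw [map_sub]; abel
        rw [e]
        refine (norm_add_le _ _).trans (add_le_add ?_ ?_)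
        · exact (W s).le_of_opNorm_le (hC s ⟨hs.1, (hs.2.trans ht2).le⟩) _
        · exact (hδ' ⟨hs.1, hs.2.trans ht1⟩ : ‖W s x - y‖ < ε / 2).le
    have := hclosed.closure_subset_iff.2 hsub hx
    simpa using this
  have hpos : 0 < min δ 1 := lt_min hδ one_pos
  filter_upwards [Ioo_mem_nhdsGT hpos] with t ht
  have ht0 : 0 < t := ht.1
  have hk := key t ht
  have e : ((t⁻¹ : ℝ) : ℂ) • (V t x - V 0 x) - y = t⁻¹ • (V t x - V 0 x - t • y) := by
    rw [Complex.coe_smul, smul_sub t⁻¹ (V t x - V 0 x), smul_smul, inv_mul_cancel₀ ht0.ne', one_smul]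
  rw [dist_eq_norm, e, norm_smul, Real.norm_of_nonneg (inv_nonneg.2 ht0.le)]
  calc t⁻¹ * ‖V t x - V 0 x - t • y‖ ≤ t⁻¹ * (ε / 2 * t) := by gcongr
    _ = ε / 2 := by field_simp
    _ < ε := half_lt_self hε

/-- A continuous linear functional separating a point from a closed subspace. -/
theorem exists_dual_eq_zero_of_notMem {X : Type*} [NormedAddCommGroup X] [NormedSpace ℂ X]
    (K : Submodule ℂ X) (hK : IsClosed (K : Set X)) {x : X} (hx : x ∉ K) :
    ∃ F : X →L[ℂ] ℂ, (∀ k ∈ K, F k = 0) ∧ F x ≠ 0 := by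
  have : IsClosed (K : Set X) := hK
  obtain ⟨g, -, hg⟩ := exists_dual_vector'' ℂ (K.mkQ x)
  refine ⟨g ∘L K.mkQL, fun k hk => ?_, ?_⟩
  · have : K.mkQ k = 0 := by simpa using hk
    change g (K.mkQ k) = 0
    rw [this, map_zero]
  · change g (K.mkQ x) ≠ 0
    rw [hg]
    have : K.mkQ x ≠ 0 := by simpa using hx
    simpa using this

section Semigroup

variable {E : Type u} [NormedAddCommGroup E] [InnerProductSpace ℂ E]

theorem hasDerivWithinAt_Ici_of_tendsto {f : ℝ → E} {φ : E} {t : ℝ}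
    (h : Tendsto (fun s : ℝ => ((s⁻¹ : ℝ) : ℂ) • (f (t + s) - f t)) (𝓝[>] 0) (𝓝 φ)) :
    HasDerivWithinAt f φ (Set.Ici t) t := by
  rw [← hasDerivWithinAt_Ioi_iff_Ici, hasDerivWithinAt_iff_tendsto_slope' (by simp)]
  have h1 : Tendsto (fun y : ℝ => y - t) (𝓝[>] t) (𝓝[>] 0) := by
    refine tendsto_nhdsWithin_iff.2 ⟨?_, ?_⟩
    · have : Tendsto (fun y : ℝ => y - t) (𝓝 t) (𝓝 (t - t)) :=
        (continuous_id.sub continuous_const).tendsto t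
      rw [sub_self] at this
      exact this.mono_left nhdsWithin_le_nhds
    · filter_upwards [self_mem_nhdsWithin] with y hy
      exact sub_pos.2 (Set.mem_Ioi.1 hy)
  refine (h.comp h1).congr fun y => ?_
  simp only [slope_def_module, Function.comp, Complex.coe_smul, add_sub_cancel]

theorem tendsto_of_hasDerivWithinAt_zero {f : ℝ → E} {φ : E}
    (h : HasDerivWithinAt f φ (Set.Ici 0) 0) :
    Tendsto (fun s : ℝ => ((s⁻¹ : ℝ) : ℂ) • (f s - f 0)) (𝓝[>] 0) (𝓝 φ) := by
  rw [← hasDerivWithinAt_Ioi_iff_Ici, hasDerivWithinAt_iff_tendsto_slope' (by simp)] at h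
  refine h.congr fun y => ?_
  simp only [slope_def_module, Complex.coe_smul, sub_zero]

/-- The infinitesimal generator of a strongly continuous semigroup is the closure of its
restriction to any dense invariant subspace of its domain. -/
theorem tendsto_generator_iff_mem_closure {S : ℝ → E →L[ℂ] E} (Γ : Submodule ℂ (E × E)) {C : ℝ}
    (h0 : S 0 = 1) (hadd : ∀ s t : ℝ, 0 ≤ s → 0 ≤ t → S (s + t) = S s ∘L S t)
    (hcont : ∀ ψ : E, ContinuousOn (fun t => S t ψ) (Set.Ici 0))
    (hC : ∀ t ∈ Set.Icc (0 : ℝ) 1, ‖S t‖ ≤ C)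
    (hder : ∀ f g, (f, g) ∈ Γ →
      Tendsto (fun t : ℝ => ((t⁻¹ : ℝ) : ℂ) • (S t f - f)) (𝓝[>] 0) (𝓝 g))
    (hinv : ∀ t, 0 ≤ t → ∀ f g, (f, g) ∈ Γ → (S t f, S t g) ∈ Γ)
    (hdense : Dense (Prod.fst '' (Γ : Set (E × E)))) (ψ φ : E) :
    (ψ, φ) ∈ closure (Γ : Set (E × E)) ↔
      Tendsto (fun t : ℝ => ((t⁻¹ : ℝ) : ℂ) • (S t ψ - ψ)) (𝓝[>] 0) (𝓝 φ) := by
  have hder' : ∀ f g, (f, g) ∈ Γ → ∀ t, 0 ≤ t →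
      HasDerivWithinAt (fun t => S t f) (S t g) (Set.Ici t) t := by
    intro f g hfg t ht
    apply hasDerivWithinAt_Ici_of_tendsto
    refine (((S t).continuous.tendsto _).comp (hder f g hfg)).congr' ?_
    filter_upwards [self_mem_nhdsWithin] with s hs
    simp only [Function.comp, hadd t s ht (le_of_lt hs)]
    rw [map_smul, map_sub]
    rfl
  have hS0 : ∀ χ, Tendsto (fun t => S t χ) (𝓝[≥] 0) (𝓝 χ) := by
    intro χ
    have := (hcont χ 0 (Set.self_mem_Ici))
    simpa [ContinuousWithinAt, h0] using this
  have hC0 : 0 ≤ C := (norm_nonneg _).trans (hC 0 ⟨le_rfl, zero_le_one⟩)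
  constructor
  · intro h
    have := tendsto_slope_of_mem_closure (V := fun t => S t ∘L ContinuousLinearMap.fst ℂ E E)
      (W := fun t => S t ∘L ContinuousLinearMap.snd ℂ E E) (Γ := (Γ : Set (E × E))) (C := C)
      (x := (ψ, φ)) (y := φ) (fun x _ => hcont x.1) (fun x hx t ht => hder' x.1 x.2 hx t ht) ?_ h
      (hS0 φ)
    · simpa [h0] using this
    · intro t ht
      refine ContinuousLinearMap.opNorm_le_bound _ hC0 fun x => ?_
      calc ‖S t x.2‖ ≤ C * ‖x.2‖ := (S t).le_of_opNorm_le (hC t ht) _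
        _ ≤ C * ‖x‖ := by gcongr; exact norm_snd_le x
  · intro h
    -- Duality: a functional `F = (F₁, F₂)` vanishing on `Γ` satisfies `F₂ (S t g) = -F₁ (S t f)`
    -- there, by invariance. So `F₂ (S t f)` has derivative `-F₁ (S t f)`, a formula free of `g`,
    -- which extends from the dense set of first components to `ψ`. Comparison with the assumed
    -- limit gives `F₂ φ = -F₁ ψ`, that is `F (ψ, φ) = 0`.
    by_contra hn
    rw [← Submodule.topologicalClosure_coe] at hn
    obtain ⟨F, hF, hF'⟩ := exists_dual_eq_zero_of_notMem Γ.topologicalClosure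
      Γ.isClosed_topologicalClosure hn
    set F₁ := F ∘L ContinuousLinearMap.inl ℂ E E with hF₁
    set F₂ := F ∘L ContinuousLinearMap.inr ℂ E E with hF₂
    have hF12 : ∀ x y, F (x, y) = F₁ x + F₂ y := by
      intro x y
      simp [hF₁, hF₂, ← map_add]
    have hz : ∀ f g, (f, g) ∈ Γ → F₂ g = -F₁ f := by
      intro f g hfg
      have := hF _ (Γ.le_topologicalClosure hfg)
      rw [hF12] at this
      linear_combination this
    have h3 := tendsto_slope_of_mem_closure (V := fun t => F₂ ∘L S t)
      (W := fun t => -(F₁ ∘L S t)) (Γ := Prod.fst '' (Γ : Set (E × E))) (C := ‖F₁‖ * C)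
      (x := ψ) (y := -F₁ ψ) ?_ ?_ ?_ (hdense ψ) ?_
    · have h4 := ((F₂.continuous.tendsto _).comp h)
      have h5 := tendsto_nhds_unique h4 (h3.congr fun t => ?_)
      · apply hF'
        rw [hF12, h5, add_neg_cancel]
      · simp [h0]
    · rintro x -
      exact F₂.continuous.comp_continuousOn (hcont x)
    · rintro x ⟨⟨f, g⟩, hfg, rfl⟩ t ht
      have h6 := (F₂.restrictScalars ℝ).hasFDerivAt.comp_hasDerivWithinAt t (hder' f g hfg t ht)
      have h7 := hz _ _ (hinv t ht f g hfg)
      simp only [neg_apply, ContinuousLinearMap.comp_apply]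
      rw [← h7]
      exact h6
    · intro t ht
      rw [norm_neg]
      exact (ContinuousLinearMap.opNorm_comp_le _ _).trans (by gcongr; exact hC t ht)
    · have h8 := ((F₁.continuous.tendsto _).comp (hS0 ψ)).neg
      exact h8

namespace IsSemigroupGeneratedBy

variable {L : E →ₗ.[ℂ] E} {S : ℝ → E →L[ℂ] E}

theorem hasDerivWithinAt (hS : IsSemigroupGeneratedBy L S) {ψ φ : E} (h : (ψ, φ) ∈ L.graph)
    {t : ℝ} (ht : 0 ≤ t) : HasDerivWithinAt (fun t => S t ψ) (S t φ) (Set.Ici t) t := by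
  apply hasDerivWithinAt_Ici_of_tendsto
  refine (((S t).continuous.tendsto _).comp ((hS.generator ψ φ).1 h)).congr' ?_
  filter_upwards [self_mem_nhdsWithin] with s hs
  simp only [Function.comp, hS.add t s ht (le_of_lt hs)]
  rw [map_smul, map_sub]
  rfl

theorem mem_graph_map (hS : IsSemigroupGeneratedBy L S) {ψ φ : E} (h : (ψ, φ) ∈ L.graph)
    {t : ℝ} (ht : 0 ≤ t) : (S t ψ, S t φ) ∈ L.graph := by
  rw [hS.generator]
  refine (((S t).continuous.tendsto _).comp ((hS.generator ψ φ).1 h)).congr' ?_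
  filter_upwards [self_mem_nhdsWithin] with s hs
  have e : S t ∘L S s = S s ∘L S t := by
    rw [← hS.add t s ht (le_of_lt hs), ← hS.add s t (le_of_lt hs) ht, add_comm]
  have e' : S t (S s ψ) = S s (S t ψ) := congrArg (fun T : E →L[ℂ] E => T ψ) e
  simp only [Function.comp]
  rw [map_smul, map_sub, e']

/-- The product `exp (-sμ) • S s h` has vanishing right derivative. With a total set of eigenvectors
this already makes the exponential unique, so no general uniqueness theorem for semigroups is
needed. -/
theorem apply_eigenvector (hS : IsSemigroupGeneratedBy L S) {h : E} {μ : ℂ}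
    (hμ : (h, μ • h) ∈ L.graph) {t : ℝ} (ht : 0 ≤ t) : S t h = Complex.exp (t * μ) • h := by
  have hexp : ∀ s : ℝ, HasDerivAt (fun s : ℝ => Complex.exp (-(s * μ)))
      (Complex.exp (-(s * μ)) * (-μ)) s := by
    intro s
    have h1 : HasDerivAt (fun s : ℝ => -((s : ℂ) * μ)) (-(1 * μ)) s :=
      ((Complex.ofRealCLM.hasDerivAt (x := s)).mul_const μ).neg
    rw [one_mul] at h1
    exact h1.cexp
  have hconst := constant_of_has_deriv_right_zero
    (f := fun s : ℝ => Complex.exp (-(s * μ)) • S s h) (a := 0) (b := t) ?_ ?_ t ⟨ht, le_rfl⟩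
  · simp only [Complex.ofReal_zero, zero_mul, neg_zero, Complex.exp_zero, one_smul, hS.zero,
      one_apply_eq_self] at hconst
    rw [← congrArg (fun x => Complex.exp (t * μ) • x) hconst, smul_smul, ← Complex.exp_add]
    simp
  · exact ContinuousOn.smul (by fun_prop) ((hS.continuousOn h).mono Set.Icc_subset_Ici_self)
  · intro s hs
    have h2 := (hexp s).hasDerivWithinAt.smul (hS.hasDerivWithinAt hμ hs.1)
    refine h2.congr_deriv ?_
    rw [map_smul, smul_smul, mul_neg, neg_smul, add_neg_cancel]

end IsSemigroupGeneratedBy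

/-- Strong convergence of uniformly bounded operators may be tested on a total set. -/
theorem tendsto_clm_of_total {ι : Type*} {l : Filter ι} {T : ι → E →L[ℂ] E} {T₀ : E →L[ℂ] E}
    {C : ℝ} (hC : ∀ᶠ i in l, ‖T i‖ ≤ C) {D : Set E}
    (hD : (Submodule.span ℂ D).topologicalClosure = ⊤)
    (h : ∀ d ∈ D, Tendsto (fun i => T i d) l (𝓝 (T₀ d))) (ψ : E) :
    Tendsto (fun i => T i ψ) l (𝓝 (T₀ ψ)) := by
  have hspan : ∀ d ∈ Submodule.span ℂ D, Tendsto (fun i => T i d) l (𝓝 (T₀ d)) := by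
    intro d hd
    induction hd using Submodule.span_induction with
    | mem x hx => exact h x hx
    | zero => simp only [map_zero]; exact tendsto_const_nhds
    | add x y _ _ hx hy => simpa using hx.add hy
    | smul c x _ hx => simpa using hx.const_smul c
  rw [Metric.tendsto_nhds]
  intro ε hε
  have hψ : ψ ∈ closure (Submodule.span ℂ D : Set E) := by
    rw [← Submodule.topologicalClosure_coe, hD]
    trivial
  set C' := max C 0 with hC'
  have hC0 : 0 ≤ C' := le_max_right _ _
  have hpos : 0 < C' + ‖T₀‖ + 1 := by positivity
  obtain ⟨d, hd, hdψ⟩ := Metric.mem_closure_iff.1 hψ (ε / 2 / (C' + ‖T₀‖ + 1)) (by positivity)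
  have h2 := (Metric.tendsto_nhds.1 (hspan d hd)) (ε / 2) (half_pos hε)
  filter_upwards [hC, h2] with i hi h3
  rw [dist_eq_norm] at *
  have e : T i ψ - T₀ ψ = T i (ψ - d) + (T i d - T₀ d) - T₀ (ψ - d) := by
    rw [map_sub, map_sub]; abel
  rw [e]
  have h4 : ‖T i (ψ - d)‖ ≤ C' * ‖ψ - d‖ :=
    (T i).le_of_opNorm_le (hi.trans (le_max_left _ _)) _
  have h5 : ‖T₀ (ψ - d)‖ ≤ ‖T₀‖ * ‖ψ - d‖ := T₀.le_opNorm _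
  have h6 : (C' + ‖T₀‖ + 1) * ‖ψ - d‖ < ε / 2 := by
    rw [lt_div_iff₀ hpos] at hdψ
    linarith
  have h7 := norm_nonneg (ψ - d)
  calc _ ≤ ‖T i (ψ - d) + (T i d - T₀ d)‖ + ‖T₀ (ψ - d)‖ := norm_sub_le _ _
    _ ≤ ‖T i (ψ - d)‖ + ‖T i d - T₀ d‖ + ‖T₀ (ψ - d)‖ := by gcongr; exact norm_add_le _ _
    _ < ε := by nlinarith

theorem clm_ext_of_total {T T' : E →L[ℂ] E} {D : Set E}
    (hD : (Submodule.span ℂ D).topologicalClosure = ⊤) (h : ∀ d ∈ D, T d = T' d) : T = T' :=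
  ContinuousLinearMap.ext_on ((Submodule.dense_iff_topologicalClosure_eq_top).2 hD) h

end Semigroup

end WeylCalculus
end

noncomputable section
namespace WeylCalculus
universe u

/-! ### Diagonal operators -/

section Diagonal

variable {E : Type u} [NormedAddCommGroup E] [InnerProductSpace ℂ E]

theorem hilbertBasis_ext {ι : Type*} (b : HilbertBasis ι ℂ E) {x y : E}
    (h : ∀ n, inner ℂ (b n) x = inner ℂ (b n) y) : x = y := by
  apply b.repr.injective
  ext n
  simpa [b.repr_apply_apply] using h n

theorem hilbertBasis_inner {ι : Type*} [DecidableEq ι] (b : HilbertBasis ι ℂ E) (m n : ι) :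
    inner ℂ (b m) (b n) = if m = n then (1 : ℂ) else 0 :=
  orthonormal_iff_ite.1 b.orthonormal m n

theorem hilbertBasis_hasSum_norm_sq {ι : Type*} (b : HilbertBasis ι ℂ E) (x : E) :
    HasSum (fun n => ‖inner ℂ (b n) x‖ ^ 2) (‖x‖ ^ 2) := by
  have h := b.hasSum_inner_mul_inner x x
  have h2 := (Complex.hasSum_iff _ _).1 h
  convert h2.1 using 2 with n
  · rw [← inner_conj_symm x (b n), Complex.conj_mul']
    norm_cast
  · rw [inner_self_eq_norm_sq_to_K]
    norm_cast

theorem exists_diagonal (b : HilbertBasis ℕ ℂ E) (c : ℕ → ℂ) {C : ℝ} (hC : 0 ≤ C)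
    (hc : ∀ n, ‖c n‖ ≤ C) :
    ∃ T : E →L[ℂ] E, ‖T‖ ≤ C ∧ ∀ ψ n, inner ℂ (b n) (T ψ) = c n * inner ℂ (b n) ψ := by
  have hle : ∀ ψ n, ‖c n * inner ℂ (b n) ψ‖ ^ 2 ≤ C ^ 2 * ‖inner ℂ (b n) ψ‖ ^ 2 := by
    intro ψ n
    rw [norm_mul, mul_pow]
    gcongr
    exact hc n
  have hsum : ∀ ψ, Summable fun n => ‖c n * inner ℂ (b n) ψ‖ ^ 2 := fun ψ =>
    Summable.of_nonneg_of_le (fun n => by positivity) (hle ψ)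
      ((hilbertBasis_hasSum_norm_sq b ψ).summable.mul_left _)
  have hmem : ∀ ψ, Memℓp (fun n => c n * inner ℂ (b n) ψ) 2 := by
    intro ψ
    rw [memℓp_gen_iff (by norm_num)]
    simpa using hsum ψ
  let f : E →ₗ[ℂ] E :=
    { toFun := fun ψ => b.repr.symm ⟨fun n => c n * inner ℂ (b n) ψ, hmem ψ⟩
      map_add' := fun x y => by
        rw [← map_add]
        congr 1
        ext n
        simp [mul_add]
        rfl
      map_smul' := fun a x => by
        rw [RingHom.id_apply, ← map_smul]
        congr 1
        ext n
        simp
        ring }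
  have hf : ∀ ψ n, inner ℂ (b n) (f ψ) = c n * inner ℂ (b n) ψ := by
    intro ψ n
    rw [← b.repr_apply_apply]
    simp [f]
  have hb : ∀ ψ, ‖f ψ‖ ≤ C * ‖ψ‖ := by
    intro ψ
    have h1 := hilbertBasis_hasSum_norm_sq b (f ψ)
    have h2 := (hilbertBasis_hasSum_norm_sq b ψ).mul_left (C ^ 2)
    have h3 := hasSum_le (fun n => by rw [hf]; exact hle ψ n) h1 h2
    rw [← mul_pow] at h3
    exact (pow_le_pow_iff_left₀ (norm_nonneg _) (by positivity) two_ne_zero).1 h3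
  exact ⟨f.mkContinuous C hb, f.mkContinuous_norm_le hC hb, hf⟩

open Classical in
/-- The bounded operator which is diagonal in the basis `b` with the bounded sequence of
eigenvalues `c` (and `0` if `c` is not bounded). -/
def diagOp (b : HilbertBasis ℕ ℂ E) (c : ℕ → ℂ) : E →L[ℂ] E :=
  if h : ∃ C, 0 ≤ C ∧ ∀ n, ‖c n‖ ≤ C then (exists_diagonal b c h.choose_spec.1
    h.choose_spec.2).choose else 0

theorem inner_diagOp (b : HilbertBasis ℕ ℂ E) {c : ℕ → ℂ} {C : ℝ} (hc : ∀ n, ‖c n‖ ≤ C)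
    (ψ : E) (n : ℕ) : inner ℂ (b n) (diagOp b c ψ) = c n * inner ℂ (b n) ψ := by
  have h : ∃ C, 0 ≤ C ∧ ∀ n, ‖c n‖ ≤ C := ⟨C, (norm_nonneg _).trans (hc 0), hc⟩
  rw [diagOp, dif_pos h]
  exact (exists_diagonal b c h.choose_spec.1 h.choose_spec.2).choose_spec.2 ψ n

theorem norm_diagOp_le (b : HilbertBasis ℕ ℂ E) {c : ℕ → ℂ} {C : ℝ} (hc : ∀ n, ‖c n‖ ≤ C) :
    ‖diagOp b c‖ ≤ C := by
  obtain ⟨T, hT, hT'⟩ := exists_diagonal b c ((norm_nonneg _).trans (hc 0)) hc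
  have : diagOp b c = T := by
    ext ψ
    exact hilbertBasis_ext b fun n => by rw [inner_diagOp b hc, hT']
  rwa [this]

theorem diagOp_apply_basis (b : HilbertBasis ℕ ℂ E) {c : ℕ → ℂ} {C : ℝ} (hc : ∀ n, ‖c n‖ ≤ C)
    (n : ℕ) : diagOp b c (b n) = c n • b n := by
  apply hilbertBasis_ext b
  intro m
  rw [inner_diagOp b hc, inner_smul_right, hilbertBasis_inner]
  split_ifs with h
  · rw [h]
  · simp

theorem eq_diagOp (b : HilbertBasis ℕ ℂ E) {c : ℕ → ℂ} {C : ℝ} (hc : ∀ n, ‖c n‖ ≤ C)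
    {T : E →L[ℂ] E} (hT : ∀ n, T (b n) = c n • b n) : T = diagOp b c := by
  refine clm_ext_of_total b.dense_span ?_
  rintro _ ⟨n, rfl⟩
  rw [hT, diagOp_apply_basis b hc]

theorem diagOp_comp (b : HilbertBasis ℕ ℂ E) {c d e : ℕ → ℂ} {C D : ℝ} (hc : ∀ n, ‖c n‖ ≤ C)
    (hd : ∀ n, ‖d n‖ ≤ D) (he : ∀ n, e n = c n * d n) :
    diagOp b e = diagOp b c ∘L diagOp b d := by
  have he' : ∀ n, ‖e n‖ ≤ C * D := fun n => by
    rw [he, norm_mul]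
    exact mul_le_mul (hc n) (hd n) (norm_nonneg _) ((norm_nonneg _).trans (hc n))
  ext ψ
  refine hilbertBasis_ext b fun n => ?_
  rw [inner_diagOp b he', ContinuousLinearMap.comp_apply, inner_diagOp b hc, inner_diagOp b hd,
    he, mul_assoc]

/-- The partial sums of the expansions of `ψ` and `φ` over the same finite index set lie in the span
and converge together. Thus the eigenvectors form a core of the maximal diagonal operator. -/
theorem mem_closure_span_of_inner (b : HilbertBasis ℕ ℂ E) {μ : ℕ → ℝ} {ψ φ : E}
    (h : ∀ n, inner ℂ (b n) φ = (μ n : ℂ) * inner ℂ (b n) ψ) :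
    (ψ, φ) ∈ closure (Submodule.span ℂ (Set.range fun n => (b n, (μ n : ℂ) • b n)) :
      Set (E × E)) := by
  have h3 := (b.hasSum_repr ψ).prodMk (b.hasSum_repr φ)
  refine mem_closure_of_tendsto h3 (Eventually.of_forall fun s => ?_)
  refine Submodule.sum_mem _ fun n _ => ?_
  have : (b.repr ψ n • b n, b.repr φ n • b n) = b.repr ψ n • (b n, (μ n : ℂ) • b n) := by
    rw [Prod.smul_mk, smul_smul, b.repr_apply_apply, b.repr_apply_apply, h n, mul_comm]
  rw [this]
  exact Submodule.smul_mem _ _ (Submodule.subset_span ⟨n, rfl⟩)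

/-- The unbounded operator `L` is diagonal in the basis `b`, with real eigenvalues `μ` and with its
maximal domain. -/
def IsDiagonal (b : HilbertBasis ℕ ℂ E) (μ : ℕ → ℝ) (L : E →ₗ.[ℂ] E) : Prop :=
  ∀ ψ φ, (ψ, φ) ∈ L.graph ↔ ∀ n, inner ℂ (b n) φ = (μ n : ℂ) * inner ℂ (b n) ψ

namespace IsDiagonal

variable {b : HilbertBasis ℕ ℂ E} {μ : ℕ → ℝ} {L : E →ₗ.[ℂ] E}

theorem ext {L' : E →ₗ.[ℂ] E} (h : IsDiagonal b μ L) (h' : IsDiagonal b μ L') : L = L' := by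
  apply LinearPMap.eq_of_eq_graph
  ext ⟨ψ, φ⟩
  rw [h ψ φ, h' ψ φ]

theorem mem_graph_basis (h : IsDiagonal b μ L) (n : ℕ) : (b n, (μ n : ℂ) • b n) ∈ L.graph := by
  rw [h]
  intro m
  rw [inner_smul_right, hilbertBasis_inner]
  split_ifs with e
  · rw [e]
  · simp

/-- The case `c = 0` must be excluded: `0 • L` keeps the domain of `L`, whereas zero eigenvalues
have the whole space as maximal domain. -/
theorem smul (h : IsDiagonal b μ L) {c : ℝ} (hc : c ≠ 0) :
    IsDiagonal b (fun n => c * μ n) ((c : ℂ) • L) := by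
  have hc' : (c : ℂ) ≠ 0 := by exact_mod_cast hc
  intro ψ φ
  have : (ψ, φ) ∈ ((c : ℂ) • L).graph ↔ (ψ, (c : ℂ)⁻¹ • φ) ∈ L.graph := by
    simp only [LinearPMap.mem_graph_iff, LinearPMap.smul_apply]
    constructor
    · rintro ⟨y, hy, rfl⟩
      exact ⟨y, hy, by rw [smul_smul, inv_mul_cancel₀ hc', one_smul]⟩
    · rintro ⟨y, hy, hy'⟩
      exact ⟨y, hy, by rw [hy', smul_smul, mul_inv_cancel₀ hc', one_smul]⟩
  rw [this, h]
  refine forall_congr' fun n => ?_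
  rw [inner_smul_right, inv_mul_eq_iff_eq_mul₀ hc']
  push_cast
  rw [mul_assoc]

theorem addScalar (h : IsDiagonal b μ L) (c : ℝ) :
    IsDiagonal b (fun n => μ n + c) (addScalar L c) := by
  intro ψ φ
  have : (ψ, φ) ∈ (WeylCalculus.addScalar L c).graph ↔ (ψ, φ - (c : ℂ) • ψ) ∈ L.graph := by
    simp only [LinearPMap.mem_graph_iff]
    constructor
    · rintro ⟨y, hy, hy'⟩
      refine ⟨y, hy, ?_⟩
      change (c : ℂ) • (y : E) + L y = φ at hy'
      rw [← hy', ← hy]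
      simp
    · rintro ⟨y, hy, hy'⟩
      refine ⟨y, hy, ?_⟩
      change (c : ℂ) • (y : E) + L y = φ
      rw [hy', hy]
      simp
  rw [this, h]
  refine forall_congr' fun n => ?_
  rw [inner_sub_right, inner_smul_right, sub_eq_iff_eq_add]
  push_cast
  rw [add_mul]

theorem isSymm (h : IsDiagonal b μ L) {ψ φ ψ' φ' : E} (h1 : (ψ, φ) ∈ L.graph)
    (h2 : (ψ', φ') ∈ L.graph) : inner ℂ φ ψ' = inner ℂ ψ φ' := by
  refine (b.hasSum_inner_mul_inner φ ψ').unique ?_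
  refine (b.hasSum_inner_mul_inner ψ φ').congr_fun fun n => ?_
  rw [(h _ _).1 h2 n, ← inner_conj_symm φ, (h _ _).1 h1 n, map_mul, inner_conj_symm,
    Complex.conj_ofReal]
  ring

theorem dense_domain (h : IsDiagonal b μ L) : Dense (L.domain : Set E) := by
  have : Submodule.span ℂ (Set.range b) ≤ L.domain := by
    rw [Submodule.span_le]
    rintro _ ⟨n, rfl⟩
    exact LinearPMap.mem_domain_of_mem_graph (h.mem_graph_basis n)
  exact (Submodule.dense_iff_topologicalClosure_eq_top.2 b.dense_span).mono this

theorem mem_closure_span (h : IsDiagonal b μ L) {ψ φ : E} (hψ : (ψ, φ) ∈ L.graph) :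
    (ψ, φ) ∈ closure (Submodule.span ℂ (Set.range fun n => (b n, (μ n : ℂ) • b n)) :
      Set (E × E)) :=
  mem_closure_span_of_inner b ((h ψ φ).1 hψ)

theorem norm_exp_le {M : ℝ} (hμ : ∀ n, μ n ≤ M) {t : ℝ} (ht : 0 ≤ t) (n : ℕ) :
    ‖Complex.exp (t * μ n)‖ ≤ Real.exp (t * M) := by
  rw [← Complex.ofReal_mul, Complex.norm_exp_ofReal]
  exact Real.exp_le_exp.2 (mul_le_mul_of_nonneg_left (hμ n) ht)

/-- The span of the eigenvectors is invariant and is a core, so `tendsto_generator_iff_mem_closure`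
identifies the generator. The absolute value in `|t|` keeps the eigenvalues bounded for negative
`t`, where the semigroup law demands nothing but `diagOp` could otherwise fall back to its default
value. -/
theorem isSemigroupGeneratedBy (h : IsDiagonal b μ L) {M : ℝ} (hμ : ∀ n, μ n ≤ M) :
    IsSemigroupGeneratedBy L (fun t => diagOp b fun n => Complex.exp ((|t| : ℝ) * μ n)) := by
  have hM : ∀ t : ℝ, ∀ n, ‖Complex.exp ((|t| : ℝ) * μ n)‖ ≤ Real.exp (|t| * |M|) := fun t n =>
    norm_exp_le (fun n => (hμ n).trans (le_abs_self M)) (abs_nonneg t) n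
  set S : ℝ → E →L[ℂ] E := fun t => diagOp b fun n => Complex.exp ((|t| : ℝ) * μ n) with hS
  have hSb : ∀ t n, S t (b n) = Complex.exp ((|t| : ℝ) * μ n) • b n := fun t n =>
    diagOp_apply_basis b (hM t) n
  have h0 : S 0 = 1 := clm_ext_of_total b.dense_span (by rintro _ ⟨n, rfl⟩; simp [hSb])
  have hadd : ∀ s t : ℝ, 0 ≤ s → 0 ≤ t → S (s + t) = S s ∘L S t := by
    intro s t hs ht
    refine diagOp_comp b (hM s) (hM t) fun n => ?_
    rw [abs_of_nonneg hs, abs_of_nonneg ht, abs_of_nonneg (add_nonneg hs ht), ← Complex.exp_add]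
    push_cast
    ring_nf
  have hcont : ∀ ψ, Continuous fun t => S t ψ := by
    intro ψ
    refine continuous_iff_continuousAt.2 fun t₀ => ?_
    refine tendsto_clm_of_total (C := Real.exp ((|t₀| + 1) * |M|)) ?_ b.dense_span ?_ ψ
    · have : ∀ᶠ t in 𝓝 t₀, |t| < |t₀| + 1 :=
        (continuous_abs.tendsto t₀).eventually_lt_const (lt_add_one _)
      filter_upwards [this] with t ht
      refine (norm_diagOp_le b (hM t)).trans (Real.exp_le_exp.2 ?_)
      gcongr
    · rintro _ ⟨n, rfl⟩
      simp only [hSb]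
      exact Continuous.tendsto (f := fun t : ℝ => Complex.exp ((|t| : ℝ) * μ n) • b n)
        (by fun_prop) t₀
  set Γ : Submodule ℂ (E × E) := Submodule.span ℂ (Set.range fun n => (b n, (μ n : ℂ) • b n))
    with hΓ
  have hder : ∀ f g, (f, g) ∈ Γ →
      Tendsto (fun t : ℝ => ((t⁻¹ : ℝ) : ℂ) • (S t f - f)) (𝓝[>] 0) (𝓝 g) := by
    suffices H : ∀ x ∈ Γ, Tendsto (fun t : ℝ => ((t⁻¹ : ℝ) : ℂ) • (S t x.1 - x.1))
        (𝓝[>] 0) (𝓝 x.2) from fun f g hfg => H _ hfg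
    intro x hx
    induction hx using Submodule.span_induction with
    | mem x hx =>
      obtain ⟨n, rfl⟩ := hx
      have h1 : HasDerivWithinAt (fun t : ℝ => Complex.exp (t * μ n) • b n)
          ((Complex.exp ((0 : ℝ) * μ n) * (1 * μ n)) • b n) (Set.Ici 0) 0 :=
        ((((Complex.ofRealCLM.hasDerivAt (x := 0)).mul_const (μ n : ℂ)).cexp).smul_const
          (b n)).hasDerivWithinAt
      have h2 := tendsto_of_hasDerivWithinAt_zero h1
      simp only [Complex.ofReal_zero, zero_mul, Complex.exp_zero, one_mul, one_smul] at h2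
      refine h2.congr' ?_
      filter_upwards [self_mem_nhdsWithin] with t ht
      rw [hSb, abs_of_pos ht]
    | zero => simp only [Prod.fst_zero, map_zero, sub_zero, smul_zero]; exact tendsto_const_nhds
    | add x y _ _ hx hy =>
      refine (hx.add hy).congr fun t => ?_
      rw [← smul_add, Prod.fst_add, map_add]
      congr 1
      abel
    | smul c x _ hx =>
      refine (hx.const_smul c).congr fun t => ?_
      rw [smul_comm, smul_sub, Prod.smul_fst, map_smul]
  have hinv : ∀ t, 0 ≤ t → ∀ f g, (f, g) ∈ Γ → (S t f, S t g) ∈ Γ := by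
    intro t _
    suffices H : ∀ x ∈ Γ, (S t x.1, S t x.2) ∈ Γ from fun f g hfg => H _ hfg
    intro x hx
    induction hx using Submodule.span_induction with
    | mem x hx =>
      obtain ⟨n, rfl⟩ := hx
      have : (S t (b n), S t ((μ n : ℂ) • b n)) =
          Complex.exp ((|t| : ℝ) * μ n) • (b n, (μ n : ℂ) • b n) := by
        rw [map_smul, hSb, smul_comm, Prod.smul_mk]
      rw [this]
      exact Submodule.smul_mem _ _ (Submodule.subset_span ⟨n, rfl⟩)
    | zero => simp only [Prod.fst_zero, Prod.snd_zero, map_zero]; exact Γ.zero_mem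
    | add x y _ _ hx hy => simpa using Γ.add_mem hx hy
    | smul c x _ hx => simpa using Γ.smul_mem c hx
  have hdense : Dense (Prod.fst '' (Γ : Set (E × E))) := by
    refine (Submodule.dense_iff_topologicalClosure_eq_top.2 b.dense_span).mono ?_
    have : Submodule.span ℂ (Set.range b) ≤ Γ.map (LinearMap.fst ℂ E E) := by
      rw [Submodule.span_le]
      rintro _ ⟨n, rfl⟩
      exact ⟨_, Submodule.subset_span ⟨n, rfl⟩, rfl⟩
    exact this
  have hgen := tendsto_generator_iff_mem_closure Γ (C := Real.exp |M|) h0 hadd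
    (fun ψ => (hcont ψ).continuousOn) ?_ hder hinv hdense
  · refine ⟨h0, hadd, fun ψ => (hcont ψ).continuousOn, fun ψ φ => ⟨fun hψ => ?_, fun hψ => ?_⟩⟩
    · exact (hgen ψ φ).1 (h.mem_closure_span hψ)
    · have h1 := (hgen ψ φ).2 hψ
      rw [h]
      intro n
      have hclosed : IsClosed {x : E × E | inner ℂ (b n) x.2 = (μ n : ℂ) * inner ℂ (b n) x.1} :=
        isClosed_eq (by fun_prop) (by fun_prop)
      refine hclosed.closure_subset_iff.2 ?_ h1
      have hle : Γ ≤ L.graph := by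
        rw [hΓ, Submodule.span_le]
        rintro _ ⟨n, rfl⟩
        exact h.mem_graph_basis n
      exact fun x hx => (h x.1 x.2).1 (hle hx) n
  · intro t ht
    refine (norm_diagOp_le b (hM t)).trans (Real.exp_le_exp.2 ?_)
    rw [abs_of_nonneg ht.1]
    exact mul_le_of_le_one_left (abs_nonneg M) ht.2

/-- The exponential of a diagonal operator which is bounded above. -/
theorem isExp_iff (h : IsDiagonal b μ L) {M : ℝ} (hμ : ∀ n, μ n ≤ M) (T : E →L[ℂ] E) :
    IsExp L T ↔ T = diagOp b fun n => Complex.exp (μ n) := by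
  constructor
  · rintro ⟨S, hS, rfl⟩
    refine eq_diagOp b (C := Real.exp M) (fun n => ?_) fun n => ?_
    · simpa using norm_exp_le hμ zero_le_one n
    · simpa using hS.apply_eigenvector (h.mem_graph_basis n) zero_le_one
  · rintro rfl
    exact ⟨_, h.isSemigroupGeneratedBy hμ, by simp⟩

theorem isExp_iff_apply (h : IsDiagonal b μ L) {M : ℝ} (hμ : ∀ n, μ n ≤ M) (T : E →L[ℂ] E) :
    IsExp L T ↔ ∀ n, T (b n) = Complex.exp (μ n) • b n := by
  have hM : ∀ n, ‖Complex.exp (μ n)‖ ≤ Real.exp M := fun n => by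
    simpa using norm_exp_le hμ zero_le_one n
  rw [h.isExp_iff hμ]
  exact ⟨fun e n => by rw [e, diagOp_apply_basis b hM], fun e => eq_diagOp b hM e⟩

variable [CompleteSpace E]

/-- Tested against the eigenvectors, the adjoint relation is precisely the coefficient condition of
the maximal domain; the other inclusion is symmetry, `isSymm`. -/
theorem isSelfAdjoint (h : IsDiagonal b μ L) : IsSelfAdjoint L := by
  rw [LinearPMap.isSelfAdjoint_def]
  apply LinearPMap.eq_of_eq_graph
  rw [LinearPMap.adjoint_graph_eq_graph_adjoint h.dense_domain]
  ext ⟨ψ, φ⟩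
  rw [Submodule.mem_adjoint_iff]
  constructor
  · intro h1
    rw [h]
    intro n
    have := h1 _ _ (h.mem_graph_basis n)
    rw [inner_smul_left, Complex.conj_ofReal] at this
    linear_combination -this
  · intro h1 a c h2
    rw [h.isSymm h2 h1, sub_self]

theorem _root_.WeylCalculus.symm_of_isSelfAdjoint {B : E →ₗ.[ℂ] E} (hB : IsSelfAdjoint B)
    {ψ φ ψ' φ' : E} (h1 : (ψ, φ) ∈ B.graph) (h2 : (ψ', φ') ∈ B.graph) :
    inner ℂ φ ψ' = inner ℂ ψ φ' := by
  have h3 := LinearPMap.adjoint_graph_eq_graph_adjoint hB.dense_domain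
  rw [LinearPMap.isSelfAdjoint_def.1 hB] at h3
  rw [h3, Submodule.mem_adjoint_iff] at h2
  exact sub_eq_zero.1 (h2 _ _ h1)

/-- An operator with simple spectrum `exp μ` has exactly one logarithm. -/
theorem isLog_iff (h : IsDiagonal b μ L) {M : ℝ} (hμ : ∀ n, μ n ≤ M)
    (hinj : Function.Injective μ) {T : E →L[ℂ] E}
    (hT : ∀ n, T (b n) = Complex.exp (μ n) • b n) (B : E →ₗ.[ℂ] E) :
    IsLog T B ↔ B = L := by
  constructor
  swap
  · rintro rfl
    exact ⟨h.isSelfAdjoint, (h.isExp_iff_apply hμ T).2 hT⟩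
  rintro ⟨hB, S, hS, hS1⟩
  have hT' := (h.isExp_iff hμ T).1 ((h.isExp_iff_apply hμ T).2 hT)
  have hM : ∀ n, ‖Complex.exp (μ n)‖ ≤ Real.exp M := fun n => by
    simpa using norm_exp_le hμ zero_le_one n
  have hinner : ∀ ψ n, inner ℂ (b n) (T ψ) = Complex.exp (μ n) * inner ℂ (b n) ψ := by
    rw [hT']
    exact inner_diagOp b hM
  have hcomm : ∀ t, 0 ≤ t → ∀ ψ, S t (T ψ) = T (S t ψ) := by
    intro t ht ψ
    have e : S t ∘L S 1 = S 1 ∘L S t := by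
      rw [← hS.add t 1 ht zero_le_one, ← hS.add 1 t zero_le_one ht, add_comm]
    rw [← hS1]
    exact congrArg (fun A : E →L[ℂ] E => A ψ) e
  -- The semigroup commutes with `T = S 1`, whose eigenvalues `exp (μ n)` are distinct, so it has no
  -- off-diagonal entries in the basis `b`.
  have hoff : ∀ t, 0 ≤ t → ∀ m n, m ≠ n → inner ℂ (b m) (S t (b n)) = 0 := by
    intro t ht m n hmn
    have h1 := hinner (S t (b n)) m
    rw [← hcomm t ht, hT, map_smul, inner_smul_right] at h1
    have h2 : Complex.exp (μ n) ≠ Complex.exp (μ m) := by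
      rw [← Complex.ofReal_exp, ← Complex.ofReal_exp]
      intro h3
      exact hmn (hinj (Real.exp_injective (Complex.ofReal_injective h3))).symm
    have h3 : (Complex.exp (μ n) - Complex.exp (μ m)) * inner ℂ (b m) (S t (b n)) = 0 := by
      rw [sub_mul, h1, sub_self]
    exact (mul_eq_zero.1 h3).resolve_left (sub_ne_zero.2 h2)
  set c : ℕ → ℝ → ℂ := fun n t => inner ℂ (b n) (S t (b n)) with hc
  have hSb : ∀ t, 0 ≤ t → ∀ n, S t (b n) = c n t • b n := by
    intro t ht n
    refine hilbertBasis_ext b fun m => ?_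
    rw [inner_smul_right, hilbertBasis_inner]
    split_ifs with e
    · rw [e, mul_one]
    · rw [hoff t ht m n e, mul_zero]
  have hfun : ∀ t, 0 ≤ t → ∀ n ψ, inner ℂ (b n) (S t ψ) = c n t * inner ℂ (b n) ψ := by
    intro t ht n ψ
    have : (innerSL ℂ (b n)) ∘L S t = c n t • innerSL ℂ (b n) := by
      refine ContinuousLinearMap.ext_on
        (Submodule.dense_iff_topologicalClosure_eq_top.2 b.dense_span) ?_
      rintro _ ⟨m, rfl⟩
      change inner ℂ (b n) (S t (b m)) = c n t * inner ℂ (b n) (b m)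
      rw [hilbertBasis_inner]
      split_ifs with e
      · rw [e, mul_one]
      · rw [hoff t ht n m e, mul_zero]
    exact congrArg (fun A : E →L[ℂ] ℂ => A ψ) this
  -- The vector `b n` is not yet known to lie in the domain of `B`. A domain vector `ψ` with nonzero
  -- `n`-th coefficient exists by density, and the difference quotient of the scalar `c n` is read
  -- off from that of `S t ψ`.
  have heig : ∀ n, (b n, (μ n : ℂ) • b n) ∈ B.graph := by
    intro n
    obtain ⟨ψ, φ, hψ, hne⟩ : ∃ ψ φ, (ψ, φ) ∈ B.graph ∧ inner ℂ (b n) ψ ≠ 0 := by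
      by_contra! hcon
      have h0 : b n = 0 := by
        refine hB.dense_domain.eq_zero_of_inner_left ℂ fun v hv => ?_
        obtain ⟨w, hw⟩ := LinearPMap.mem_domain_iff.1 hv
        exact hcon _ _ hw
      have h1 := b.orthonormal.1 n
      rw [h0, norm_zero] at h1
      exact zero_ne_one h1
    set ν : ℂ := inner ℂ (b n) φ / inner ℂ (b n) ψ with hν
    have hlim : Tendsto (fun t : ℝ => ((t⁻¹ : ℝ) : ℂ) * (c n t - 1)) (𝓝[>] 0) (𝓝 ν) := by
      have h1 := (((innerSL ℂ (b n)).continuous.tendsto _).comp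
        ((hS.generator ψ φ).1 hψ)).div_const (inner ℂ (b n) ψ)
      refine h1.congr' ?_
      filter_upwards [self_mem_nhdsWithin] with t ht
      simp only [Function.comp, innerSL_apply_apply]
      rw [inner_smul_right, inner_sub_right, hfun t (le_of_lt ht)]
      field_simp
    have hgr : (b n, ν • b n) ∈ B.graph := by
      rw [hS.generator]
      refine (hlim.smul_const (b n)).congr' ?_
      filter_upwards [self_mem_nhdsWithin] with t ht
      rw [hSb t (le_of_lt ht), mul_smul, sub_smul, one_smul]
    -- From `exp ν = exp (μ n)` alone, `ν` is determined only modulo `2πi`; reality makes it equal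
    -- to `μ n`.
    have hreal : (starRingEnd ℂ) ν = ν := by
      have := symm_of_isSelfAdjoint hB hgr hgr
      rwa [inner_smul_left, inner_smul_right, hilbertBasis_inner, if_pos rfl, mul_one,
        mul_one] at this
    have h1 := hS.apply_eigenvector hgr zero_le_one
    rw [hS1, hT, Complex.ofReal_one, one_mul] at h1
    obtain ⟨r, hr⟩ := Complex.conj_eq_iff_real.1 hreal
    have h2 := congrArg (fun x => inner ℂ (b n) x) h1
    simp only [inner_smul_right, hilbertBasis_inner, if_true, mul_one] at h2
    rw [hr, ← Complex.ofReal_exp, ← Complex.ofReal_exp] at h2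
    rw [Real.exp_injective (Complex.ofReal_injective h2), ← hr]
    exact hgr
  -- Both inclusions follow from the common eigenvectors: symmetry of `B` against them gives the
  -- coefficient condition, and closedness of `B` gives all limits of their combinations.
  refine IsDiagonal.ext (b := b) (μ := μ) (fun ψ φ => ⟨fun hψ n => ?_, fun hψ => ?_⟩) h
  · have := symm_of_isSelfAdjoint hB (heig n) hψ
    rw [inner_smul_left, Complex.conj_ofReal] at this
    exact this.symm
  · have h1 := h.mem_closure_span ((h ψ φ).2 hψ)
    have h2 : IsClosed (B.graph : Set (E × E)) := hB.isClosed
    refine h2.closure_subset_iff.2 ?_ h1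
    have : Submodule.span ℂ (Set.range fun n => (b n, (μ n : ℂ) • b n)) ≤ B.graph := by
      rw [Submodule.span_le]
      rintro _ ⟨n, rfl⟩
      exact heig n
    exact this

end IsDiagonal

/-! ### Positivity and traces of diagonal operators -/

section Trace

theorem isPositive_of_diagonal (b : HilbertBasis ℕ ℂ E) {c : ℕ → ℝ} (hc0 : ∀ n, 0 ≤ c n)
    {T : E →L[ℂ] E} (hT : ∀ n, T (b n) = (c n : ℂ) • b n) : T.IsPositive := by
  have hexp : ∀ x y, HasSum (fun n => (c n : ℂ) * (inner ℂ x (b n) * inner ℂ (b n) y))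
      (inner ℂ x (T y)) := by
    intro x y
    have h1 := ((b.hasSum_repr y).mapL T).mapL (innerSL ℂ x)
    simp only [innerSL_apply_apply] at h1
    refine h1.congr_fun fun n => ?_
    rw [map_smul, hT, b.repr_apply_apply, inner_smul_right, inner_smul_right]
    ring
  refine (ContinuousLinearMap.isPositive_iff_complex T).2 fun x => ?_
  have h1 : HasSum (fun n => ((c n * ‖inner ℂ (b n) x‖ ^ 2 : ℝ) : ℂ)) (inner ℂ x (T x)) := by
    refine (hexp x x).congr_fun fun n => ?_
    rw [← inner_conj_symm x (b n), Complex.conj_mul']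
    push_cast
    ring
  have h2 := (Complex.hasSum_iff _ _).1 h1
  have h3 : 0 ≤ (inner ℂ x (T x)).re :=
    h2.1.nonneg fun n => mul_nonneg (hc0 n) (by positivity)
  have h4 : (inner ℂ x (T x)).im = 0 := h2.2.unique (by simpa only [Complex.ofReal_im] using hasSum_zero)
  have h5 : inner ℂ (T x) x = (starRingEnd ℂ) (inner ℂ x (T x)) := (inner_conj_symm _ _).symm
  refine ⟨Complex.ext ?_ ?_, ?_⟩
  · exact Complex.ofReal_re _
  · rw [h5, Complex.conj_im, h4, neg_zero]
    exact Complex.ofReal_im _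
  · rw [h5]
    simpa only [RCLike.re_to_complex, Complex.conj_re] using h3

variable [CompleteSpace E]

/-- The trace of `W T` for a bounded operator `W` and an operator `T` which is diagonal with
summable eigenvalues. -/
theorem hasSum_inner_comp (b : HilbertBasis ℕ ℂ E) {c : ℕ → ℂ} (hc : Summable c)
    {T : E →L[ℂ] E} (hT : ∀ n, T (b n) = c n • b n) (W : E →L[ℂ] E) {ι : Type*}
    (e : HilbertBasis ι ℂ E) :
    HasSum (fun i => inner ℂ (e i) (W (T (e i)))) (∑' n, c n * inner ℂ (b n) (W (b n))) := by
  have hcn : Summable fun n => ‖c n‖ := hc.norm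
  have hexp : ∀ x, HasSum (fun n => c n * inner ℂ (b n) x * inner ℂ (ContinuousLinearMap.adjoint W x) (b n))
      (inner ℂ x (W (T x))) := by
    intro x
    have h1 := ((b.hasSum_repr x).mapL T).mapL (innerSL ℂ (ContinuousLinearMap.adjoint W x))
    simp only [innerSL_apply_apply, ContinuousLinearMap.adjoint_inner_left] at h1 ⊢
    refine h1.congr_fun fun n => ?_
    rw [map_smul, hT, b.repr_apply_apply, map_smul, map_smul, inner_smul_right, inner_smul_right]
    ring
  set f : ι → ℕ → ℂ := fun i n => c n * inner ℂ (b n) (e i) * inner ℂ (e i) (W (b n)) with hf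
  -- Absolute convergence of the double series: `|uv| ≤ |u|² + |v|²` and Parseval in the basis `e`,
  -- applied to `b n` and to `W (b n)`, bound the sum over `i` by `‖c n‖ (1 + ‖W‖²)`. The
  -- interchange of sums then makes the trace independent of `e`.
  have hbound : ∀ n, Summable (fun i => ‖f i n‖) ∧ ∑' i, ‖f i n‖ ≤ ‖c n‖ * (1 + ‖W‖ ^ 2) := by
    intro n
    have h1 := (hilbertBasis_hasSum_norm_sq e (b n)).add (hilbertBasis_hasSum_norm_sq e (W (b n)))
    have h2 := h1.mul_left ‖c n‖
    have hle : ∀ i, ‖f i n‖ ≤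
        ‖c n‖ * (‖inner ℂ (e i) (b n)‖ ^ 2 + ‖inner ℂ (e i) (W (b n))‖ ^ 2) := by
      intro i
      rw [hf]
      simp only [norm_mul, mul_assoc]
      gcongr
      rw [norm_inner_symm (b n)]
      nlinarith [sq_nonneg (‖inner ℂ (e i) (b n)‖ - ‖inner ℂ (e i) (W (b n))‖),
        sq_nonneg (‖inner ℂ (e i) (b n)‖), sq_nonneg (‖inner ℂ (e i) (W (b n))‖)]
    have h3 : Summable (fun i => ‖f i n‖) :=
      Summable.of_nonneg_of_le (fun i => norm_nonneg _) hle h2.summable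
    refine ⟨h3, (h3.tsum_le_tsum hle h2.summable).trans ?_⟩
    rw [h2.tsum_eq, b.orthonormal.1 n, one_pow]
    gcongr
    simpa [b.orthonormal.1 n] using W.le_opNorm (b n)
  have hprod : Summable (Function.uncurry fun n i => f i n) := by
    refine Summable.of_norm ?_
    refine (summable_prod_of_nonneg fun _ => norm_nonneg _).2 ⟨fun n => (hbound n).1, ?_⟩
    exact Summable.of_nonneg_of_le (fun n => tsum_nonneg fun i => norm_nonneg _)
      (fun n => (hbound n).2) (hcn.mul_right _)
  have hswap : Summable (Function.uncurry f) := hprod.prod_symm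
  have hrow : ∀ i, HasSum (fun n => f i n) (inner ℂ (e i) (W (T (e i)))) := by
    intro i
    refine (hexp (e i)).congr_fun fun n => ?_
    rw [hf, ContinuousLinearMap.adjoint_inner_left]
  have hcol : ∀ n, HasSum (fun i => f i n) (c n * inner ℂ (b n) (W (b n))) := by
    intro n
    refine ((e.hasSum_inner_mul_inner (b n) (W (b n))).mul_left (c n)).congr_fun fun i => ?_
    simp only [hf, mul_assoc]
  have h1 := hswap.hasSum.prod_fiberwise hrow
  have h2 := hprod.hasSum.prod_fiberwise hcol
  have h3 : ∑' p, Function.uncurry f p = ∑' p, Function.uncurry (fun n i => f i n) p :=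
    ((Equiv.prodComm _ _).tsum_eq (Function.uncurry fun n i => f i n))
  rw [h2.tsum_eq, ← h3]
  exact h1

/-- The isometry drops out of `(Wρ)*(Wρ) = ρ²`, whose positive square root is `ρ`. Hence `Wρ` is of
trace class as soon as `ρ` is. -/
theorem abs_comp_eq {W ρ : E →L[ℂ] E} (hW : ContinuousLinearMap.adjoint W ∘L W = 1)
    (hρ : ρ.IsPositive) : CFC.abs (W ∘L ρ) = ρ := by
  have h0 : 0 ≤ ρ := (ContinuousLinearMap.nonneg_iff_isPositive ρ).2 hρ
  have h1 : star (W * ρ) * (W * ρ) = ρ * ρ := by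
    have h2 : star W * W = 1 := hW
    rw [star_mul, mul_assoc, ← mul_assoc (star W), h2, one_mul, hρ.isSelfAdjoint.star_eq]
  change CFC.abs (W * ρ) = ρ
  rw [CFC.abs, h1, CFC.sqrt_mul_self ρ h0]

/-- The trace of `W T` for an isometry `W` and a positive diagonal operator `T` of trace class. -/
theorem hasTrace_comp (b : HilbertBasis ℕ ℂ E) {c : ℕ → ℝ} (hc : Summable c) (hc0 : ∀ n, 0 ≤ c n)
    {T : E →L[ℂ] E} (hT : ∀ n, T (b n) = (c n : ℂ) • b n) {W : E →L[ℂ] E}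
    (hW : ContinuousLinearMap.adjoint W ∘L W = 1) :
    HasTrace (W ∘L T) (∑' n, (c n : ℂ) * inner ℂ (b n) (W (b n))) := by
  have hcC : Summable fun n => (c n : ℂ) := Complex.summable_ofReal.2 hc
  have hpos := isPositive_of_diagonal b hc0 hT
  refine ⟨fun ι e => ?_, fun ι e => hasSum_inner_comp b hcC hT W e⟩
  rw [abs_comp_eq hW hpos]
  exact (hasSum_inner_comp b hcC hT 1 e).summable

end Trace

end Diagonal

end WeylCalculus
end

noncomputable section
namespace WeylCalculus
universe u

/-! ### Closable operators and unitary groups -/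

section Unitary

variable {E : Type u} [NormedAddCommGroup E] [InnerProductSpace ℂ E]

/-- The adjoint relation passes to the closure of a graph. -/
theorem inner_eq_of_mem_closure {Γ : Set (E × E)} {f g : E}
    (h : ∀ x ∈ Γ, inner ℂ g x.1 = inner ℂ f x.2) {x : E × E} (hx : x ∈ closure Γ) :
    inner ℂ g x.1 = inner ℂ f x.2 := by
  have hclosed : IsClosed {x : E × E | inner ℂ g x.1 = inner ℂ f x.2} :=
    isClosed_eq (by fun_prop) (by fun_prop)
  exact hclosed.closure_subset_iff.2 h hx

/-- An operator with a densely defined formal adjoint is closable. -/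
theorem isClosable_of_formalAdjoint (L : E →ₗ.[ℂ] E) {D : Set E} (hD : Dense D)
    (h : ∀ f ∈ D, ∃ g, ∀ x ∈ L.graph, inner ℂ g x.1 = inner ℂ f x.2) : L.IsClosable := by
  refine ⟨L.graph.topologicalClosure.toLinearPMap, (Submodule.toLinearPMap_graph_eq _ ?_).symm⟩
  rintro ⟨x, y⟩ hx (rfl : x = 0)
  rw [← SetLike.mem_coe, Submodule.topologicalClosure_coe] at hx
  refine hD.eq_zero_of_inner_right ℂ fun f hf => ?_
  obtain ⟨g, hg⟩ := h f hf
  have := inner_eq_of_mem_closure (Γ := (L.graph : Set (E × E))) hg hx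
  simpa using this.symm

theorem mem_graph_closure_iff {L : E →ₗ.[ℂ] E} (h : L.IsClosable) (x : E × E) :
    x ∈ L.closure.graph ↔ x ∈ closure (L.graph : Set (E × E)) := by
  rw [← h.graph_closure_eq_closure_graph, ← Submodule.topologicalClosure_coe, SetLike.mem_coe]

/-- Stone's theorem for the closure of a skew-symmetric operator: if `U` is a one-parameter unitary
group which leaves the graph `Γ` invariant and is differentiable there, then `U 1` is the
exponential of the closure of `Γ`, and no other operator is. -/
theorem isExp_iff_of_unitaryGroup {L : E →ₗ.[ℂ] E} (Γ : Submodule ℂ (E × E))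
    (hL : ∀ x, x ∈ L.graph ↔ x ∈ closure (Γ : Set (E × E)))
    (hdense : Dense (Prod.fst '' (Γ : Set (E × E))))
    (hskew : ∀ x ∈ Γ, ∀ y ∈ Γ, inner ℂ (-x.2) y.1 = inner ℂ x.1 y.2)
    {U : ℝ → E →L[ℂ] E} (h0 : U 0 = 1) (hadd : ∀ s t, U (s + t) = U s ∘L U t)
    (hiso : ∀ t x, ‖U t x‖ = ‖x‖)
    (hder : ∀ f g, (f, g) ∈ Γ →
      Tendsto (fun t : ℝ => ((t⁻¹ : ℝ) : ℂ) • (U t f - f)) (𝓝[>] 0) (𝓝 g))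
    (hinv : ∀ t, 0 ≤ t → ∀ f g, (f, g) ∈ Γ → (U t f, U t g) ∈ Γ) (T : E →L[ℂ] E) :
    IsExp L T ↔ T = U 1 := by
  have hnorm : ∀ t, ‖U t‖ ≤ 1 := fun t =>
    ContinuousLinearMap.opNorm_le_bound _ zero_le_one fun x => by rw [hiso, one_mul]
  have hcont0 : ∀ ψ, Tendsto (fun t => U t ψ) (𝓝[≥] 0) (𝓝 ψ) := by
    intro ψ
    refine tendsto_clm_of_total (T₀ := 1) (C := 1) (D := Prod.fst '' (Γ : Set (E × E)))
      (Eventually.of_forall hnorm) ?_ ?_ ψ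
    · rw [← Submodule.dense_iff_topologicalClosure_eq_top]
      exact hdense.mono Submodule.subset_span
    · rintro _ ⟨⟨f, g⟩, hfg, rfl⟩
      have h1 : HasDerivWithinAt (fun t => U t f) g (Set.Ici 0) 0 := by
        apply hasDerivWithinAt_Ici_of_tendsto
        simpa [h0] using hder f g hfg
      simpa [ContinuousWithinAt, h0] using h1.continuousWithinAt
  have hcontI : ∀ ψ, ContinuousOn (fun t => U t ψ) (Set.Ici 0) := by
    intro ψ t ht
    have hright : ∀ s : ℝ, Tendsto (fun t => U t ψ) (𝓝[≥] s) (𝓝 (U s ψ)) := by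
      intro s
      have h2 : Tendsto (fun t : ℝ => t - s) (𝓝[≥] s) (𝓝[≥] 0) := by
        refine tendsto_nhdsWithin_iff.2 ⟨?_, ?_⟩
        · have : Tendsto (fun y : ℝ => y - s) (𝓝 s) (𝓝 (s - s)) :=
            (continuous_id.sub continuous_const).tendsto s
          rw [sub_self] at this
          exact this.mono_left nhdsWithin_le_nhds
        · filter_upwards [self_mem_nhdsWithin] with y hy
          exact sub_nonneg.2 (Set.mem_Ici.1 hy)
      refine (((U s).continuous.tendsto ψ).comp ((hcont0 ψ).comp h2)).congr fun t => ?_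
      simp only [Function.comp]
      rw [← ContinuousLinearMap.comp_apply, ← hadd, add_sub_cancel]
    -- Left continuity comes from isometry and the group law: `‖U t ψ - U s ψ‖ = ‖U (s - t) ψ - ψ‖`,
    -- with `s - t ≥ 0`.
    have hleft : ∀ s : ℝ, Tendsto (fun t => U t ψ) (𝓝[≤] s) (𝓝 (U s ψ)) := by
      intro s
      have h2 : Tendsto (fun t : ℝ => s - t) (𝓝[≤] s) (𝓝[≥] 0) := by
        refine tendsto_nhdsWithin_iff.2 ⟨?_, ?_⟩
        · have : Tendsto (fun y : ℝ => s - y) (𝓝 s) (𝓝 (s - s)) :=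
            (continuous_const.sub continuous_id).tendsto s
          rw [sub_self] at this
          exact this.mono_left nhdsWithin_le_nhds
        · filter_upwards [self_mem_nhdsWithin] with y hy
          exact sub_nonneg.2 (Set.mem_Iic.1 hy)
      have h3 := (hcont0 ψ).comp h2
      rw [tendsto_iff_norm_sub_tendsto_zero] at h3 ⊢
      refine h3.congr fun t => ?_
      simp only [Function.comp]
      rw [← hiso t (U (s - t) ψ - ψ), map_sub, ← ContinuousLinearMap.comp_apply, ← hadd,
        add_sub_cancel, norm_sub_rev]
    have : ContinuousAt (fun t => U t ψ) t := by
      rw [ContinuousAt, ← nhdsLE_sup_nhdsGE]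
      exact (hleft t).sup (hright t)
    exact this.continuousWithinAt
  have hgen := tendsto_generator_iff_mem_closure Γ (C := 1) h0 (fun s t _ _ => hadd s t) hcontI
    (fun t _ => hnorm t) hder hinv hdense
  have hU : IsSemigroupGeneratedBy L U :=
    ⟨h0, fun s t _ _ => hadd s t, hcontI, fun ψ φ => by rw [hL, hgen]⟩
  constructor
  swap
  · rintro rfl
    exact ⟨U, hU, rfl⟩
  rintro ⟨S, hS, rfl⟩
  have hinner : ∀ x y, inner ℂ (U 1 x) (U 1 y) = inner ℂ x y := fun x y =>
    (LinearMap.norm_map_iff_inner_map_map (U 1)).1 (hiso 1) x y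
  have hsub : ∀ x ∈ Γ, x ∈ L.graph := fun x hx => (hL x).2 (subset_closure hx)
  -- For a competing semigroup `S`, the function `s ↦ ⟪U s x, S s y⟫` is constant: its derivative
  -- vanishes because `Γ` is invariant under `U`, and skew-symmetry of `Γ` extends to pairs with one
  -- entry in the closure.
  have key : ∀ x ∈ Γ, ∀ y ∈ Γ, inner ℂ (U 1 x.1) (S 1 y.1) = inner ℂ x.1 y.1 := by
    intro x hx y hy
    have hconst := constant_of_has_deriv_right_zero
      (f := fun s : ℝ => (inner ℂ (U s x.1) (S s y.1) : ℂ)) (a := 0) (b := 1) ?_ ?_ 1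
      ⟨zero_le_one, le_rfl⟩
    · simpa [h0, hS.zero] using hconst
    · exact ContinuousOn.inner ((hcontI _).mono Set.Icc_subset_Ici_self)
        ((hS.continuousOn _).mono Set.Icc_subset_Ici_self)
    · intro s hs
      have h1 := (hU.hasDerivWithinAt (hsub x hx) hs.1).inner ℂ
        (hS.hasDerivWithinAt (hsub y hy) hs.1)
      refine h1.congr_deriv ?_
      have h2 := hinv s hs.1 _ _ hx
      have h3 := inner_eq_of_mem_closure (Γ := (Γ : Set (E × E))) (g := -(U s x.2)) (f := U s x.1)
        (fun z hz => hskew _ h2 z hz) ((hL _).1 (hS.mem_graph_map (hsub y hy) hs.1))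
      rw [← h3, inner_neg_left, neg_add_cancel]
  refine clm_ext_of_total (D := Prod.fst '' (Γ : Set (E × E))) ?_ ?_
  · rw [← Submodule.dense_iff_topologicalClosure_eq_top]
    exact hdense.mono Submodule.subset_span
  · rintro _ ⟨y, hy, rfl⟩
    -- `U 1` is surjective, with right inverse `U (-1)`, so the vectors `U 1 x` are dense and `key`
    -- determines `S 1 y`.
    have hsurj : Dense ((U 1) '' (Prod.fst '' (Γ : Set (E × E)))) := by
      refine DenseRange.dense_image (Function.Surjective.denseRange fun z => ⟨U (-1) z, ?_⟩)
        (U 1).continuous hdense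
      rw [← ContinuousLinearMap.comp_apply, ← hadd, add_neg_cancel, h0]
      rfl
    refine hsurj.eq_of_inner_right ℂ ?_
    rintro _ ⟨_, ⟨x, hx, rfl⟩, rfl⟩
    rw [key x hx y hy, hinner]

end Unitary

end WeylCalculus
end

noncomputable section
namespace WeylCalculus

/-! ### Gaussian Schwartz functions -/

/-- From `|x|ⁿ ≤ n! e^{|x|}`. This crude bound suffices for the polynomial factors in the
derivatives of a Gaussian. -/
theorem exists_norm_eval_le_exp (P : Polynomial ℂ) :
    ∃ C, 0 ≤ C ∧ ∀ x : ℝ, ‖P.eval (x : ℂ)‖ ≤ C * Real.exp |x| := by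
  induction P using Polynomial.induction_on' with
  | add p q hp hq =>
    obtain ⟨C, hC, h1⟩ := hp
    obtain ⟨D, hD, h2⟩ := hq
    refine ⟨C + D, add_nonneg hC hD, fun x => ?_⟩
    rw [Polynomial.eval_add, add_mul]
    exact (norm_add_le _ _).trans (add_le_add (h1 x) (h2 x))
  | monomial n a =>
    refine ⟨‖a‖ * n.factorial, by positivity, fun x => ?_⟩
    have := Real.pow_div_factorial_le_exp |x| (abs_nonneg x) n
    rw [div_le_iff₀ (by positivity)] at this
    rw [Polynomial.eval_monomial, norm_mul, norm_pow, Complex.norm_real, Real.norm_eq_abs,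
      mul_assoc]
    gcongr
    linarith

theorem hasDerivAt_cexp_quadratic (a b c : ℂ) (x : ℝ) :
    HasDerivAt (fun x : ℝ => Complex.exp (-a * x ^ 2 + b * x + c))
      ((-2 * a * x + b) * Complex.exp (-a * x ^ 2 + b * x + c)) x := by
  have h1 : HasDerivAt (fun x : ℝ => (x : ℂ)) 1 x := Complex.ofRealCLM.hasDerivAt
  have h2 := ((((h1.pow 2).const_mul (-a)).add (h1.const_mul b)).add_const c).cexp
  refine (h2.congr_deriv ?_).congr_of_eventuallyEq (Eventually.of_forall fun y => ?_)
  · simp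
    ring
  · simp

theorem exists_iteratedDeriv_cexp_quadratic (a b c : ℂ) (n : ℕ) :
    ∃ P : Polynomial ℂ, ∀ x : ℝ,
      iteratedDeriv n (fun x : ℝ => Complex.exp (-a * x ^ 2 + b * x + c)) x =
        P.eval (x : ℂ) * Complex.exp (-a * x ^ 2 + b * x + c) := by
  induction n with
  | zero => exact ⟨1, fun x => by simp⟩
  | succ n ih =>
    obtain ⟨P, hP⟩ := ih
    refine ⟨Polynomial.derivative P + P * (Polynomial.C (-2 * a) * Polynomial.X + Polynomial.C b),
      fun x => ?_⟩
    rw [iteratedDeriv_succ, funext hP]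
    have h1 : HasDerivAt (fun x : ℝ => P.eval (x : ℂ)) ((Polynomial.derivative P).eval (x : ℂ)) x :=
      (P.hasDerivAt (x : ℂ)).comp_ofReal
    refine (h1.mul (hasDerivAt_cexp_quadratic a b c x)).deriv.trans ?_
    simp only [Polynomial.eval_add, Polynomial.eval_mul, Polynomial.eval_C, Polynomial.eval_X]
    ring

/-- The Gaussian `exp (-a x² + b x + c)` with `Re a > 0` as a Schwartz function. -/
def gaussian (a b c : ℂ) (ha : 0 < a.re) : 𝓢(ℝ, ℂ) where
  toFun x := Complex.exp (-a * x ^ 2 + b * x + c)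
  smooth' := by
    have : ContDiff ℝ (⊤ : ℕ∞) (fun x : ℝ => (x : ℂ)) := Complex.ofRealCLM.contDiff
    fun_prop
  decay' k n := by
    obtain ⟨P, hP⟩ := exists_iteratedDeriv_cexp_quadratic a b c n
    obtain ⟨C, hC, hPC⟩ := exists_norm_eval_le_exp P
    -- The `2` accounts for two factors `e^{|x|}`, one absorbing `|x|^k` and one the polynomial;
    -- completing the square in `B|x| - Re a |x|²` gives `B² / (4 Re a)`.
    set B := 2 + |b.re| with hB
    refine ⟨k.factorial * C * Real.exp (B ^ 2 / (4 * a.re) + c.re), fun x => ?_⟩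
    rw [norm_iteratedFDeriv_eq_norm_iteratedDeriv, hP, norm_mul, Complex.norm_exp]
    have h1 := Real.pow_div_factorial_le_exp |x| (abs_nonneg x) k
    rw [div_le_iff₀ (by positivity)] at h1
    have h2 : (-a * x ^ 2 + b * x + c).re ≤ -a.re * |x| ^ 2 + |b.re| * |x| + c.re := by
      rw [sq_abs]
      have h3 : (-a * x ^ 2 + b * x + c).re = -a.re * x ^ 2 + b.re * x + c.re := by
        rw [← Complex.ofReal_pow]
        simp [-Complex.ofReal_pow]
      rw [h3, ← abs_mul]
      gcongr
      exact le_abs_self _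
    have h4 : |x| + (|x| + (-a.re * |x| ^ 2 + |b.re| * |x| + c.re)) ≤
        B ^ 2 / (4 * a.re) + c.re := by
      have h5 : B * |x| - a.re * |x| ^ 2 ≤ B ^ 2 / (4 * a.re) := by
        rw [le_div_iff₀ (by positivity)]
        nlinarith [sq_nonneg (B - 2 * a.re * |x|)]
      rw [hB] at h5 ⊢
      linarith
    rw [Real.norm_eq_abs]
    calc |x| ^ k * (‖P.eval (x : ℂ)‖ * Real.exp (-a * x ^ 2 + b * x + c).re)
        ≤ (Real.exp |x| * k.factorial) * ((C * Real.exp |x|) *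
          Real.exp (-a.re * |x| ^ 2 + |b.re| * |x| + c.re)) := by
          gcongr
          exact hPC x
      _ = k.factorial * C *
          Real.exp (|x| + (|x| + (-a.re * |x| ^ 2 + |b.re| * |x| + c.re))) := by
          rw [Real.exp_add |x| (|x| + _), Real.exp_add |x| (_ + c.re)]
          ring
      _ ≤ _ := by gcongr

theorem gaussian_apply (a b c : ℂ) (ha : 0 < a.re) (x : ℝ) :
    gaussian a b c ha x = Complex.exp (-a * x ^ 2 + b * x + c) := rfl

/-! ### The inner product of Schwartz functions -/

theorem inner_schwartzToL2 (f g : 𝓢(ℝ, ℂ)) :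
    inner ℂ (schwartzToL2 f) (schwartzToL2 g) = ∫ x, (starRingEnd ℂ) (f x) * g x := by
  refine (SchwartzMap.inner_toL2_toL2_eq f g volume).trans ?_
  refine integral_congr_ae (Eventually.of_forall fun x => ?_)
  simp [mul_comm]

theorem coeFn_schwartzToL2 (f : 𝓢(ℝ, ℂ)) : schwartzToL2 f =ᵐ[volume] f :=
  f.coeFn_toLp 2 volume

theorem inner_schwartzToL2_left (f : 𝓢(ℝ, ℂ)) (x : L2) :
    Integrable (fun q => (starRingEnd ℂ) (f q) * x q) ∧
      inner ℂ (schwartzToL2 f) x = ∫ q, (starRingEnd ℂ) (f q) * x q := by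
  have h1 := L2.integrable_inner (𝕜 := ℂ) (schwartzToL2 f) x
  have h2 : (fun q => inner ℂ (schwartzToL2 f q) (x q)) =ᵐ[volume]
      fun q => (starRingEnd ℂ) (f q) * x q := by
    filter_upwards [coeFn_schwartzToL2 f] with q hq
    rw [hq]
    simp [mul_comm]
  exact ⟨h1.congr h2, integral_congr_ae h2⟩

theorem dense_range_schwartzToL2 : Dense (Set.range schwartzToL2) :=
  SchwartzMap.denseRange_toLpCLM (p := 2) ENNReal.ofNat_ne_top

theorem inner_position (f g : 𝓢(ℝ, ℂ)) :
    inner ℂ (schwartzToL2 f) (schwartzToL2 (position g)) =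
      inner ℂ (schwartzToL2 (position f)) (schwartzToL2 g) := by
  rw [inner_schwartzToL2, inner_schwartzToL2]
  refine integral_congr_ae (Eventually.of_forall fun x => ?_)
  simp only [position_apply, map_mul, Complex.conj_ofReal]
  ring

/-- Differentiation of Schwartz functions. -/
abbrev dOp : 𝓢(ℝ, ℂ) →L[ℂ] 𝓢(ℝ, ℂ) := SchwartzMap.derivCLM ℂ ℂ

theorem inner_dOp (f g : 𝓢(ℝ, ℂ)) :
    inner ℂ (schwartzToL2 f) (schwartzToL2 (dOp g)) =
      -inner ℂ (schwartzToL2 (dOp f)) (schwartzToL2 g) := by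
  rw [inner_schwartzToL2, inner_schwartzToL2]
  exact SchwartzMap.integral_bilinear_deriv_right_eq_neg_left f g
    ((ContinuousLinearMap.mul ℝ ℂ).comp (Complex.conjCLE : ℂ →L[ℝ] ℂ))

theorem dOp_position (f : 𝓢(ℝ, ℂ)) : dOp (position f) = f + position (dOp f) := by
  ext x
  have h1 : HasDerivAt (fun x : ℝ => (x : ℂ)) 1 x := Complex.ofRealCLM.hasDerivAt
  have h2 := h1.mul (f.hasDerivAt x)
  have h3 : (position f : ℝ → ℂ) = (fun x : ℝ => (x : ℂ)) * f := funext (position_apply f)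
  change deriv (position f) x = f x + position (dOp f) x
  rw [h3, h2.deriv, position_apply, one_mul]
  rfl

theorem momentum_eq (ħ : ℝ) (f : 𝓢(ℝ, ℂ)) : momentum ħ f = (-(Complex.I * (ħ : ℂ))) • dOp f := rfl

/-! ### Injectivity of the Fourier transform -/

/-- Every test function is the Fourier transform of a Schwartz function, and the transform can be
moved to the other factor under the integral. So `g` integrates to zero against all test functions.
-/
theorem ae_eq_zero_of_fourier_eq_zero {g : ℝ → ℂ} (hg : Integrable g)
    (h : ∀ w : ℝ, ∫ v : ℝ, Complex.exp ((-2 * Real.pi * v * w : ℝ) * Complex.I) * g v = 0) :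
    g =ᵐ[volume] 0 := by
  have hfour : ∀ w : ℝ, FourierTransform.fourier g w = 0 := by
    intro w
    rw [Real.fourier_real_eq_integral_exp_smul]
    simpa [smul_eq_mul] using h w
  refine ae_eq_zero_of_integral_contDiff_smul_eq_zero hg.locallyIntegrable fun u hu hu' => ?_
  have hv : HasCompactSupport fun x => (u x : ℂ) := hu'.comp_left Complex.ofReal_zero
  have hv' : ContDiff ℝ (⊤ : ℕ∞) fun x => (u x : ℂ) := Complex.ofRealCLM.contDiff.comp hu
  set φ : 𝓢(ℝ, ℂ) := hv.toSchwartzMap hv' with hφ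
  have h1 := VectorFourier.integral_fourierIntegral_smul_eq_flip (μ := (volume : Measure ℝ))
    (ν := (volume : Measure ℝ)) (L := innerₗ ℝ)
    (f := (FourierTransformInv.fourierInv φ : 𝓢(ℝ, ℂ)))
    (g := g) Real.continuous_fourierChar continuous_inner
    (FourierTransformInv.fourierInv φ : 𝓢(ℝ, ℂ)).integrable hg
  rw [flip_innerₗ] at h1
  have h2 : ∀ x, VectorFourier.fourierIntegral Real.fourierChar volume (innerₗ ℝ) g x = 0 := hfour
  have h3 : ∀ x, VectorFourier.fourierIntegral Real.fourierChar volume (innerₗ ℝ)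
      (FourierTransformInv.fourierInv φ : 𝓢(ℝ, ℂ)) x = u x := by
    intro x
    have h4 : FourierTransform.fourier (FourierTransformInv.fourierInv φ : 𝓢(ℝ, ℂ)) = φ :=
      FourierTransform.fourier_fourierInv_eq φ
    exact congrArg (fun f : 𝓢(ℝ, ℂ) => f x) h4
  simp only [h2, h3, smul_zero, integral_zero] at h1
  simpa using h1

end WeylCalculus
end

noncomputable section
namespace WeylCalculus

/-! ### Creation and annihilation operators -/

/-- The prefactor `√(π/α)` is written as the exponential of a logarithm, so that identities between
Gaussian integrals reduce to identities between exponents. -/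
theorem integral_cexp_real_quadratic {α : ℝ} (hα : 0 < α) (β γ : ℂ) :
    ∫ x : ℝ, Complex.exp (-(α : ℂ) * x ^ 2 + β * x + γ) =
      Complex.exp ((1 / 2 * Real.log (Real.pi / α) : ℝ) + γ + β ^ 2 / (4 * α)) := by
  have hα' : (α : ℂ) ≠ 0 := by exact_mod_cast hα.ne'
  have h1 := integral_cexp_quadratic (b := -(α : ℂ)) (by simpa using hα) β γ
  rw [h1, neg_neg]
  have h2 : ((Real.pi : ℂ) / α) ^ (1 / 2 : ℂ) =
      Complex.exp ((1 / 2 * Real.log (Real.pi / α) : ℝ)) := by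
    have h3 : ((Real.pi : ℂ) / α) = ((Real.pi / α : ℝ) : ℂ) := by push_cast; rfl
    have h4 : (1 / 2 : ℂ) = ((1 / 2 : ℝ) : ℂ) := by push_cast; rfl
    rw [h3, h4, ← Complex.ofReal_cpow (by positivity), Real.rpow_def_of_pos (by positivity),
      Complex.ofReal_exp, mul_comm]
  rw [h2, ← Complex.exp_add]
  congr 1
  field_simp
  ring

/-- The data of a complex Gaussian `exp (-ν q² / (2ħ))`, the ground state of a quadratic
Hamiltonian. -/
structure Oscillator where
  /-- Planck's constant. -/
  ħ : ℝ
  /-- The complex width of the Gaussian. -/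
  ν : ℂ
  hħ : 0 < ħ
  hν : 0 < ν.re

namespace Oscillator

variable (O : Oscillator)

/-- The normalisation `√(2 ħ Re ν)` of the ladder operators. -/
def s : ℝ := Real.sqrt (2 * O.ħ * O.ν.re)

theorem s_pos : 0 < O.s := Real.sqrt_pos.2 (mul_pos (mul_pos two_pos O.hħ) O.hν)

theorem s_sq : O.s ^ 2 = 2 * O.ħ * O.ν.re :=
  Real.sq_sqrt (mul_pos (mul_pos two_pos O.hħ) O.hν).le

theorem s_ne : (O.s : ℂ) ≠ 0 := by exact_mod_cast O.s_pos.ne'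

theorem ħ_ne : (O.ħ : ℂ) ≠ 0 := by exact_mod_cast O.hħ.ne'

theorem νre_ne : (O.ν.re : ℂ) ≠ 0 := by exact_mod_cast O.hν.ne'

theorem s_sq' : (O.s : ℂ) ^ 2 = 2 * O.ħ * O.ν.re := by exact_mod_cast O.s_sq

theorem add_conj_ν : O.ν + (starRingEnd ℂ) O.ν = 2 * O.ν.re := by
  rw [Complex.add_conj]
  push_cast
  rfl

/-- The annihilation operator `(ħ d/dq + ν q) / s`. -/
def ann : 𝓢(ℝ, ℂ) →L[ℂ] 𝓢(ℝ, ℂ) :=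
  (O.s : ℂ)⁻¹ • ((O.ħ : ℂ) • dOp + O.ν • position)

/-- The creation operator `(-ħ d/dq + ν̄ q) / s`. -/
def cre : 𝓢(ℝ, ℂ) →L[ℂ] 𝓢(ℝ, ℂ) :=
  (O.s : ℂ)⁻¹ • (-(O.ħ : ℂ) • dOp + (starRingEnd ℂ) O.ν • position)

theorem ann_apply (f : 𝓢(ℝ, ℂ)) :
    O.ann f = (O.s : ℂ)⁻¹ • ((O.ħ : ℂ) • dOp f + O.ν • position f) := rfl

theorem cre_apply (f : 𝓢(ℝ, ℂ)) :
    O.cre f = (O.s : ℂ)⁻¹ • (-(O.ħ : ℂ) • dOp f + (starRingEnd ℂ) O.ν • position f) := rfl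

theorem inner_cre (f g : 𝓢(ℝ, ℂ)) :
    inner ℂ (schwartzToL2 (O.cre f)) (schwartzToL2 g) =
      inner ℂ (schwartzToL2 f) (schwartzToL2 (O.ann g)) := by
  rw [ann_apply, cre_apply]
  simp only [map_smul, map_add, inner_smul_left, inner_smul_right, inner_add_left, inner_add_right,
    inner_position, inner_dOp, map_inv₀, map_neg, Complex.conj_ofReal, Complex.conj_conj]
  ring

/-- The canonical commutation relation. The normalisation `s² = ħ(ν + ν̄)` is chosen to make the
commutator equal to `1`. -/
theorem ann_cre (f : 𝓢(ℝ, ℂ)) : O.ann (O.cre f) = O.cre (O.ann f) + f := by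
  have hs := O.s_ne
  have h : (O.ν + (starRingEnd ℂ) O.ν) * O.ħ = O.s ^ 2 := by
    rw [add_conj_ν, s_sq']
    ring
  have h2 : O.ann (O.cre f) = O.cre (O.ann f) +
      ((O.s : ℂ)⁻¹ * (O.s : ℂ)⁻¹ * ((O.ν + (starRingEnd ℂ) O.ν) * O.ħ)) • f := by
    simp only [ann_apply, cre_apply, map_smul, map_add, dOp_position]
    module
  rw [h2, h, show (O.s : ℂ)⁻¹ * (O.s : ℂ)⁻¹ * (O.s : ℂ) ^ 2 = 1 by field_simp, one_smul]

/-- The coherent state with parameter `z`. -/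
def coh (z : ℂ) : 𝓢(ℝ, ℂ) :=
  gaussian (O.ν / (2 * O.ħ)) (z * O.s / O.ħ)
    (-z ^ 2 / 2 + (1 / 4 * Real.log (O.ν.re / (Real.pi * O.ħ)) : ℝ)) (by
      have : O.ν / (2 * O.ħ) = O.ν / ((2 * O.ħ : ℝ) : ℂ) := by push_cast; rfl
      rw [this, Complex.div_ofReal_re]
      exact div_pos O.hν (mul_pos two_pos O.hħ))

theorem coh_apply (z : ℂ) (x : ℝ) : O.coh z x = Complex.exp (-(O.ν / (2 * O.ħ)) * x ^ 2 +
    (z * O.s / O.ħ) * x + (-z ^ 2 / 2 + (1 / 4 * Real.log (O.ν.re / (Real.pi * O.ħ)) : ℝ))) := rfl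

theorem ann_coh (z : ℂ) : O.ann (O.coh z) = z • O.coh z := by
  ext x
  have hs := O.s_ne
  have hħ := O.ħ_ne
  have h := (hasDerivAt_cexp_quadratic (O.ν / (2 * O.ħ)) (z * O.s / O.ħ)
    (-z ^ 2 / 2 + (1 / 4 * Real.log (O.ν.re / (Real.pi * O.ħ)) : ℝ)) x).deriv
  change (O.s : ℂ)⁻¹ * ((O.ħ : ℂ) * deriv (O.coh z) x + O.ν * position (O.coh z) x) =
    z * O.coh z x
  rw [position_apply]
  have h' : deriv (O.coh z) x = (-2 * (O.ν / (2 * O.ħ)) * x + z * O.s / O.ħ) * O.coh z x := h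
  rw [h']
  field_simp
  ring

/-- The coherent states are not unit vectors: they are normalised so that their Gram kernel is the
reproducing kernel of Bargmann–Fock space, which keeps all later formulas analytic in `z`. -/
theorem inner_coh (w z : ℂ) :
    inner ℂ (schwartzToL2 (O.coh w)) (schwartzToL2 (O.coh z)) =
      Complex.exp ((starRingEnd ℂ) w * z) := by
  have hs := O.s_ne
  have hħ := O.ħ_ne
  have hν := O.νre_ne
  rw [inner_schwartzToL2]
  have hα : 0 < O.ν.re / O.ħ := div_pos O.hν O.hħ
  have h1 : ∀ x : ℝ, (starRingEnd ℂ) (O.coh w x) * O.coh z x =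
      Complex.exp (-((O.ν.re / O.ħ : ℝ) : ℂ) * x ^ 2 + (((starRingEnd ℂ) w + z) * O.s / O.ħ) * x +
        (-((starRingEnd ℂ) w ^ 2 + z ^ 2) / 2 +
          (1 / 2 * Real.log (O.ν.re / (Real.pi * O.ħ)) : ℝ))) := by
    intro x
    rw [coh_apply, coh_apply, ← Complex.exp_conj, ← Complex.exp_add]
    congr 1
    have h2 : (starRingEnd ℂ) O.ν = 2 * O.ν.re - O.ν := by rw [← add_conj_ν]; ring
    simp only [map_add, map_neg, map_mul, map_div₀, map_pow, Complex.conj_ofReal, h2,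
      map_ofNat, Complex.ofReal_mul, Complex.ofReal_div]
    push_cast
    field_simp
    ring
  simp only [h1]
  rw [integral_cexp_real_quadratic hα]
  congr 1
  have h3 : Real.log (Real.pi / (O.ν.re / O.ħ)) = -Real.log (O.ν.re / (Real.pi * O.ħ)) := by
    rw [← Real.log_inv]
    congr 1
    field_simp
  rw [h3]
  have h4 : (((starRingEnd ℂ) w + z) * O.s / O.ħ) ^ 2 / (4 * ((O.ν.re / O.ħ : ℝ) : ℂ)) =
      ((starRingEnd ℂ) w + z) ^ 2 / 2 := by
    rw [div_pow, mul_pow, s_sq']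
    push_cast
    field_simp
    norm_num
  rw [h4]
  push_cast
  ring

theorem norm_coh_sq (z : ℂ) : ‖schwartzToL2 (O.coh z)‖ ^ 2 = Real.exp (‖z‖ ^ 2) := by
  have h := O.inner_coh z z
  rw [inner_self_eq_norm_sq_to_K, Complex.conj_mul'] at h
  exact Complex.ofReal_injective (by push_cast; exact h)

/-- The coherent states are total. -/
theorem eq_zero_of_inner_coh (x : L2) (h : ∀ z, inner ℂ (schwartzToL2 (O.coh z)) x = 0) :
    x = 0 := by
  have hs := O.s_ne
  have hħ := O.ħ_ne
  have hzero := ae_eq_zero_of_fourier_eq_zero (inner_schwartzToL2_left (O.coh 0) x).1 fun w => by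
    -- For imaginary `z` the coherent state is, up to a constant, the ground state times a plane
    -- wave; this `z` has frequency `w`. So the Fourier transform of the conjugate ground state
    -- times `x` vanishes, and the ground state has no zeros.
    have h1 := h ((2 * Real.pi * w * O.ħ / O.s : ℝ) * Complex.I)
    rw [(inner_schwartzToL2_left _ x).2] at h1
    set z : ℂ := (2 * Real.pi * w * O.ħ / O.s : ℝ) * Complex.I with hz
    have h2 : ∀ q : ℝ, (starRingEnd ℂ) (O.coh z q) = (starRingEnd ℂ) (Complex.exp (-z ^ 2 / 2)) *
        (Complex.exp ((-2 * Real.pi * q * w : ℝ) * Complex.I) *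
          (starRingEnd ℂ) (O.coh 0 q)) := by
      intro q
      rw [coh_apply, coh_apply, ← Complex.exp_conj, ← Complex.exp_conj, ← Complex.exp_conj,
        ← Complex.exp_add, ← Complex.exp_add]
      congr 1
      have h3 : (z * O.s / O.ħ) * q = ((2 * Real.pi * q * w : ℝ) : ℂ) * Complex.I := by
        rw [hz]
        push_cast
        field_simp
      simp only [map_add, h3, zero_mul, zero_div, map_mul, Complex.conj_ofReal, Complex.conj_I]
      push_cast
      simp
      ring
    simp only [h2, mul_assoc] at h1
    rw [integral_const_mul] at h1
    have h4 : (starRingEnd ℂ) (Complex.exp (-z ^ 2 / 2)) ≠ 0 := by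
      rw [← Complex.exp_conj]
      exact Complex.exp_ne_zero _
    simpa [mul_assoc] using (mul_eq_zero.1 h1).resolve_left h4
  rw [Lp.eq_zero_iff_ae_eq_zero]
  filter_upwards [hzero] with q hq
  have h5 : (starRingEnd ℂ) (O.coh 0 q) ≠ 0 := by
    rw [coh_apply, ← Complex.exp_conj]
    exact Complex.exp_ne_zero _
  exact (mul_eq_zero.1 hq).resolve_left h5

theorem total_coh :
    (Submodule.span ℂ (Set.range fun z => schwartzToL2 (O.coh z))).topologicalClosure = ⊤ := by
  rw [Submodule.topologicalClosure_eq_top_iff, Submodule.eq_bot_iff]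
  intro x hx
  refine O.eq_zero_of_inner_coh x fun z => ?_
  exact (Submodule.mem_orthogonal _ _).1 hx _ (Submodule.subset_span ⟨z, rfl⟩)

/-! ### The Hermite basis -/

/-- The unnormalised excited states. -/
def exc (n : ℕ) : 𝓢(ℝ, ℂ) := (O.cre)^[n] (O.coh 0)

theorem exc_zero : O.exc 0 = O.coh 0 := rfl

theorem exc_succ (n : ℕ) : O.exc (n + 1) = O.cre (O.exc n) :=
  Function.iterate_succ_apply' _ _ _

theorem ann_exc_zero : O.ann (O.exc 0) = 0 := by rw [exc_zero, ann_coh, zero_smul]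

theorem ann_exc_succ (n : ℕ) : O.ann (O.exc (n + 1)) = ((n + 1 : ℕ) : ℂ) • O.exc n := by
  induction n with
  | zero => rw [exc_succ, ann_cre, ann_exc_zero, map_zero, zero_add, zero_add, Nat.cast_one, one_smul]
  | succ n ih =>
    rw [exc_succ, ann_cre, ih, map_smul, ← exc_succ]
    push_cast
    module

/-- Each creation operator passes to the other side as an annihilation operator and contributes one
eigenvalue `z`. -/
theorem inner_exc_coh (n : ℕ) (z : ℂ) :
    inner ℂ (schwartzToL2 (O.exc n)) (schwartzToL2 (O.coh z)) = z ^ n := by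
  induction n with
  | zero => rw [exc_zero, inner_coh, map_zero, zero_mul, Complex.exp_zero, pow_zero]
  | succ n ih => rw [exc_succ, inner_cre, ann_coh, map_smul, inner_smul_right, ih, pow_succ']

theorem inner_exc_exc (m n : ℕ) :
    inner ℂ (schwartzToL2 (O.exc m)) (schwartzToL2 (O.exc n)) =
      if m = n then (m.factorial : ℂ) else 0 := by
  induction m generalizing n with
  | zero =>
    cases n with
    | zero => rw [exc_zero, inner_coh]; simp
    | succ n =>
      rw [← inner_conj_symm, exc_succ _ n, inner_cre, ann_exc_zero]
      simp
  | succ m ih =>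
    cases n with
    | zero => rw [exc_succ, inner_cre, ann_exc_zero]; simp
    | succ n =>
      rw [exc_succ _ m, inner_cre, ann_exc_succ, map_smul, inner_smul_right, ih]
      by_cases h : m = n
      · subst h
        simp [Nat.factorial_succ]
      · simp [h]

/-- The normalised excited states. -/
def fock (n : ℕ) : L2 := ((Real.sqrt n.factorial : ℝ) : ℂ)⁻¹ • schwartzToL2 (O.exc n)

theorem orthonormal_fock : Orthonormal ℂ O.fock := by
  rw [orthonormal_iff_ite]
  intro m n
  rw [fock, fock, inner_smul_left, inner_smul_right, inner_exc_exc]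
  split_ifs with h
  · subst h
    rw [map_inv₀, Complex.conj_ofReal]
    have h1 : ((Real.sqrt m.factorial : ℝ) : ℂ) ^ 2 = m.factorial := by
      rw [← Complex.ofReal_pow, Real.sq_sqrt (by positivity)]
      simp
    have h2 : ((Real.sqrt m.factorial : ℝ) : ℂ) ≠ 0 := by
      have : Real.sqrt m.factorial ≠ 0 := Real.sqrt_ne_zero'.2 (by positivity)
      exact_mod_cast this
    rw [← h1]
    field_simp
  · simp

theorem norm_inner_fock_coh_sq (n : ℕ) (z : ℂ) :
    ‖inner ℂ (O.fock n) (schwartzToL2 (O.coh z))‖ ^ 2 = (‖z‖ ^ 2) ^ n / n.factorial := by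
  rw [fock, inner_smul_left, inner_exc_coh, norm_mul, map_inv₀, Complex.conj_ofReal, norm_inv,
    Complex.norm_real, Real.norm_of_nonneg (Real.sqrt_nonneg _), mul_pow, inv_pow,
    Real.sq_sqrt (by positivity), norm_pow]
  ring

/-- Equality in Bessel's inequality puts a vector in the closed span. -/
theorem _root_.WeylCalculus.inner_eq_zero_of_bessel_eq {E : Type*} [NormedAddCommGroup E]
    [InnerProductSpace ℂ E] {v : ℕ → E} (hv : Orthonormal ℂ v) {e x : E}
    (he : HasSum (fun n => ‖inner ℂ (v n) e‖ ^ 2) (‖e‖ ^ 2)) (hx : ∀ n, inner ℂ (v n) x = 0) :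
    inner ℂ e x = 0 := by
  have h1 : ∀ N, ‖e - ∑ n ∈ Finset.range N, (inner ℂ (v n) e : ℂ) • v n‖ ^ 2 =
      ‖e‖ ^ 2 - ∑ n ∈ Finset.range N, ‖inner ℂ (v n) e‖ ^ 2 := by
    intro N
    rw [@norm_sub_sq ℂ]
    have h2 : inner ℂ e (∑ n ∈ Finset.range N, (inner ℂ (v n) e : ℂ) • v n) =
        ((∑ n ∈ Finset.range N, ‖inner ℂ (v n) e‖ ^ 2 : ℝ) : ℂ) := by
      rw [inner_sum]
      push_cast
      refine Finset.sum_congr rfl fun n _ => ?_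
      rw [inner_smul_right, ← inner_conj_symm e, Complex.mul_conj']
    have h3 : ‖∑ n ∈ Finset.range N, (inner ℂ (v n) e : ℂ) • v n‖ ^ 2 =
        ∑ n ∈ Finset.range N, ‖inner ℂ (v n) e‖ ^ 2 := by
      have h4 := hv.inner_sum (fun n => inner ℂ (v n) e) (fun n => inner ℂ (v n) e)
        (Finset.range N)
      rw [inner_self_eq_norm_sq_to_K] at h4
      have h5 : ∑ n ∈ Finset.range N, (starRingEnd ℂ) (inner ℂ (v n) e) * inner ℂ (v n) e =
          ((∑ n ∈ Finset.range N, ‖inner ℂ (v n) e‖ ^ 2 : ℝ) : ℂ) := by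
        push_cast
        exact Finset.sum_congr rfl fun n _ => Complex.conj_mul' _
      rw [h5] at h4
      exact Complex.ofReal_injective (by push_cast at h4 ⊢; exact h4)
    rw [h2, h3, RCLike.re_to_complex, Complex.ofReal_re]
    ring
  have h2 : Tendsto (fun N => ‖e - ∑ n ∈ Finset.range N, (inner ℂ (v n) e : ℂ) • v n‖ ^ 2) atTop
      (𝓝 0) := by
    simp only [h1]
    have := (tendsto_const_nhds (x := ‖e‖ ^ 2)).sub he.tendsto_sum_nat
    rwa [sub_self] at this
  have h3 : Tendsto (fun N => ‖e - ∑ n ∈ Finset.range N, (inner ℂ (v n) e : ℂ) • v n‖ * ‖x‖) atTop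
      (𝓝 0) := by
    have := h2.sqrt
    simp only [Real.sqrt_zero, Real.sqrt_sq (norm_nonneg _)] at this
    simpa using this.mul_const ‖x‖
  rw [← norm_le_zero_iff]
  refine ge_of_tendsto h3 (Eventually.of_forall fun N => ?_)
  have h4 : inner ℂ e x =
      inner ℂ (e - ∑ n ∈ Finset.range N, (inner ℂ (v n) e : ℂ) • v n) x := by
    rw [inner_sub_left, sum_inner]
    simp [inner_smul_left, hx]
  rw [h4]
  exact norm_inner_le_norm _ _

/-- The orthonormal basis of generalised Hermite functions. -/
def basis : HilbertBasis ℕ ℂ L2 :=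
  HilbertBasis.mkOfOrthogonalEqBot O.orthonormal_fock (by
    rw [Submodule.eq_bot_iff]
    intro x hx
    -- The Bessel sum of a coherent state is `∑ |z|²ⁿ / n! = e^{|z|²}`, its full squared norm. So a
    -- vector orthogonal to all excited states is orthogonal to all coherent states.
    refine O.eq_zero_of_inner_coh x fun z => ?_
    refine inner_eq_zero_of_bessel_eq O.orthonormal_fock ?_ fun n =>
      (Submodule.mem_orthogonal _ _).1 hx _ (Submodule.subset_span ⟨n, rfl⟩)
    rw [norm_coh_sq]
    simp only [norm_inner_fock_coh_sq]
    rw [Real.exp_eq_exp_ℝ]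
    exact NormedSpace.expSeries_div_hasSum_exp (‖z‖ ^ 2))

theorem basis_apply (n : ℕ) : O.basis n = O.fock n := by
  rw [basis, HilbertBasis.coe_mkOfOrthogonalEqBot]

end Oscillator

end WeylCalculus
end

noncomputable section
namespace WeylCalculus

/-! ### The quadratic Hamiltonian -/

theorem mem_graph_onSchwartz (A : 𝓢(ℝ, ℂ) →L[ℂ] 𝓢(ℝ, ℂ)) (x : L2 × L2) :
    x ∈ (onSchwartz A).graph ↔ ∃ f, x = (schwartzToL2 f, schwartzToL2 (A f)) := by
  rw [LinearPMap.mem_graph_iff]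
  constructor
  · rintro ⟨⟨_, f, rfl⟩, h1, h2⟩
    exact ⟨f, Prod.ext h1.symm (h2.symm.trans (onSchwartz_apply A f))⟩
  · rintro ⟨f, rfl⟩
    exact ⟨⟨schwartzToL2 f, f, rfl⟩, rfl, onSchwartz_apply A f⟩

theorem isClosable_onSchwartz {A A' : 𝓢(ℝ, ℂ) →L[ℂ] 𝓢(ℝ, ℂ)}
    (h : ∀ f g, inner ℂ (schwartzToL2 (A' f)) (schwartzToL2 g) =
      inner ℂ (schwartzToL2 f) (schwartzToL2 (A g))) : (onSchwartz A).IsClosable := by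
  refine isClosable_of_formalAdjoint _ dense_range_schwartzToL2 ?_
  rintro _ ⟨f, rfl⟩
  refine ⟨schwartzToL2 (A' f), fun x hx => ?_⟩
  obtain ⟨g, rfl⟩ := (mem_graph_onSchwartz A x).1 hx
  exact h f g

/-- The expression `½ x̂ · Q x̂` on Schwartz functions. -/
abbrev quadOp (ħ : ℝ) (Q : Matrix (Fin 2) (Fin 2) ℝ) : 𝓢(ℝ, ℂ) →L[ℂ] 𝓢(ℝ, ℂ) :=
  (1 / 2 : ℂ) • ∑ j, ∑ k, (Q j k : ℂ) • (xOp ħ j ∘L xOp ħ k)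

theorem quadOp_apply (ħ : ℝ) (Q : Matrix (Fin 2) (Fin 2) ℝ) (f : 𝓢(ℝ, ℂ)) :
    quadOp ħ Q f = (1 / 2 : ℂ) • ((Q 0 0 : ℂ) • momentum ħ (momentum ħ f) +
      (Q 0 1 : ℂ) • momentum ħ (position f) + (Q 1 0 : ℂ) • position (momentum ħ f) +
      (Q 1 1 : ℂ) • position (position f)) := by
  simp [quadOp, xOp, Fin.sum_univ_two, add_assoc]

section PosDef

variable {Q : Matrix (Fin 2) (Fin 2) ℝ}

theorem posDef_symm (hQ : Q.PosDef) : Q 1 0 = Q 0 1 := by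
  have := hQ.isHermitian.apply 0 1
  simpa using this

theorem posDef_diag (hQ : Q.PosDef) (i : Fin 2) : 0 < Q i i := hQ.diag_pos

theorem posDef_sqrt_det_pos (hQ : Q.PosDef) : 0 < Real.sqrt Q.det := Real.sqrt_pos.2 hQ.det_pos

theorem posDef_sq_det (hQ : Q.PosDef) : Real.sqrt Q.det ^ 2 = Q 0 0 * Q 1 1 - Q 0 1 ^ 2 := by
  rw [Real.sq_sqrt hQ.det_pos.le, Matrix.det_fin_two, posDef_symm hQ]
  ring

/-- The oscillator whose ground state is the ground state of `½ x̂ · Q x̂`. -/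
def oscillatorOf {ħ : ℝ} (hħ : 0 < ħ) (hQ : Q.PosDef) : Oscillator where
  ħ := ħ
  ν := ⟨Real.sqrt Q.det / Q 0 0, Q 0 1 / Q 0 0⟩
  hħ := hħ
  hν := div_pos (posDef_sqrt_det_pos hQ) (posDef_diag hQ 0)

variable {ħ : ℝ}

/-- Factorisation into ladder operators. Since `Q₀₀ ν = ω + i Q₀₁` and `ω² = det Q`, one has `Q₀₀
|ν|² = Q₁₁`, which matches the `q²` term. The zero-point term `½` compensates the real part of `ν`
in the ordering terms. -/
theorem quadOp_eq (hħ : 0 < ħ) (hQ : Q.PosDef) (f : 𝓢(ℝ, ℂ)) :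
    quadOp ħ Q f = ((ħ * Real.sqrt Q.det : ℝ) : ℂ) •
      ((oscillatorOf hħ hQ).cre ((oscillatorOf hħ hQ).ann f) + (1 / 2 : ℂ) • f) := by
  set O := oscillatorOf hħ hQ with hO
  set ω := Real.sqrt Q.det with hω
  have hs := O.s_ne
  have h00 : (Q 0 0 : ℂ) ≠ 0 := by exact_mod_cast (posDef_diag hQ 0).ne'
  have hħ0 : (ħ : ℂ) ≠ 0 := by exact_mod_cast hħ.ne'
  have hω0 : (ω : ℂ) ≠ 0 := by exact_mod_cast (posDef_sqrt_det_pos hQ).ne'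
  have hν : (Q 0 0 : ℂ) * O.ν = ω + Complex.I * Q 0 1 := by
    rw [← Complex.re_add_im O.ν]
    change (Q 0 0 : ℂ) * (((ω / Q 0 0 : ℝ) : ℂ) + ((Q 0 1 / Q 0 0 : ℝ) : ℂ) * Complex.I) = _
    push_cast
    field_simp
  have hν' : (Q 0 0 : ℂ) * (starRingEnd ℂ) O.ν = ω - Complex.I * Q 0 1 := by
    have := congrArg (starRingEnd ℂ) hν
    simpa [sub_eq_add_neg] using this
  have hs2 : (ħ : ℂ) * ω * ((O.s : ℂ)⁻¹ * (O.s : ℂ)⁻¹) = Q 0 0 / 2 := by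
    have h1 : (O.s : ℂ) ^ 2 = 2 * ħ * ((ω / Q 0 0 : ℝ) : ℂ) := O.s_sq'
    have h2 : (O.s : ℂ)⁻¹ * (O.s : ℂ)⁻¹ = ((O.s : ℂ) ^ 2)⁻¹ := by
      rw [sq, mul_inv]
    rw [h2, h1]
    push_cast
    field_simp
  have hdet : (ω : ℂ) ^ 2 = Q 0 0 * Q 1 1 - Q 0 1 ^ 2 := by exact_mod_cast posDef_sq_det hQ
  have hνν : (Q 0 0 : ℂ) * (O.ν * (starRingEnd ℂ) O.ν) = Q 1 1 := by
    apply mul_left_cancel₀ h00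
    have : (Q 0 0 : ℂ) * (Q 0 0 * (O.ν * (starRingEnd ℂ) O.ν)) =
        (Q 0 0 * O.ν) * (Q 0 0 * (starRingEnd ℂ) O.ν) := by ring
    rw [this, hν, hν']
    linear_combination hdet - (Q 0 1 : ℂ) ^ 2 * Complex.I_sq
  have hcre : O.cre (O.ann f) = ((O.s : ℂ)⁻¹ * (O.s : ℂ)⁻¹) • (-(ħ : ℂ) ^ 2 • dOp (dOp f) -
      ((ħ : ℂ) * O.ν) • f + ((ħ : ℂ) * ((starRingEnd ℂ) O.ν - O.ν)) • position (dOp f) +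
      (O.ν * (starRingEnd ℂ) O.ν) • position (position f)) := by
    have : (O.ħ : ℂ) = ħ := rfl
    simp only [Oscillator.ann_apply, Oscillator.cre_apply, map_smul, map_add, dOp_position, this]
    module
  rw [quadOp_apply, posDef_symm hQ]
  simp only [momentum_eq, map_smul, dOp_position]
  rw [hcre, Complex.ofReal_mul, smul_add ((ħ : ℂ) * ω),
    smul_smul ((ħ : ℂ) * ω) ((O.s : ℂ)⁻¹ * (O.s : ℂ)⁻¹), hs2]
  match_scalars
  · linear_combination (-(1 / 2 : ℂ) * ħ ^ 2 * Q 0 0) * (-Complex.I_sq)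
  · linear_combination ((1 / 2 : ℂ) * ħ) * hν
  · linear_combination ((1 / 2 : ℂ) * ħ) * (hν - hν')
  · linear_combination (-(1 / 2 : ℂ)) * hνν

/-- The eigenvalues of the Hamiltonian. -/
def energy (ħ : ℝ) (Q : Matrix (Fin 2) (Fin 2) ℝ) (n : ℕ) : ℝ :=
  ħ * Real.sqrt Q.det * (n + 1 / 2)

theorem quadOp_exc (hħ : 0 < ħ) (hQ : Q.PosDef) (n : ℕ) :
    quadOp ħ Q ((oscillatorOf hħ hQ).exc n) = (energy ħ Q n : ℂ) • (oscillatorOf hħ hQ).exc n := by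
  rw [quadOp_eq hħ hQ, energy]
  cases n with
  | zero =>
    rw [Oscillator.ann_exc_zero, map_zero, zero_add, smul_smul]
    push_cast
    rw [zero_add]
  | succ n =>
    rw [Oscillator.ann_exc_succ, map_smul, ← Oscillator.exc_succ]
    push_cast
    module

theorem inner_quadOp (hħ : 0 < ħ) (hQ : Q.PosDef) (f g : 𝓢(ℝ, ℂ)) :
    inner ℂ (schwartzToL2 (quadOp ħ Q f)) (schwartzToL2 g) =
      inner ℂ (schwartzToL2 f) (schwartzToL2 (quadOp ħ Q g)) := by
  have h : ∀ f g, inner ℂ (schwartzToL2 f) (schwartzToL2 ((oscillatorOf hħ hQ).cre g)) =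
      inner ℂ (schwartzToL2 ((oscillatorOf hħ hQ).ann f)) (schwartzToL2 g) := by
    intro f g
    rw [← inner_conj_symm, Oscillator.inner_cre, inner_conj_symm]
  rw [quadOp_eq hħ hQ, quadOp_eq hħ hQ]
  simp only [map_smul, map_add, inner_smul_left, inner_smul_right, inner_add_left, inner_add_right,
    h, Oscillator.inner_cre, Complex.conj_ofReal, map_div₀, map_one, map_ofNat]

theorem mem_graph_hamiltonian (hħ : 0 < ħ) (hQ : Q.PosDef) (x : L2 × L2) :
    x ∈ (hamiltonian ħ Q).graph ↔ x ∈ closure ((onSchwartz (quadOp ħ Q)).graph : Set (L2 × L2)) :=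
  mem_graph_closure_iff (isClosable_onSchwartz (inner_quadOp hħ hQ)) x

/-- Essential self-adjointness in concrete form. The eigenfunctions are Schwartz functions, so
symmetry against them imposes the coefficient condition on every limit of the graph, while a pair
satisfying it is a limit of finite combinations of eigenpairs. -/
theorem isDiagonal_hamiltonian (hħ : 0 < ħ) (hQ : Q.PosDef) :
    IsDiagonal (oscillatorOf hħ hQ).basis (energy ħ Q) (hamiltonian ħ Q) := by
  have hmem : ∀ n, ((oscillatorOf hħ hQ).basis n, (energy ħ Q n : ℂ) • (oscillatorOf hħ hQ).basis n)
      ∈ (onSchwartz (quadOp ħ Q)).graph := by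
    intro n
    rw [mem_graph_onSchwartz, Oscillator.basis_apply, Oscillator.fock]
    refine ⟨((Real.sqrt n.factorial : ℝ) : ℂ)⁻¹ • (oscillatorOf hħ hQ).exc n, ?_⟩
    rw [map_smul, map_smul, map_smul, quadOp_exc hħ hQ, map_smul, smul_comm]
  intro ψ φ
  rw [mem_graph_hamiltonian hħ hQ]
  constructor
  · intro h n
    have h1 := inner_eq_of_mem_closure (f := (oscillatorOf hħ hQ).basis n)
      (g := (energy ħ Q n : ℂ) • (oscillatorOf hħ hQ).basis n) ?_ h
    · rw [inner_smul_left, Complex.conj_ofReal] at h1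
      exact h1.symm
    · intro x hx
      obtain ⟨f, hf⟩ := (mem_graph_onSchwartz _ _).1 (hmem n)
      obtain ⟨g, rfl⟩ := (mem_graph_onSchwartz _ _).1 hx
      rw [Prod.mk.injEq] at hf
      rw [hf.2, hf.1]
      exact inner_quadOp hħ hQ f g
  · intro h
    refine closure_mono ?_ (mem_closure_span_of_inner _ h)
    have : Submodule.span ℂ (Set.range fun n => ((oscillatorOf hħ hQ).basis n,
        (energy ħ Q n : ℂ) • (oscillatorOf hħ hQ).basis n)) ≤ (onSchwartz (quadOp ħ Q)).graph := by
      rw [Submodule.span_le]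
      rintro _ ⟨n, rfl⟩
      exact hmem n
    exact this

end PosDef

end WeylCalculus
end

noncomputable section
namespace WeylCalculus

/-! ### Weyl operators -/

theorem hasTemperateGrowth_cexp_linear {b : ℂ} (hb : b.re = 0) (c : ℂ) :
    Function.HasTemperateGrowth (fun x : ℝ => Complex.exp (b * x + c)) := by
  have hder : ∀ x : ℝ, HasDerivAt (fun x : ℝ => Complex.exp (b * x + c))
      (b * Complex.exp (b * x + c)) x := by
    intro x
    have h1 : HasDerivAt (fun x : ℝ => (x : ℂ)) 1 x := Complex.ofRealCLM.hasDerivAt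
    refine ((h1.const_mul b).add_const c).cexp.congr_deriv ?_
    ring
  have hiter : ∀ n : ℕ, ∀ x : ℝ, iteratedDeriv n (fun x : ℝ => Complex.exp (b * x + c)) x =
      b ^ n * Complex.exp (b * x + c) := by
    intro n
    induction n with
    | zero => simp
    | succ n ih =>
      intro x
      rw [iteratedDeriv_succ, funext ih]
      refine ((hder x).const_mul (b ^ n)).deriv.trans ?_
      ring
  refine ⟨?_, fun n => ⟨0, ‖b‖ ^ n * Real.exp c.re, fun x => ?_⟩⟩
  · have : ContDiff ℝ (⊤ : ℕ∞) (fun x : ℝ => (x : ℂ)) := Complex.ofRealCLM.contDiff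
    fun_prop
  · rw [norm_iteratedFDeriv_eq_norm_iteratedDeriv, hiter, norm_mul, norm_pow, Complex.norm_exp]
    simp [hb]

/-- The Weyl operator `e^{(i/ħ) ξ·x̂}` on Schwartz functions:
`ψ ↦ (q ↦ e^{(i/ħ)(ξ₁ q + ξ₀ ξ₁ / 2)} ψ (q + ξ₀))`. -/
def weylS (ħ : ℝ) (ξ : Fin 2 → ℝ) : 𝓢(ℝ, ℂ) →L[ℂ] 𝓢(ℝ, ℂ) :=
  SchwartzMap.smulLeftCLM ℂ (fun q : ℝ => Complex.exp ((Complex.I * ((ξ 1 / ħ : ℝ) : ℂ)) * q +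
    Complex.I * ((ξ 0 * ξ 1 / (2 * ħ) : ℝ) : ℂ))) ∘L SchwartzMap.compSubConstCLM ℂ (-ξ 0)

variable {ħ : ℝ} (ξ : Fin 2 → ℝ)

theorem weylS_apply (ħ : ℝ) (f : 𝓢(ℝ, ℂ)) (q : ℝ) :
    weylS ħ ξ f q = Complex.exp ((Complex.I * ((ξ 1 / ħ : ℝ) : ℂ)) * q +
      Complex.I * ((ξ 0 * ξ 1 / (2 * ħ) : ℝ) : ℂ)) * f (q + ξ 0) := by
  have h := hasTemperateGrowth_cexp_linear (b := Complex.I * ((ξ 1 / ħ : ℝ) : ℂ)) (by simp)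
    (Complex.I * ((ξ 0 * ξ 1 / (2 * ħ) : ℝ) : ℂ))
  rw [weylS, ContinuousLinearMap.comp_apply, SchwartzMap.smulLeftCLM_apply_apply h,
    SchwartzMap.compSubConstCLM_apply, sub_neg_eq_add, smul_eq_mul]

theorem norm_cexp_phase (a b q : ℝ) :
    ‖Complex.exp ((Complex.I * (a : ℂ)) * q + Complex.I * (b : ℂ))‖ = 1 := by
  rw [Complex.norm_exp]
  simp

theorem norm_weylS_apply (ħ : ℝ) (f : 𝓢(ℝ, ℂ)) (q : ℝ) : ‖weylS ħ ξ f q‖ = ‖f (q + ξ 0)‖ := by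
  rw [weylS_apply, norm_mul, norm_cexp_phase, one_mul]

theorem weylS_zero (f : 𝓢(ℝ, ℂ)) : weylS ħ 0 f = f := by
  ext q
  rw [weylS_apply]
  simp

/-- The phase `ξ₀ξ₁/2` is what turns a ray into a one-parameter group: it supplies the cross term
`st ξ₀ξ₁` produced by translating the linear phase. -/
theorem weylS_add_smul (s t : ℝ) (f : 𝓢(ℝ, ℂ)) :
    weylS ħ ((s + t) • ξ) f = weylS ħ (s • ξ) (weylS ħ (t • ξ) f) := by
  ext q
  rw [weylS_apply, weylS_apply, weylS_apply, ← mul_assoc, ← Complex.exp_add]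
  congr 1
  · congr 1
    simp only [Pi.smul_apply, smul_eq_mul]
    push_cast
    ring
  · congr 1
    simp only [Pi.smul_apply, smul_eq_mul]
    ring

theorem inner_weylS (f g : 𝓢(ℝ, ℂ)) :
    inner ℂ (schwartzToL2 (weylS ħ ξ f)) (schwartzToL2 (weylS ħ ξ g)) =
      inner ℂ (schwartzToL2 f) (schwartzToL2 g) := by
  rw [inner_schwartzToL2, inner_schwartzToL2,
    ← integral_add_right_eq_self (fun x => (starRingEnd ℂ) (f x) * g x) (ξ 0)]
  refine integral_congr_ae (Eventually.of_forall fun q => ?_)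
  simp only [weylS_apply, map_mul]
  rw [mul_mul_mul_comm, Complex.conj_mul', norm_cexp_phase]
  simp

theorem norm_weylS (f : 𝓢(ℝ, ℂ)) :
    ‖schwartzToL2 (weylS ħ ξ f)‖ = ‖schwartzToL2 f‖ := by
  rw [@norm_eq_sqrt_re_inner ℂ, @norm_eq_sqrt_re_inner ℂ, inner_weylS]

theorem dOp_weylS (f : 𝓢(ℝ, ℂ)) :
    dOp (weylS ħ ξ f) = weylS ħ ξ (dOp f) + (Complex.I * ((ξ 1 / ħ : ℝ) : ℂ)) • weylS ħ ξ f := by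
  ext q
  have h0 : HasDerivAt (fun x : ℝ => (x : ℂ)) 1 q := Complex.ofRealCLM.hasDerivAt
  have h1 := ((h0.const_mul (Complex.I * ((ξ 1 / ħ : ℝ) : ℂ))).add_const
    (Complex.I * ((ξ 0 * ξ 1 / (2 * ħ) : ℝ) : ℂ))).cexp
  have h2 : HasDerivAt (fun x => f (x + ξ 0)) (deriv f (q + ξ 0)) q :=
    (f.hasDerivAt (q + ξ 0)).comp_add_const q (ξ 0)
  have h3 := (h1.mul h2).deriv
  change deriv (weylS ħ ξ f) q = weylS ħ ξ (dOp f) q +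
    (Complex.I * ((ξ 1 / ħ : ℝ) : ℂ)) * weylS ħ ξ f q
  rw [show (weylS ħ ξ f : ℝ → ℂ) = _ from funext (weylS_apply ξ ħ f)]
  refine h3.trans ?_
  rw [weylS_apply, SchwartzMap.derivCLM_apply]
  ring

theorem position_weylS (f : 𝓢(ℝ, ℂ)) :
    position (weylS ħ ξ f) = weylS ħ ξ (position f) - (ξ 0 : ℂ) • weylS ħ ξ f := by
  ext q
  change position (weylS ħ ξ f) q = weylS ħ ξ (position f) q - (ξ 0 : ℂ) * weylS ħ ξ f q
  rw [position_apply, weylS_apply, weylS_apply, position_apply]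
  push_cast
  ring

/-- The operator `ξ · x̂` on Schwartz functions. -/
abbrev linOp (ħ : ℝ) (ξ : Fin 2 → ℝ) : 𝓢(ℝ, ℂ) →L[ℂ] 𝓢(ℝ, ℂ) := ∑ j, (ξ j : ℂ) • xOp ħ j

/-- The generator `(i/ħ) ξ · x̂` on Schwartz functions. -/
def genS (ħ : ℝ) (ξ : Fin 2 → ℝ) : 𝓢(ℝ, ℂ) →L[ℂ] 𝓢(ℝ, ℂ) := (Complex.I / ħ) • linOp ħ ξ

theorem linOp_apply (f : 𝓢(ℝ, ℂ)) :
    linOp ħ ξ f = (ξ 0 : ℂ) • momentum ħ f + (ξ 1 : ℂ) • position f := by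
  simp [linOp, xOp, Fin.sum_univ_two]

theorem genS_apply (hħ : ħ ≠ 0) (f : 𝓢(ℝ, ℂ)) :
    genS ħ ξ f = (ξ 0 : ℂ) • dOp f + (Complex.I * ((ξ 1 / ħ : ℝ) : ℂ)) • position f := by
  have hħ' : (ħ : ℂ) ≠ 0 := by exact_mod_cast hħ
  change (Complex.I / ħ) • linOp ħ ξ f = _
  rw [linOp_apply, momentum_eq]
  push_cast
  match_scalars
  · field_simp
    linear_combination -(ξ 0 : ℂ) * Complex.I_sq
  · field_simp

theorem inner_linOp (f g : 𝓢(ℝ, ℂ)) :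
    inner ℂ (schwartzToL2 (linOp ħ ξ f)) (schwartzToL2 g) =
      inner ℂ (schwartzToL2 f) (schwartzToL2 (linOp ħ ξ g)) := by
  rw [linOp_apply, linOp_apply, momentum_eq, momentum_eq]
  simp only [map_smul, map_add, inner_smul_left, inner_smul_right, inner_add_left, inner_add_right,
    inner_position, inner_dOp, map_neg, map_mul, Complex.conj_ofReal, Complex.conj_I]
  ring

theorem inner_genS (f g : 𝓢(ℝ, ℂ)) :
    inner ℂ (-schwartzToL2 (genS ħ ξ f)) (schwartzToL2 g) =
      inner ℂ (schwartzToL2 f) (schwartzToL2 (genS ħ ξ g)) := by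
  change inner ℂ (-schwartzToL2 ((Complex.I / ħ) • linOp ħ ξ f)) (schwartzToL2 g) =
      inner ℂ (schwartzToL2 f) (schwartzToL2 ((Complex.I / ħ) • linOp ħ ξ g))
  rw [map_smul, map_smul, inner_neg_left, inner_smul_left, inner_smul_right, inner_linOp]
  simp only [map_div₀, Complex.conj_I, Complex.conj_ofReal]
  ring

/-- Conjugation shifts `d/dq` and `q` by constants that cancel in the generator along the same ray.
This gives the invariance of the core required by `isExp_iff_of_unitaryGroup`. -/
theorem genS_weylS (hħ : ħ ≠ 0) (t : ℝ) (f : 𝓢(ℝ, ℂ)) :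
    genS ħ ξ (weylS ħ (t • ξ) f) = weylS ħ (t • ξ) (genS ħ ξ f) := by
  rw [genS_apply ξ hħ, genS_apply ξ hħ, dOp_weylS, position_weylS, map_add, map_smul, map_smul]
  simp only [Pi.smul_apply, smul_eq_mul]
  push_cast
  module

theorem hasDerivAt_weylS (hħ : ħ ≠ 0) (f : 𝓢(ℝ, ℂ)) (q t : ℝ) :
    HasDerivAt (fun t : ℝ => weylS ħ (t • ξ) f q) (weylS ħ (t • ξ) (genS ħ ξ f) q) t := by
  have h0 : HasDerivAt (fun x : ℝ => (x : ℂ)) 1 t := Complex.ofRealCLM.hasDerivAt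
  have h1 := ((h0.const_mul (Complex.I * ((ξ 1 / ħ : ℝ) : ℂ) * q)).add
    ((h0.pow 2).const_mul (Complex.I * ((ξ 0 * ξ 1 / (2 * ħ) : ℝ) : ℂ)))).cexp
  have h2 : HasDerivAt (fun t : ℝ => q + t * ξ 0) (ξ 0) t := by
    simpa using ((hasDerivAt_id t).mul_const (ξ 0)).const_add q
  have h3 := h1.mul ((f.hasDerivAt (q + t * ξ 0)).scomp t h2)
  have hħ' : (ħ : ℂ) ≠ 0 := by exact_mod_cast hħ
  refine (h3.congr_deriv ?_).congr_of_eventuallyEq (Eventually.of_forall fun u => ?_)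
  · rw [weylS_apply, genS_apply ξ hħ]
    change _ = _ * ((ξ 0 : ℂ) * deriv f (q + (t • ξ) 0) +
      (Complex.I * ((ξ 1 / ħ : ℝ) : ℂ)) * position f (q + (t • ξ) 0))
    rw [position_apply]
    have e : Complex.I * (((t • ξ) 1 / ħ : ℝ) : ℂ) * q +
        Complex.I * (((t • ξ) 0 * (t • ξ) 1 / (2 * ħ) : ℝ) : ℂ) =
        Complex.I * ((ξ 1 / ħ : ℝ) : ℂ) * q * t +
        Complex.I * ((ξ 0 * ξ 1 / (2 * ħ) : ℝ) : ℂ) * (t : ℂ) ^ 2 := by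
      simp only [Pi.smul_apply, smul_eq_mul]
      push_cast
      ring
    rw [e]
    simp only [Pi.smul_apply, smul_eq_mul, Complex.real_smul, Function.comp, Pi.add_apply,
      Pi.pow_apply]
    push_cast
    field_simp
    ring
  · refine (weylS_apply (u • ξ) ħ f q).trans ?_
    simp only [Pi.smul_apply, smul_eq_mul, Function.comp, Pi.mul_apply, Pi.add_apply, Pi.pow_apply]
    congr 2
    push_cast
    ring

theorem exists_decay (f : 𝓢(ℝ, ℂ)) : ∃ C, 0 ≤ C ∧ ∀ y : ℝ, (1 + y ^ 2) * ‖f y‖ ≤ C := by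
  refine ⟨SchwartzMap.seminorm ℂ 0 0 f + SchwartzMap.seminorm ℂ 2 0 f, by positivity,
    fun y => ?_⟩
  have h1 := SchwartzMap.norm_pow_mul_le_seminorm ℂ f 0 y
  have h2 := SchwartzMap.norm_pow_mul_le_seminorm ℂ f 2 y
  rw [Real.norm_eq_abs, sq_abs] at h2
  simp only [pow_zero, one_mul] at h1
  linarith

theorem memLp_inv_one_add_sq : MemLp (fun q : ℝ => (1 + q ^ 2)⁻¹) 2 volume := by
  rw [memLp_two_iff_integrable_sq (by fun_prop)]
  refine integrable_inv_one_add_sq.mono (by fun_prop) (Eventually.of_forall fun q => ?_)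
  have h : (1 + q ^ 2)⁻¹ ≤ 1 := inv_le_one_of_one_le₀ (by nlinarith [sq_nonneg q])
  have h' : 0 ≤ (1 + q ^ 2)⁻¹ := by positivity
  rw [Real.norm_of_nonneg (by positivity), Real.norm_of_nonneg h']
  nlinarith

/-- The Weyl operators are differentiable at `0` in `L²` on Schwartz functions. -/
theorem tendsto_weylS (hħ : ħ ≠ 0) (f : 𝓢(ℝ, ℂ)) :
    Tendsto (fun t : ℝ => ((t⁻¹ : ℝ) : ℂ) • (schwartzToL2 (weylS ħ (t • ξ) f) - schwartzToL2 f))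
      (𝓝[>] 0) (𝓝 (schwartzToL2 (genS ħ ξ f))) := by
  set g := genS ħ ξ f with hg
  obtain ⟨C, hC, hdec⟩ := exists_decay (genS ħ ξ g)
  -- The factor `2 (1 + ξ₀²)` compares `1 + q²` with `1 + (q + sξ₀)²` for all `s ∈ [0, 1]`, so one
  -- square-integrable majorant serves every translate.
  set K : ℝ := 2 * (1 + ξ 0 ^ 2) * C with hK
  have hsup : ∀ s ∈ Set.Icc (0 : ℝ) 1, ∀ q : ℝ,
      ‖weylS ħ (s • ξ) (genS ħ ξ g) q‖ ≤ K * (1 + q ^ 2)⁻¹ := by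
    intro s hs q
    rw [norm_weylS_apply, ← div_eq_mul_inv, le_div_iff₀ (by positivity)]
    simp only [Pi.smul_apply, smul_eq_mul]
    have h1 := hdec (q + s * ξ 0)
    have h2 : 1 + q ^ 2 ≤ 2 * (1 + ξ 0 ^ 2) * (1 + (q + s * ξ 0) ^ 2) := by
      have h3 : s ^ 2 ≤ 1 := by nlinarith [hs.1, hs.2]
      have h4 : (s * ξ 0) ^ 2 ≤ ξ 0 ^ 2 := by
        rw [mul_pow]
        nlinarith [sq_nonneg (ξ 0)]
      nlinarith [sq_nonneg (q + 2 * (s * ξ 0)), sq_nonneg (ξ 0 * (q + s * ξ 0)), sq_nonneg (ξ 0)]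
    calc _ ≤ ‖genS ħ ξ g (q + s * ξ 0)‖ * (2 * (1 + ξ 0 ^ 2) * (1 + (q + s * ξ 0) ^ 2)) := by
          gcongr
      _ = 2 * (1 + ξ 0 ^ 2) * ((1 + (q + s * ξ 0) ^ 2) * ‖genS ħ ξ g (q + s * ξ 0)‖) := by ring
      _ ≤ K := by rw [hK]; gcongr
  have hone : ∀ t ∈ Set.Icc (0 : ℝ) 1, ∀ q : ℝ,
      ‖weylS ħ (t • ξ) g q - g q‖ ≤ K * (1 + q ^ 2)⁻¹ * t := by
    intro t ht q
    have := norm_image_sub_le_of_norm_deriv_right_le_segment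
      (f := fun s : ℝ => weylS ħ (s • ξ) g q) (a := 0) (b := t)
      (fun s _ => (hasDerivAt_weylS ξ hħ g q s).continuousAt.continuousWithinAt)
      (fun s _ => (hasDerivAt_weylS ξ hħ g q s).hasDerivWithinAt)
      (fun s hs => hsup s ⟨hs.1, hs.2.le.trans ht.2⟩ q) t ⟨ht.1, le_rfl⟩
    simpa [weylS_zero] using this
  -- A second mean value inequality bounds the first-order Taylor remainder pointwise by `t²` times
  -- the majorant; after division by `t` its `L²` norm is `O(t)`.
  have htwo : ∀ t ∈ Set.Ioc (0 : ℝ) 1, ∀ q : ℝ,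
      ‖weylS ħ (t • ξ) f q - f q - t * g q‖ ≤ K * (1 + q ^ 2)⁻¹ * t * t := by
    intro t ht q
    have hd : ∀ s : ℝ, HasDerivAt (fun s : ℝ => weylS ħ (s • ξ) f q - s * g q)
        (weylS ħ (s • ξ) g q - g q) s := by
      intro s
      have h0 : HasDerivAt (fun x : ℝ => (x : ℂ)) 1 s := Complex.ofRealCLM.hasDerivAt
      exact ((hasDerivAt_weylS ξ hħ f q s).sub (h0.mul_const (g q))).congr_deriv (by rw [one_mul])
    have := norm_image_sub_le_of_norm_deriv_right_le_segment
      (f := fun s : ℝ => weylS ħ (s • ξ) f q - s * g q) (a := 0) (b := t)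
      (C := K * (1 + q ^ 2)⁻¹ * t)
      (fun s _ => (hd s).continuousAt.continuousWithinAt)
      (fun s _ => (hd s).hasDerivWithinAt)
      (fun s hs => (hone s ⟨hs.1, hs.2.le.trans ht.2⟩ q).trans (by
        have := hs.2.le
        gcongr)) t ⟨ht.1.le, le_rfl⟩
    have e : weylS ħ (t • ξ) f q - f q - t * g q =
        weylS ħ (t • ξ) f q - t * g q - (weylS ħ ((0 : ℝ) • ξ) f q - ((0 : ℝ) : ℂ) * g q) := by
      rw [zero_smul, weylS_zero]
      push_cast
      ring
    rw [e]
    simpa using this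
  set B : Lp ℝ 2 (volume : Measure ℝ) := memLp_inv_one_add_sq.toLp _ with hB
  have hnorm : ∀ t ∈ Set.Ioc (0 : ℝ) 1,
      ‖((t⁻¹ : ℝ) : ℂ) • (schwartzToL2 (weylS ħ (t • ξ) f) - schwartzToL2 f) - schwartzToL2 g‖ ≤
        K * t * ‖B‖ := by
    intro t ht
    have ht0 : (t : ℂ) ≠ 0 := by exact_mod_cast ht.1.ne'
    rw [← map_sub, ← map_smul, ← map_sub]
    refine Lp.norm_le_mul_norm_of_ae_le_mul ?_
    filter_upwards [coeFn_schwartzToL2 (((t⁻¹ : ℝ) : ℂ) • (weylS ħ (t • ξ) f - f) - g),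
      memLp_inv_one_add_sq.coeFn_toLp] with q h1 h2
    rw [h1, h2, Real.norm_of_nonneg (by positivity)]
    change ‖((t⁻¹ : ℝ) : ℂ) * (weylS ħ (t • ξ) f q - f q) - g q‖ ≤ _
    have e : ((t⁻¹ : ℝ) : ℂ) * (weylS ħ (t • ξ) f q - f q) - g q =
        ((t⁻¹ : ℝ) : ℂ) * (weylS ħ (t • ξ) f q - f q - t * g q) := by
      push_cast
      field_simp
    rw [e, norm_mul, Complex.norm_real, Real.norm_of_nonneg (inv_nonneg.2 ht.1.le)]
    calc _ ≤ t⁻¹ * (K * (1 + q ^ 2)⁻¹ * t * t) := by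
          have := ht.1.le
          gcongr
          exact htwo t ht q
      _ = K * t * (1 + q ^ 2)⁻¹ := by
          have := ht.1.ne'
          field_simp
  rw [tendsto_iff_norm_sub_tendsto_zero]
  refine squeeze_zero' (g := fun t => K * t * ‖B‖) (Eventually.of_forall fun t => norm_nonneg _) ?_ ?_
  · filter_upwards [Ioc_mem_nhdsGT one_pos] with t ht using hnorm t ht
  · have : Tendsto (fun t : ℝ => K * t * ‖B‖) (𝓝 0) (𝓝 (K * 0 * ‖B‖)) :=
      Continuous.tendsto (by fun_prop) 0
    simp only [mul_zero, zero_mul] at this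
    exact this.mono_left nhdsWithin_le_nhds

/-- The Weyl operator `e^{(i/ħ) ξ·x̂}` on `L²(ℝ)`. -/
def weyl (ħ : ℝ) (ξ : Fin 2 → ℝ) : L2 →L[ℂ] L2 :=
  (schwartzToL2 ∘ₗ (weylS ħ ξ).toLinearMap).extendOfNorm schwartzToL2

theorem weyl_schwartz (f : 𝓢(ℝ, ℂ)) : weyl ħ ξ (schwartzToL2 f) = schwartzToL2 (weylS ħ ξ f) :=
  LinearMap.extendOfNorm_eq dense_range_schwartzToL2
    ⟨1, fun f => by rw [one_mul]; exact (norm_weylS ξ f).le⟩ f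

theorem norm_weyl (x : L2) : ‖weyl ħ ξ x‖ = ‖x‖ := by
  have hclosed : IsClosed {x : L2 | ‖weyl ħ ξ x‖ = ‖x‖} := isClosed_eq (by fun_prop) (by fun_prop)
  refine hclosed.closure_subset_iff.2 ?_ (dense_range_schwartzToL2 x)
  rintro _ ⟨f, rfl⟩
  change ‖weyl ħ ξ (schwartzToL2 f)‖ = _
  rw [weyl_schwartz, norm_weylS]

theorem clm_ext_schwartz {T T' : L2 →L[ℂ] L2} (h : ∀ f, T (schwartzToL2 f) = T' (schwartzToL2 f)) :
    T = T' := by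
  refine ContinuousLinearMap.ext fun x => ?_
  exact congrFun (DenseRange.equalizer (f := schwartzToL2) dense_range_schwartzToL2 T.continuous
    T'.continuous (funext h)) x

theorem adjoint_weyl_comp : ContinuousLinearMap.adjoint (weyl ħ ξ) ∘L weyl ħ ξ = 1 :=
  (ContinuousLinearMap.norm_map_iff_adjoint_comp_self _).1 (norm_weyl ξ)

/-- The Weyl operator is the exponential of `(i/ħ) ξ·x̂`, and the only one. -/
theorem isExp_linearObservable_iff (hħ : ħ ≠ 0) (V : L2 →L[ℂ] L2) :
    IsExp ((Complex.I / (ħ : ℂ)) • linearObservable ħ ξ) V ↔ V = weyl ħ ξ := by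
  have hc : Complex.I / (ħ : ℂ) ≠ 0 :=
    div_ne_zero Complex.I_ne_zero (by exact_mod_cast hħ)
  set c := Complex.I / (ħ : ℂ) with hcdef
  have hgraph : ∀ x, x ∈ (c • linearObservable ħ ξ).graph ↔
      x ∈ closure ((onSchwartz (genS ħ ξ)).graph : Set (L2 × L2)) := by
    intro x
    have h1 : x ∈ (c • linearObservable ħ ξ).graph ↔
        (x.1, c⁻¹ • x.2) ∈ (linearObservable ħ ξ).graph := by
      simp only [LinearPMap.mem_graph_iff, LinearPMap.smul_apply]
      constructor
      · rintro ⟨y, hy, hy'⟩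
        exact ⟨y, hy, by rw [← hy', smul_smul, inv_mul_cancel₀ hc, one_smul]⟩
      · rintro ⟨y, hy, hy'⟩
        exact ⟨y, hy, by rw [hy', smul_smul, mul_inv_cancel₀ hc, one_smul]⟩
    have h2 : (x.1, c⁻¹ • x.2) ∈ (linearObservable ħ ξ).graph ↔
        (x.1, c⁻¹ • x.2) ∈ closure ((onSchwartz (linOp ħ ξ)).graph : Set (L2 × L2)) :=
      mem_graph_closure_iff (isClosable_onSchwartz (inner_linOp ξ)) _
    -- Rescaling the second component by a nonzero constant is a homeomorphism, so multiplying the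
    -- closure by `i/ħ` is the same as closing the multiple.
    set Φ : L2 × L2 ≃ₜ L2 × L2 := (Homeomorph.refl L2).prodCongr
      (Homeomorph.smulOfNeZero c⁻¹ (inv_ne_zero hc)) with hΦ
    have h3 : ((onSchwartz (genS ħ ξ)).graph : Set (L2 × L2)) =
        Φ ⁻¹' ((onSchwartz (linOp ħ ξ)).graph : Set (L2 × L2)) := by
      ext y
      change y ∈ (onSchwartz (genS ħ ξ)).graph ↔
        (y.1, c⁻¹ • y.2) ∈ (onSchwartz (linOp ħ ξ)).graph
      rw [mem_graph_onSchwartz, mem_graph_onSchwartz]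
      refine exists_congr fun f => ?_
      have h4 : schwartzToL2 (genS ħ ξ f) = c • schwartzToL2 (linOp ħ ξ f) := by
        rw [← map_smul]
        rfl
      rw [Prod.ext_iff, Prod.ext_iff, h4]
      simp only [inv_smul_eq_iff₀ hc]
    rw [h1, h2, h3, ← Φ.preimage_closure]
    rfl
  have hU1 : weyl ħ ξ = weyl ħ ((1 : ℝ) • ξ) := by rw [one_smul]
  rw [hU1]
  have hpair : ∀ f g, (f, g) ∈ (onSchwartz (genS ħ ξ)).graph →
      ∃ u, f = schwartzToL2 u ∧ g = schwartzToL2 (genS ħ ξ u) := by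
    intro f g h
    obtain ⟨u, hu⟩ := (mem_graph_onSchwartz _ _).1 h
    exact ⟨u, (Prod.mk.inj hu).1, (Prod.mk.inj hu).2⟩
  refine isExp_iff_of_unitaryGroup (U := fun t => weyl ħ (t • ξ)) (onSchwartz (genS ħ ξ)).graph
    hgraph ?_ ?_ ?_ ?_ ?_ ?_ ?_ V
  · refine dense_range_schwartzToL2.mono ?_
    rintro _ ⟨f, rfl⟩
    exact ⟨_, (mem_graph_onSchwartz _ _).2 ⟨f, rfl⟩, rfl⟩
  · rintro ⟨x, x'⟩ hx ⟨y, y'⟩ hy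
    obtain ⟨f, rfl, rfl⟩ := hpair _ _ hx
    obtain ⟨g, rfl, rfl⟩ := hpair _ _ hy
    exact inner_genS ξ f g
  · refine clm_ext_schwartz fun f => ?_
    rw [weyl_schwartz, zero_smul, weylS_zero]
    rfl
  · intro s t
    refine clm_ext_schwartz fun f => ?_
    rw [ContinuousLinearMap.comp_apply, weyl_schwartz, weyl_schwartz, weyl_schwartz, weylS_add_smul]
  · exact fun t x => norm_weyl _ x
  · intro f g h
    obtain ⟨u, rfl, rfl⟩ := hpair _ _ h
    simp only [weyl_schwartz]
    exact tendsto_weylS ξ hħ u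
  · intro t _ f g h
    obtain ⟨u, rfl, rfl⟩ := hpair _ _ h
    rw [mem_graph_onSchwartz]
    exact ⟨weylS ħ (t • ξ) u, by rw [weyl_schwartz, weyl_schwartz, genS_weylS ξ hħ]⟩

end WeylCalculus
end

noncomputable section
namespace WeylCalculus

namespace Oscillator

/-! ### Weyl operators in the Hermite basis -/

variable (O : Oscillator) (ξ : Fin 2 → ℝ)

/-- The displacement of the coherent states under the Weyl operator. -/
def disp : ℂ := (Complex.I * ξ 1 - O.ν * ξ 0) / O.s

/-- A consequence of `s² = 2ħ Re ν`. It lets the action on coherent states be expressed through the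
displacement and its conjugate alone. -/
theorem disp_add : O.disp ξ + O.s * ξ 0 / O.ħ = -(starRingEnd ℂ) (O.disp ξ) := by
  have hs := O.s_ne
  have hħ := O.ħ_ne
  have h2 : (starRingEnd ℂ) O.ν = 2 * O.ν.re - O.ν := by rw [← add_conj_ν]; ring
  simp only [disp, map_div₀, map_sub, map_mul, Complex.conj_I, Complex.conj_ofReal, h2]
  field_simp
  rw [O.s_sq']
  ring

theorem weylS_coh (z : ℂ) : weylS O.ħ ξ (O.coh z) =
    Complex.exp (-(starRingEnd ℂ) (O.disp ξ) * z -
      (starRingEnd ℂ) (O.disp ξ) * O.disp ξ / 2) • O.coh (z + O.disp ξ) := by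
  ext q
  change _ = Complex.exp (-(starRingEnd ℂ) (O.disp ξ) * z -
      (starRingEnd ℂ) (O.disp ξ) * O.disp ξ / 2) * O.coh (z + O.disp ξ) q
  rw [weylS_apply, coh_apply, coh_apply, ← Complex.exp_add, ← Complex.exp_add]
  congr 1
  have hs := O.s_ne
  have hħ := O.ħ_ne
  rw [show (starRingEnd ℂ) (O.disp ξ) = -(O.disp ξ + O.s * ξ 0 / O.ħ) by
    rw [O.disp_add ξ, neg_neg]]
  have h1 : Complex.I * ξ 1 = O.s * O.disp ξ + O.ν * ξ 0 := by
    rw [disp]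
    field_simp
    ring
  have h2 : Complex.I * ((ξ 1 / O.ħ : ℝ) : ℂ) = (O.s * O.disp ξ + O.ν * ξ 0) / O.ħ := by
    rw [← h1]
    push_cast
    ring
  have h3 : Complex.I * ((ξ 0 * ξ 1 / (2 * O.ħ) : ℝ) : ℂ) =
      (O.s * O.disp ξ + O.ν * ξ 0) * ξ 0 / (2 * O.ħ) := by
    rw [← h1]
    push_cast
    ring
  rw [h2, h3]
  push_cast
  field_simp
  ring

theorem weylS_cre (f : 𝓢(ℝ, ℂ)) : weylS O.ħ ξ (O.cre f) =
    O.cre (weylS O.ħ ξ f) - (starRingEnd ℂ) (O.disp ξ) • weylS O.ħ ξ f := by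
  have hs := O.s_ne
  have hħ := O.ħ_ne
  simp only [cre_apply, map_smul, map_add, dOp_weylS, position_weylS]
  simp only [disp, map_div₀, map_sub, map_mul, Complex.conj_I, Complex.conj_ofReal]
  push_cast
  match_scalars
  · field_simp
  · field_simp
  · field_simp
    ring

theorem weylS_exc (n : ℕ) : weylS O.ħ ξ (O.exc n) =
    ((O.cre - (starRingEnd ℂ) (O.disp ξ) • (1 : 𝓢(ℝ, ℂ) →L[ℂ] 𝓢(ℝ, ℂ))) ^ n)
      (weylS O.ħ ξ (O.coh 0)) := by
  induction n with
  | zero => rfl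
  | succ n ih =>
    rw [exc_succ, weylS_cre, ih, pow_succ']
    rfl

theorem inner_pow_cre (α : ℂ) (n : ℕ) (f g : 𝓢(ℝ, ℂ)) :
    inner ℂ (schwartzToL2 f)
      (schwartzToL2 (((O.cre - (starRingEnd ℂ) α • (1 : 𝓢(ℝ, ℂ) →L[ℂ] 𝓢(ℝ, ℂ))) ^ n) g)) =
    inner ℂ (schwartzToL2 (((O.ann - α • (1 : 𝓢(ℝ, ℂ) →L[ℂ] 𝓢(ℝ, ℂ))) ^ n) f))
      (schwartzToL2 g) := by
  induction n generalizing f with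
  | zero => rfl
  | succ n ih =>
    rw [pow_succ', pow_succ]
    change inner ℂ (schwartzToL2 f) (schwartzToL2 (O.cre _ - (starRingEnd ℂ) α • _)) =
      inner ℂ (schwartzToL2 (((O.ann - α • (1 : 𝓢(ℝ, ℂ) →L[ℂ] 𝓢(ℝ, ℂ))) ^ n)
        (O.ann f - α • f))) (schwartzToL2 g)
    rw [← ih, map_sub, map_smul, inner_sub_right, inner_smul_right, map_sub, map_smul,
      inner_sub_left, inner_smul_left]
    congr 1
    rw [← inner_conj_symm, inner_cre, inner_conj_symm]
    rfl

theorem ann_pow_exc (j k : ℕ) :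
    (O.ann ^ j) (O.exc (k + j)) = (((k + j).factorial : ℂ) / k.factorial) • O.exc k := by
  induction j with
  | zero =>
    have : (k.factorial : ℂ) ≠ 0 := by exact_mod_cast k.factorial_ne_zero
    simp [div_self this]
  | succ j ih =>
    rw [pow_succ]
    change (O.ann ^ j) (O.ann (O.exc (k + j + 1))) = _
    rw [ann_exc_succ, map_smul, ih, smul_smul, ← add_assoc, Nat.factorial_succ (k + j)]
    push_cast
    congr 1
    ring

/-- Write `α` for the displacement. Moving the Weyl operator through the creation operators gives
`(a† - ᾱ)ⁿ` on a multiple of the coherent state at `α`; its adjoint `(a - α)ⁿ` acts on the excited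
state by the binomial theorem, and pairing with the coherent state yields powers of `α`. The finite
sum is the Laguerre polynomial `Lₙ(|α|²)`. -/
theorem inner_exc_weylS (n : ℕ) :
    inner ℂ (schwartzToL2 (O.exc n)) (schwartzToL2 (weylS O.ħ ξ (O.exc n))) =
      Complex.exp (-(‖O.disp ξ‖ ^ 2 : ℝ) / 2) * (n.factorial *
        ∑ k ∈ Finset.range (n + 1), (n.choose k : ℂ) *
          ((-(‖O.disp ξ‖ ^ 2 : ℝ) : ℂ) ^ k / k.factorial)) := by
  rw [weylS_exc, inner_pow_cre, weylS_coh, map_smul, inner_smul_right, zero_add, mul_zero, zero_sub]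
  have hc : (starRingEnd ℂ) (O.disp ξ) * O.disp ξ = ((‖O.disp ξ‖ ^ 2 : ℝ) : ℂ) := by
    rw [Complex.conj_mul']
    push_cast
    rfl
  rw [hc, neg_div]
  congr 1
  have hcomm : Commute (-(O.disp ξ) • (1 : 𝓢(ℝ, ℂ) →L[ℂ] 𝓢(ℝ, ℂ))) O.ann := by
    ext f q
    simp
  have hpow : ∀ k (f : 𝓢(ℝ, ℂ)), ((-(O.disp ξ) • (1 : 𝓢(ℝ, ℂ) →L[ℂ] 𝓢(ℝ, ℂ))) ^ k) f =
      (-(O.disp ξ)) ^ k • f := by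
    intro k f
    rw [smul_pow, one_pow]
    rfl
  have hexp : ((O.ann - O.disp ξ • (1 : 𝓢(ℝ, ℂ) →L[ℂ] 𝓢(ℝ, ℂ))) ^ n) (O.exc n) =
      ∑ k ∈ Finset.range (n + 1), ((n.choose k : ℂ) * ((-(O.disp ξ)) ^ k *
        (n.factorial / k.factorial))) • O.exc k := by
    rw [sub_eq_neg_add, ← neg_smul, hcomm.add_pow, sum_apply]
    refine Finset.sum_congr rfl fun k hk => ?_
    obtain ⟨j, rfl⟩ := Nat.exists_eq_add_of_le (Nat.lt_succ_iff.1 (Finset.mem_range.1 hk))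
    rw [Nat.add_sub_cancel_left, ← nsmul_eq_mul', ← Nat.cast_smul_eq_nsmul ℂ]
    change ((k + j).choose k : ℂ) • ((-(O.disp ξ) • (1 : 𝓢(ℝ, ℂ) →L[ℂ] 𝓢(ℝ, ℂ))) ^ k)
      ((O.ann ^ j) (O.exc (k + j))) = _
    rw [ann_pow_exc, hpow, smul_smul, smul_smul]
    congr 1
    ring
  rw [hexp, map_sum, sum_inner, Finset.mul_sum]
  refine Finset.sum_congr rfl fun k _ => ?_
  rw [map_smul, inner_smul_left, inner_exc_coh, ← hc]
  simp only [map_mul, map_pow, map_neg, map_div₀, map_natCast]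
  rw [← neg_mul, mul_pow]
  ring

theorem inner_basis_weyl (n : ℕ) :
    inner ℂ (O.basis n) (weyl O.ħ ξ (O.basis n)) =
      Complex.exp (-(‖O.disp ξ‖ ^ 2 : ℝ) / 2) *
        ∑ k ∈ Finset.range (n + 1), (n.choose k : ℂ) *
          ((-(‖O.disp ξ‖ ^ 2 : ℝ) : ℂ) ^ k / k.factorial) := by
  rw [basis_apply, fock, map_smul, weyl_schwartz, inner_smul_left, inner_smul_right,
    inner_exc_weylS, map_inv₀, Complex.conj_ofReal]
  have h1 : ((Real.sqrt n.factorial : ℝ) : ℂ) ^ 2 = n.factorial := by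
    rw [← Complex.ofReal_pow, Real.sq_sqrt (by positivity)]
    simp
  have h2 : ((Real.sqrt n.factorial : ℝ) : ℂ) ≠ 0 := by
    have : Real.sqrt n.factorial ≠ 0 := Real.sqrt_ne_zero'.2 (by positivity)
    exact_mod_cast this
  rw [← h1]
  field_simp

/-- The generating function of the Laguerre polynomials. -/
theorem _root_.WeylCalculus.hasSum_pow_mul_sum_choose {r : ℝ} (hr0 : 0 ≤ r) (hr1 : r < 1) (x : ℂ) :
    HasSum (fun n : ℕ => (r : ℂ) ^ n *
      ∑ k ∈ Finset.range (n + 1), (n.choose k : ℂ) * (x ^ k / k.factorial))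
      ((1 - r : ℂ)⁻¹ * Complex.exp (x * r / (1 - r))) := by
  have hr : ‖(r : ℂ)‖ < 1 := by rwa [Complex.norm_real, Real.norm_of_nonneg hr0]
  have hrR : ‖r‖ < 1 := by rwa [Real.norm_of_nonneg hr0]
  have h1r : (1 - r : ℂ) ≠ 0 := by
    have : (1 - r : ℝ) ≠ 0 := by linarith
    exact_mod_cast this
  have hR : ∀ k : ℕ, HasSum (fun n : ℕ => (n.choose k : ℝ) * r ^ n) (r ^ k / (1 - r) ^ (k + 1)) := by
    intro k
    have h := (hasSum_choose_mul_geometric_of_norm_lt_one k hrR).mul_left (r ^ k)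
    have hinj : Function.Injective fun n : ℕ => n + k := add_left_injective k
    rw [← hinj.hasSum_iff]
    · rw [mul_one_div] at h
      refine h.congr_fun fun n => ?_
      simp only [Function.comp, pow_add]
      ring
    · intro n hn
      have : n < k := by
        by_contra hk
        exact hn ⟨n - k, Nat.sub_add_cancel (not_lt.1 hk)⟩
      simp [Nat.choose_eq_zero_of_lt this]
  have hC : ∀ k : ℕ, HasSum (fun n : ℕ => (n.choose k : ℂ) * (r : ℂ) ^ n)
      ((r : ℂ) ^ k / (1 - r) ^ (k + 1)) := by
    intro k
    have := Complex.hasSum_ofReal.2 (hR k)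
    push_cast at this
    exact this
  -- Summing over `n` first gives the negative binomial series `hC`; the remaining sum over `k` is
  -- the exponential series at `xr/(1 - r)`. The same computation with `‖x‖` gives absolute
  -- convergence, hence the exchange.
  set F : ℕ × ℕ → ℂ := fun p => (x ^ p.1 / p.1.factorial) * ((p.2.choose p.1 : ℂ) * (r : ℂ) ^ p.2)
    with hF
  have hsum : Summable F := by
    rw [← summable_norm_iff, summable_prod_of_nonneg fun _ => norm_nonneg _]
    have e : ∀ k n : ℕ, ‖F (k, n)‖ = (‖x‖ ^ k / k.factorial) * ((n.choose k : ℝ) * r ^ n) := by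
      intro k n
      simp [hF, abs_of_nonneg hr0]
    simp only [e]
    refine ⟨fun k => (hR k).summable.mul_left _, ?_⟩
    simp only [fun k => ((hR k).mul_left (‖x‖ ^ k / k.factorial)).tsum_eq]
    have := (Real.summable_pow_div_factorial (‖x‖ * r / (1 - r))).mul_left (1 - r)⁻¹
    refine this.congr fun k => ?_
    have : (1 - r : ℝ) ≠ 0 := by linarith
    rw [div_pow, mul_pow]
    field_simp
    ring
  have h2 : HasSum F ((1 - r : ℂ)⁻¹ * Complex.exp (x * r / (1 - r))) := by
    have h3 := hsum.hasSum.prod_fiberwise fun k => (hC k).mul_left (x ^ k / k.factorial)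
    have h4 : HasSum (fun k : ℕ => x ^ k / k.factorial * ((r : ℂ) ^ k / (1 - r) ^ (k + 1)))
        ((1 - r : ℂ)⁻¹ * Complex.exp (x * r / (1 - r))) := by
      have h5 := (NormedSpace.expSeries_div_hasSum_exp (x * r / (1 - r) : ℂ)).mul_left
        (1 - r : ℂ)⁻¹
      rw [← Complex.exp_eq_exp_ℂ] at h5
      refine h5.congr_fun fun k => ?_
      rw [div_pow, mul_pow]
      field_simp
      ring
    rw [← h3.unique h4]
    exact hsum.hasSum
  have h6 := ((Equiv.prodComm ℕ ℕ).hasSum_iff.2 h2).prod_fiberwise (g := fun n : ℕ => (r : ℂ) ^ n *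
      ∑ k ∈ Finset.range (n + 1), (n.choose k : ℂ) * (x ^ k / k.factorial)) fun n => by
    rw [Finset.mul_sum]
    have : ∀ k, (F ∘ Equiv.prodComm ℕ ℕ) (n, k) =
        (r : ℂ) ^ n * ((n.choose k : ℂ) * (x ^ k / k.factorial)) := by
      intro k
      simp only [hF, Function.comp, Equiv.prodComm_apply, Prod.swap_prod_mk]
      ring
    simp only [this]
    refine hasSum_sum_of_ne_finset_zero fun k hk => ?_
    rw [Finset.mem_range, not_lt] at hk
    simp [Nat.choose_eq_zero_of_lt (Nat.lt_of_succ_le hk)]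
  exact h6

end Oscillator

end WeylCalculus
end

noncomputable section
namespace WeylCalculus

/-! ### Mehler kernels -/

/-- A bounded operator that is a Carleman integral operator on a total set is one everywhere. -/
theorem ae_eq_inner_of_total {D : Set L2}
    (hD : (Submodule.span ℂ D).topologicalClosure = ⊤) (T : L2 →L[ℂ] L2) (k : ℝ → L2)
    (h : ∀ ψ ∈ D, ∀ᵐ q, T ψ q = inner ℂ (k q) ψ) (ψ : L2) : ∀ᵐ q, T ψ q = inner ℂ (k q) ψ := by
  have hspan : ∀ ψ ∈ Submodule.span ℂ D, ∀ᵐ q, T ψ q = inner ℂ (k q) ψ := by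
    intro ψ hψ
    induction hψ using Submodule.span_induction with
    | mem x hx => exact h x hx
    | zero =>
      rw [map_zero]
      filter_upwards [Lp.coeFn_zero ℂ 2 (volume : Measure ℝ)] with q hq
      rw [hq, inner_zero_right]
      rfl
    | add x y _ _ hx hy =>
      rw [map_add]
      filter_upwards [Lp.coeFn_add (T x) (T y), hx, hy] with q h1 h2 h3
      rw [h1, Pi.add_apply, h2, h3, inner_add_right]
    | smul c x _ hx =>
      rw [map_smul]
      filter_upwards [Lp.coeFn_smul c (T x), hx] with q h1 h2
      rw [h1, Pi.smul_apply, h2, inner_smul_right, smul_eq_mul]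
  have hmem : ψ ∈ closure (Submodule.span ℂ D : Set L2) := by
    rw [← Submodule.topologicalClosure_coe, hD]
    trivial
  -- Approximate `ψ` by `u n` in the span. A subsequence of `T (u n)` converges almost everywhere,
  -- whereas `⟪k q, u n⟫` converges for every `q` because `k q` is in `L²`.
  obtain ⟨u, hu, hlim⟩ := mem_closure_iff_seq_limit.1 hmem
  have h1 : TendstoInMeasure volume (fun n => (T (u n) : ℝ → ℂ)) atTop (T ψ) :=
    tendstoInMeasure_of_tendsto_Lp ((T.continuous.tendsto ψ).comp hlim)
  obtain ⟨ns, hns, h2⟩ := h1.exists_seq_tendsto_ae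
  have h3 : ∀ᵐ q, ∀ n, T (u n) q = inner ℂ (k q) (u n) :=
    ae_all_iff.2 fun n => hspan _ (hu n)
  filter_upwards [h2, h3] with q h4 h5
  refine tendsto_nhds_unique h4 ?_
  simp only [h5]
  exact (Continuous.tendsto (by fun_prop : Continuous fun x => inner ℂ (k q) x) ψ).comp
    (hlim.comp hns.tendsto_atTop)

namespace Oscillator

variable (O : Oscillator)

/-- A Gaussian symbol adapted to the oscillator. -/
def mehlerSymbol (C T : ℝ) (x : Fin 2 → ℝ) : ℝ :=
  C * Real.exp (-(T / (O.ħ * O.ν.re)) * ((x 0 + O.ν.im * x 1) ^ 2 + O.ν.re ^ 2 * x 1 ^ 2))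

/-- The quadratic coefficient of the Mehler kernel. -/
def mehlerCoeff (T : ℝ) : ℂ :=
  ((O.ν.re / (4 * O.ħ * T) + T * O.ν.re / (4 * O.ħ) : ℝ) : ℂ) +
    ((O.ν.im / (2 * O.ħ) : ℝ) : ℂ) * Complex.I

/-- The complex conjugate of the Mehler kernel, without the constant factor. -/
def mehler {T : ℝ} (hT : 0 < T) (q : ℝ) : 𝓢(ℝ, ℂ) :=
  gaussian (O.mehlerCoeff T) ((q * (O.ν.re / (2 * O.ħ * T) - T * O.ν.re / (2 * O.ħ)) : ℝ) : ℂ)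
    (-(q : ℂ) ^ 2 * (starRingEnd ℂ) (O.mehlerCoeff T) +
      (1 / 2 * Real.log (Real.pi / (T / (O.ħ * O.ν.re))) : ℝ)) (by
    have h1 := O.hħ
    have h2 := O.hν
    have : (O.mehlerCoeff T).re = O.ν.re / (4 * O.ħ * T) + T * O.ν.re / (4 * O.ħ) := by
      rw [mehlerCoeff, Complex.add_re, Complex.ofReal_re, Complex.re_ofReal_mul, Complex.I_re,
        mul_zero, add_zero]
    rw [this]
    positivity)

theorem conj_mehlerCoeff (T : ℝ) : (starRingEnd ℂ) (O.mehlerCoeff T) =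
    ((O.ν.re / (4 * O.ħ * T) + T * O.ν.re / (4 * O.ħ) : ℝ) : ℂ) -
      ((O.ν.im / (2 * O.ħ) : ℝ) : ℂ) * Complex.I := by
  rw [mehlerCoeff, map_add, map_mul, Complex.conj_ofReal, Complex.conj_ofReal, Complex.conj_I]
  ring

theorem conj_mehler_apply {T : ℝ} (hT : 0 < T) (q q' : ℝ) : (starRingEnd ℂ) (O.mehler hT q q') =
    Complex.exp (-(starRingEnd ℂ) (O.mehlerCoeff T) * q' ^ 2 +
      ((q * (O.ν.re / (2 * O.ħ * T) - T * O.ν.re / (2 * O.ħ)) : ℝ) : ℂ) * q' +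
      (-(q : ℂ) ^ 2 * O.mehlerCoeff T +
        (1 / 2 * Real.log (Real.pi / (T / (O.ħ * O.ν.re))) : ℝ))) := by
  rw [mehler, gaussian_apply, ← Complex.exp_conj]
  simp only [map_add, map_mul, map_neg, map_pow, Complex.conj_ofReal, Complex.conj_conj]

theorem mehlerSymbol_eq (C T p q : ℝ) : (O.mehlerSymbol C T ![p, q] : ℂ) =
    C * Complex.exp (-((T / (O.ħ * O.ν.re) : ℝ) : ℂ) * p ^ 2 +
      (-2 * (T / (O.ħ * O.ν.re) : ℝ) * O.ν.im * q) * p +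
      -(T / (O.ħ * O.ν.re) : ℝ) * (O.ν.im ^ 2 + O.ν.re ^ 2) * q ^ 2) := by
  rw [mehlerSymbol, Complex.ofReal_mul, Complex.ofReal_exp]
  congr 2
  simp only [Matrix.cons_val_zero, Matrix.cons_val_one]
  push_cast
  ring

theorem integrable_mehlerSymbol (C : ℝ) {T : ℝ} (hT : 0 < T) (q : ℝ) :
    Integrable fun p : ℝ => (O.mehlerSymbol C T ![p, q] : ℂ) := by
  simp only [mehlerSymbol_eq]
  refine (integrable_cexp_quadratic ?_ _ _).const_mul _
  simp only [Complex.ofReal_re]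
  exact div_pos hT (mul_pos O.hħ O.hν)

theorem weylKernel_mehlerSymbol (C : ℝ) {T : ℝ} (hT : 0 < T) (q q' : ℝ) :
    weylKernel O.ħ (fun x => (O.mehlerSymbol C T x : ℂ)) q q' =
      ((C / (2 * Real.pi * O.ħ) : ℝ) : ℂ) * (starRingEnd ℂ) (O.mehler hT q q') := by
  have ha : 0 < T / (O.ħ * O.ν.re) := div_pos hT (mul_pos O.hħ O.hν)
  have hħ := O.ħ_ne
  have hν := O.νre_ne
  have hT' : (T : ℂ) ≠ 0 := by exact_mod_cast hT.ne'
  set a := T / (O.ħ * O.ν.re) with hadef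
  have h1 : ∀ p : ℝ, Complex.exp (Complex.I / O.ħ * ((q - q') * p)) *
      (O.mehlerSymbol C T ![p, (q + q') / 2] : ℂ) =
      C * Complex.exp (-(a : ℂ) * p ^ 2 + (Complex.I * (q - q') / O.ħ -
        a * O.ν.im * (q + q')) * p + -a * (O.ν.im ^ 2 + O.ν.re ^ 2) * ((q + q') / 2) ^ 2) := by
    intro p
    rw [mehlerSymbol_eq, mul_left_comm, ← Complex.exp_add, ← hadef]
    congr 2
    push_cast
    field_simp
    ring
  rw [weylKernel]
  simp only [h1]
  rw [integral_const_mul, integral_cexp_real_quadratic ha, conj_mehler_apply, ← hadef,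
    conj_mehlerCoeff, mehlerCoeff, ← mul_assoc]
  congr 1
  · push_cast
    ring
  congr 1
  rw [hadef]
  push_cast
  field_simp
  ring_nf
  simp only [Complex.I_sq]
  ring

/-- Mehler's formula without Hermite polynomials: a Gaussian kernel applied to a coherent state is a
Gaussian integral, and the outcome is again a coherent state with contracted parameter. -/
theorem integral_mehler_coh {T : ℝ} (hT : 0 < T) (z : ℂ) (q : ℝ) :
    ∫ q' : ℝ, (starRingEnd ℂ) (O.mehler hT q q') * O.coh z q' =
      ((2 * Real.pi * O.ħ / (1 + T) : ℝ) : ℂ) * O.coh (((1 - T) / (1 + T) : ℝ) * z) q := by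
  have h1 := O.hħ
  have h2 := O.hν
  have hs := O.s_ne
  have hħ := O.ħ_ne
  have hν := O.νre_ne
  have hT' : (T : ℂ) ≠ 0 := by exact_mod_cast hT.ne'
  have hT1 : (1 + T : ℂ) ≠ 0 := by exact_mod_cast (by positivity : 1 + T ≠ 0)
  set α := O.ν.re * (1 + T) ^ 2 / (4 * O.ħ * T) with hα
  have hα0 : 0 < α := by positivity
  have hνd : O.ν / (2 * O.ħ) = (O.ν.re + O.ν.im * Complex.I) / (2 * O.ħ) := by
    rw [Complex.re_add_im]
  have e : ∀ q' : ℝ, (starRingEnd ℂ) (O.mehler hT q q') * O.coh z q' =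
      Complex.exp (-(α : ℂ) * q' ^ 2 +
        (((q * (O.ν.re / (2 * O.ħ * T) - T * O.ν.re / (2 * O.ħ)) : ℝ) : ℂ) + z * O.s / O.ħ) * q' +
        (-(q : ℂ) ^ 2 * O.mehlerCoeff T +
          (1 / 2 * Real.log (Real.pi / (T / (O.ħ * O.ν.re))) : ℝ) +
          (-z ^ 2 / 2 + (1 / 4 * Real.log (O.ν.re / (Real.pi * O.ħ)) : ℝ)))) := by
    intro q'
    rw [conj_mehler_apply, coh_apply, ← Complex.exp_add]
    congr 1
    -- The imaginary parts of the two quadratic coefficients cancel, which is why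
    -- `integral_cexp_real_quadratic` applies.
    have h3 : (starRingEnd ℂ) (O.mehlerCoeff T) + O.ν / (2 * O.ħ) = α := by
      rw [conj_mehlerCoeff, hα, hνd]
      push_cast
      field_simp
      ring
    linear_combination (-(q' : ℂ) ^ 2) * h3
  simp only [e]
  rw [integral_cexp_real_quadratic hα0, coh_apply]
  have hlog : 1 / 2 * Real.log (Real.pi / α) +
      1 / 2 * Real.log (Real.pi / (T / (O.ħ * O.ν.re))) =
      Real.log (2 * Real.pi * O.ħ / (1 + T)) := by
    have hpi := Real.pi_pos
    rw [← mul_add, ← Real.log_mul (by positivity) (by positivity)]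
    have : Real.pi / α * (Real.pi / (T / (O.ħ * O.ν.re))) =
        (2 * Real.pi * O.ħ / (1 + T)) ^ 2 := by
      rw [hα]
      field_simp
      ring
    rw [this, Real.log_pow]
    push_cast
    ring
  have hexp : ((2 * Real.pi * O.ħ / (1 + T) : ℝ) : ℂ) =
      Complex.exp ((1 / 2 * Real.log (Real.pi / α) : ℝ) +
      (1 / 2 * Real.log (Real.pi / (T / (O.ħ * O.ν.re))) : ℝ)) := by
    rw [← Complex.ofReal_add, hlog, ← Complex.ofReal_exp, Real.exp_log (by positivity)]
  rw [hexp, ← Complex.exp_add]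
  congr 1
  -- The same logarithms now stand in both exponents, so they may be treated as atoms.
  generalize ((1 / 2 * Real.log (Real.pi / α) : ℝ) : ℂ) = l1
  generalize ((1 / 2 * Real.log (Real.pi / (T / (O.ħ * O.ν.re))) : ℝ) : ℂ) = l2
  generalize ((1 / 4 * Real.log (O.ν.re / (Real.pi * O.ħ)) : ℝ) : ℂ) = l3
  rw [hα, mehlerCoeff, hνd]
  push_cast
  field_simp
  ring_nf
  simp only [O.s_sq']
  ring

theorem _root_.WeylCalculus.inner_apply_of_basis {E : Type*} [NormedAddCommGroup E]
    [InnerProductSpace ℂ E] [CompleteSpace E] (b : HilbertBasis ℕ ℂ E) {c : ℕ → ℂ} {A : E →L[ℂ] E}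
    (hA : ∀ n, A (b n) = c n • b n) (n : ℕ) (x : E) :
    inner ℂ (b n) (A x) = c n * inner ℂ (b n) x := by
  have hc : ∀ n, ‖c n‖ ≤ ‖A‖ := by
    intro n
    have h := A.le_opNorm (b n)
    rwa [hA, norm_smul, b.orthonormal.1 n, mul_one, mul_one] at h
  rw [eq_diagOp b hc hA, inner_diagOp b hc]

/-- The `n`-th coefficient of a coherent state is proportional to `zⁿ`, so multiplying it by `rⁿ`
amounts to rescaling `z`. -/
theorem apply_coh_of_basis {r c : ℝ} {A : L2 →L[ℂ] L2}
    (hA : ∀ n, A (O.basis n) = ((c * r ^ n : ℝ) : ℂ) • O.basis n) (z : ℂ) :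
    A (schwartzToL2 (O.coh z)) = (c : ℂ) • schwartzToL2 (O.coh (r * z)) := by
  refine hilbertBasis_ext O.basis fun n => ?_
  rw [inner_apply_of_basis O.basis hA, inner_smul_right, basis_apply, fock, inner_smul_left,
    inner_smul_left, inner_exc_coh, inner_exc_coh, mul_pow]
  push_cast
  ring

/-- The operator with eigenvalues `C / (1 + T) * ((1 - T) / (1 + T)) ^ n` in the Hermite basis has
a Gaussian Weyl symbol. -/
theorem hasWeylSymbol_mehler (C : ℝ) {T : ℝ} (hT : 0 < T) {A : L2 →L[ℂ] L2}
    (hA : ∀ n, A (O.basis n) = ((C / (1 + T) * ((1 - T) / (1 + T)) ^ n : ℝ) : ℂ) • O.basis n) :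
    HasWeylSymbol O.ħ A (fun x => (O.mehlerSymbol C T x : ℂ)) := by
  refine ⟨fun q => O.integrable_mehlerSymbol C hT q, fun ψ => ?_⟩
  simp only [O.weylKernel_mehlerSymbol C hT]
  set c : ℂ := ((C / (2 * Real.pi * O.ħ) : ℝ) : ℂ) with hc
  simp only [mul_assoc c]
  have h := ae_eq_inner_of_total O.total_coh A
    (fun q => (starRingEnd ℂ) c • schwartzToL2 (O.mehler hT q)) ?_ ψ
  · filter_upwards [h] with q hq
    have h1 := inner_schwartzToL2_left (O.mehler hT q) ψ
    refine ⟨h1.1.const_mul c, ?_⟩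
    rw [hq, inner_smul_left, Complex.conj_conj, h1.2, integral_const_mul]
  · rintro _ ⟨z, rfl⟩
    rw [O.apply_coh_of_basis hA, ← map_smul]
    filter_upwards [coeFn_schwartzToL2 (((C / (1 + T) : ℝ) : ℂ) •
      O.coh (((1 - T) / (1 + T) : ℝ) * z))] with q hq
    rw [hq, inner_smul_left, Complex.conj_conj, inner_schwartzToL2, integral_mehler_coh, hc,
      ← mul_assoc]
    change ((C / (1 + T) : ℝ) : ℂ) * _ = _
    congr 1
    have h1 := O.hħ.ne'
    have h2 := Real.pi_ne_zero
    rw [← Complex.ofReal_mul]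
    congr 1
    have h3 : 1 + T ≠ 0 := by positivity
    field_simp

end Oscillator

end WeylCalculus
end

noncomputable section
namespace WeylCalculus

/-! ### Weyl quantisation of quadratic symbols -/

open FourierTransform in
theorem integral_exp_eq_fourier {ħ : ℝ} (hħ : ħ ≠ 0) (f : 𝓢(ℝ, ℂ)) (p : ℝ) :
    ∫ y : ℝ, Complex.exp (-(Complex.I / ħ * (y * p))) * f y =
      𝓕 (f : ℝ → ℂ) (p / (2 * Real.pi * ħ)) := by
  rw [Real.fourier_real_eq_integral_exp_smul]
  refine integral_congr_ae (Eventually.of_forall fun y => ?_)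
  have h1 : (ħ : ℂ) ≠ 0 := by exact_mod_cast hħ
  have h2 : (Real.pi : ℂ) ≠ 0 := by exact_mod_cast Real.pi_ne_zero
  simp only [smul_eq_mul]
  congr 2
  push_cast
  field_simp

theorem integrable_exp_mul (ħ p : ℝ) (f : 𝓢(ℝ, ℂ)) :
    Integrable fun y : ℝ => Complex.exp (-(Complex.I / ħ * (y * p))) * f y := by
  refine f.integrable.bdd_mul (c := 1) (by fun_prop) (Eventually.of_forall fun y => ?_)
  rw [Complex.norm_exp]
  have : (-(Complex.I / ħ * (y * p))).re = 0 := by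
    have e : -(Complex.I / ħ * (y * p)) = ((-(y * p / ħ) : ℝ) : ℂ) * Complex.I := by
      push_cast
      ring
    rw [e, Complex.re_ofReal_mul, Complex.I_re, mul_zero]
  rw [this, Real.exp_zero]

open FourierTransform in
theorem integral_exp_momentum {ħ : ℝ} (hħ : ħ ≠ 0) (f : 𝓢(ℝ, ℂ)) (p : ℝ) :
    ∫ y : ℝ, Complex.exp (-(Complex.I / ħ * (y * p))) * momentum ħ f y =
      p * ∫ y : ℝ, Complex.exp (-(Complex.I / ħ * (y * p))) * f y := by
  have h1 : (ħ : ℂ) ≠ 0 := by exact_mod_cast hħ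
  have h2 : (Real.pi : ℂ) ≠ 0 := by exact_mod_cast Real.pi_ne_zero
  have e : ∀ y : ℝ, Complex.exp (-(Complex.I / ħ * (y * p))) * momentum ħ f y =
      -(Complex.I * ħ) * (Complex.exp (-(Complex.I / ħ * (y * p))) * dOp f y) := by
    intro y
    rw [momentum_apply, SchwartzMap.derivCLM_apply]
    ring
  simp only [e]
  rw [integral_const_mul, integral_exp_eq_fourier hħ, integral_exp_eq_fourier hħ]
  have h3 := congrFun (Real.fourier_deriv f.integrable f.differentiable (dOp f).integrable)
    (p / (2 * Real.pi * ħ))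
  change -(Complex.I * ħ) * 𝓕 (deriv f) (p / (2 * Real.pi * ħ)) = _
  rw [h3]
  simp only [smul_eq_mul]
  push_cast
  field_simp
  rw [Complex.I_sq]
  ring

open FourierTransform in
/-- Fourier inversion with Planck's constant. -/
theorem fourier_inversion_planck {ħ : ℝ} (hħ : 0 < ħ) (f : 𝓢(ℝ, ℂ)) (q : ℝ) :
    Integrable (fun p : ℝ => Complex.exp (Complex.I / ħ * (q * p)) *
      ∫ y : ℝ, Complex.exp (-(Complex.I / ħ * (y * p))) * f y) ∧
    f q = (1 / (2 * Real.pi * ħ) : ℝ) * ∫ p : ℝ, Complex.exp (Complex.I / ħ * (q * p)) *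
      ∫ y : ℝ, Complex.exp (-(Complex.I / ħ * (y * p))) * f y := by
  have hpi := Real.pi_pos
  have h1 : (ħ : ℂ) ≠ 0 := by exact_mod_cast hħ.ne'
  have h2 : (Real.pi : ℂ) ≠ 0 := by exact_mod_cast Real.pi_ne_zero
  have hc : 2 * Real.pi * ħ ≠ 0 := by positivity
  set h : ℝ → ℂ := fun w => Complex.exp ((2 * Real.pi * (w * q) : ℝ) * Complex.I) *
    𝓕 (f : ℝ → ℂ) w with hh
  have e : (fun p : ℝ => Complex.exp (Complex.I / ħ * (q * p)) *
      ∫ y : ℝ, Complex.exp (-(Complex.I / ħ * (y * p))) * f y) =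
      fun p : ℝ => h (p / (2 * Real.pi * ħ)) := by
    funext p
    rw [integral_exp_eq_fourier hħ.ne', hh]
    congr 2
    push_cast
    field_simp
  have hint : Integrable h := by
    refine Integrable.bdd_mul (c := 1) ?_ (by fun_prop) (Eventually.of_forall fun y => ?_)
    · rw [← SchwartzMap.fourier_coe]
      exact (𝓕 f).integrable
    · rw [Complex.norm_exp_ofReal_mul_I]
  have hinv : ∫ w, h w = f q := by
    have h3 : 𝓕⁻ (𝓕 (f : ℝ → ℂ)) q = ∫ w, h w := by
      rw [Real.fourierInv_eq']
      refine integral_congr_ae (Eventually.of_forall fun w => ?_)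
      simp only [hh, smul_eq_mul]
      congr 4
      simp
      ring
    rw [← h3, ← SchwartzMap.fourier_coe, ← SchwartzMap.fourierInv_coe,
      FourierTransform.fourierInv_fourier_eq]
  rw [e]
  refine ⟨hint.comp_div hc, ?_⟩
  rw [Measure.integral_comp_div, hinv, abs_of_pos (by positivity), Complex.real_smul, ← mul_assoc,
    ← Complex.ofReal_mul, one_div_mul_cancel hc, Complex.ofReal_one, one_mul]

/-- For frozen `q`, expand `H(p, (q + y)/2) ψ(y)` in powers of `p`: the coefficients `f0`, `f1`,
`f2` are Schwartz functions of `y`. Under the Fourier integral a power of `p` becomes a power of the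
momentum operator, and inversion evaluates the result at `y = q`. The midpoint then produces the
symmetric ordering `½(p̂q̂ + q̂p̂)`. -/
theorem actsAsWeylQuantization_hamiltonian {ħ : ℝ} (hħ : 0 < ħ) {Q : Matrix (Fin 2) (Fin 2) ℝ}
    (hQ : Q.PosDef) :
    ActsAsWeylQuantization ħ (hamiltonian ħ Q) (fun x => (quadForm Q x : ℂ)) := by
  intro ψ
  refine ⟨schwartzToL2 (quadOp ħ Q ψ), ?_, ?_⟩
  · rw [mem_graph_hamiltonian hħ hQ]
    exact subset_closure ((mem_graph_onSchwartz _ _).2 ⟨ψ, rfl⟩)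
  filter_upwards [coeFn_schwartzToL2 (quadOp ħ Q ψ)] with q hq
  set f0 : 𝓢(ℝ, ℂ) := (Q 0 0 / 2 : ℂ) • ψ with hf0
  set f1 : 𝓢(ℝ, ℂ) := (Q 0 1 / 2 : ℂ) • ((q : ℂ) • ψ + position ψ) with hf1
  set f2 : 𝓢(ℝ, ℂ) := (Q 1 1 / 8 : ℂ) • ((q : ℂ) ^ 2 • ψ + (2 * q : ℂ) • position ψ +
    position (position ψ)) with hf2
  have hf0' : ∀ y, f0 y = Q 0 0 / 2 * ψ y := fun y => rfl
  have hf1' : ∀ y : ℝ, f1 y = Q 0 1 / 2 * ((q + y) * ψ y) := by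
    intro y
    change Q 0 1 / 2 * (q * ψ y + position ψ y) = _
    rw [position_apply]
    ring
  have hf2' : ∀ y : ℝ, f2 y = Q 1 1 / 8 * ((q + y) ^ 2 * ψ y) := by
    intro y
    change Q 1 1 / 8 * ((q : ℂ) ^ 2 * ψ y + 2 * q * position ψ y + position (position ψ) y) = _
    simp only [position_apply]
    ring
  have hsymb : ∀ p y : ℝ, Complex.exp (Complex.I / ħ * ((q - y) * p)) *
      (quadForm Q ![p, (q + y) / 2] : ℂ) * ψ y = Complex.exp (Complex.I / ħ * (q * p)) *
      ((p : ℂ) ^ 2 * (Complex.exp (-(Complex.I / ħ * (y * p))) * f0 y) +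
        p * (Complex.exp (-(Complex.I / ħ * (y * p))) * f1 y) +
        Complex.exp (-(Complex.I / ħ * (y * p))) * f2 y) := by
    intro p y
    have h1 : Complex.exp (Complex.I / ħ * ((q - y) * p)) =
        Complex.exp (Complex.I / ħ * (q * p)) * Complex.exp (-(Complex.I / ħ * (y * p))) := by
      rw [← Complex.exp_add]
      ring_nf
    have h2 : quadForm Q ![p, (q + y) / 2] =
        Q 0 0 / 2 * p ^ 2 + Q 0 1 / 2 * (q + y) * p + Q 1 1 / 8 * (q + y) ^ 2 := by
      simp [quadForm, Matrix.mulVec, dotProduct, Fin.sum_univ_two, posDef_symm hQ]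
      ring
    rw [h1, h2, hf0', hf1', hf2']
    push_cast
    ring
  have hi : ∀ (p : ℝ) (f : 𝓢(ℝ, ℂ)), Integrable fun y : ℝ =>
      Complex.exp (-(Complex.I / ħ * (y * p))) * f y := fun p f => integrable_exp_mul ħ p f
  have hadd : ∀ {u v w : ℝ → ℂ}, Integrable u → Integrable v → Integrable w →
      ∫ y, (u y + v y + w y) = (∫ y, u y) + (∫ y, v y) + ∫ y, w y := fun hu hv hw =>
    (integral_add (hu.add hv) hw).trans (by rw [← integral_add hu hv]; rfl)
  set g := momentum ħ (momentum ħ f0) + momentum ħ f1 + f2 with hg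
  have hinner : ∀ p : ℝ, ∫ y : ℝ, Complex.exp (Complex.I / ħ * ((q - y) * p)) *
      (quadForm Q ![p, (q + y) / 2] : ℂ) * ψ y = Complex.exp (Complex.I / ħ * (q * p)) *
      ∫ y : ℝ, Complex.exp (-(Complex.I / ħ * (y * p))) * g y := by
    intro p
    have h1 : ∀ y : ℝ, Complex.exp (-(Complex.I / ħ * (y * p))) * g y =
        Complex.exp (-(Complex.I / ħ * (y * p))) * momentum ħ (momentum ħ f0) y +
        Complex.exp (-(Complex.I / ħ * (y * p))) * momentum ħ f1 y +
        Complex.exp (-(Complex.I / ħ * (y * p))) * f2 y := by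
      intro y
      rw [hg]
      change _ * (momentum ħ (momentum ħ f0) y + momentum ħ f1 y + f2 y) = _
      ring
    simp only [hsymb, h1]
    rw [integral_const_mul, hadd ((hi _ _).const_mul _) ((hi _ _).const_mul _) (hi _ _),
      integral_const_mul, integral_const_mul, hadd (hi _ _) (hi _ _) (hi _ _),
      integral_exp_momentum hħ.ne', integral_exp_momentum hħ.ne',
      integral_exp_momentum hħ.ne']
    ring
  have hval : quadOp ħ Q ψ q = g q := by
    rw [quadOp_apply, hg, hf0, hf1, hf2, posDef_symm hQ]
    simp only [map_smul, map_add]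
    change 1 / 2 * (Q 0 0 * momentum ħ (momentum ħ ψ) q + Q 0 1 * momentum ħ (position ψ) q +
      Q 0 1 * position (momentum ħ ψ) q + Q 1 1 * position (position ψ) q) =
      Q 0 0 / 2 * momentum ħ (momentum ħ ψ) q +
      Q 0 1 / 2 * (q * momentum ħ ψ q + momentum ħ (position ψ) q) +
      Q 1 1 / 8 * ((q : ℂ) ^ 2 * ψ q + 2 * q * position ψ q + position (position ψ) q)
    simp only [position_apply]
    ring
  have hfin := fourier_inversion_planck hħ g q
  refine ⟨fun p => ?_, ?_, ?_⟩
  · simp only [hsymb]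
    exact ((((hi _ _).const_mul _).add ((hi _ _).const_mul _)).add (hi _ _)).const_mul _
  · simp only [hinner]
    exact hfin.1
  · simp only [hinner]
    rw [hq, hval]
    exact hfin.2

end WeylCalculus
end

noncomputable section
namespace WeylCalculus

/-! ### States are determined by their characteristic functions -/

/-- Positivity at `x - c y`, where the unimodular `c` aligns the phase of `⟪x, ρ y⟫`. The arithmetic
mean on the right can be summed directly into traces. -/
theorem norm_inner_le_of_isPositive {E : Type*} [NormedAddCommGroup E] [InnerProductSpace ℂ E]
    [CompleteSpace E] {ρ : E →L[ℂ] E} (hρ : ρ.IsPositive) (x y : E) :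
    ‖inner ℂ x (ρ y)‖ ≤ ((inner ℂ x (ρ x)).re + (inner ℂ y (ρ y)).re) / 2 := by
  have hpos : ∀ u, 0 ≤ (inner ℂ u (ρ u)).re := fun u => hρ.re_inner_nonneg_right u
  set a := inner ℂ x (ρ y) with ha
  by_cases h0 : a = 0
  · rw [h0, norm_zero]
    linarith [hpos x, hpos y]
  have hn : (‖a‖ : ℂ) ≠ 0 := by simpa using h0
  set c : ℂ := (starRingEnd ℂ) a / ‖a‖ with hc
  have hca : c * a = ‖a‖ := by
    rw [hc, div_mul_eq_mul_div, Complex.conj_mul']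
    field_simp
  have hcc : (starRingEnd ℂ) c * c = 1 := by
    rw [hc, map_div₀, Complex.conj_conj, Complex.conj_ofReal, div_mul_div_comm, Complex.mul_conj']
    field_simp
  have hsymm : inner ℂ y (ρ x) = (starRingEnd ℂ) a := by
    rw [ha, inner_conj_symm]
    exact (hρ.isSymmetric y x).symm
  have h := hpos (x - c • y)
  have e : inner ℂ (x - c • y) (ρ (x - c • y)) =
      inner ℂ x (ρ x) + inner ℂ y (ρ y) - 2 * (‖a‖ : ℝ) := by
    rw [map_sub, map_smul, inner_sub_left, inner_sub_right, inner_sub_right, inner_smul_left,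
      inner_smul_left, inner_smul_right, inner_smul_right, ← ha, hsymm, ← mul_assoc, hcc, hca,
      ← map_mul, hca, Complex.conj_ofReal]
    ring
  rw [e] at h
  simp at h
  linarith

variable {ħ : ℝ} (ξ : Fin 2 → ℝ)

theorem weyl_comp_neg : weyl ħ ξ ∘L weyl ħ (-ξ) = 1 := by
  refine clm_ext_schwartz fun f => ?_
  rw [ContinuousLinearMap.comp_apply, weyl_schwartz, weyl_schwartz]
  have h := weylS_add_smul (ħ := ħ) ξ 1 (-1) f
  rw [one_smul, neg_one_smul, add_neg_cancel, zero_smul, weylS_zero] at h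
  rw [← h]
  rfl

theorem adjoint_weyl : ContinuousLinearMap.adjoint (weyl ħ ξ) = weyl ħ (-ξ) := by
  have h1 := adjoint_weyl_comp (ħ := ħ) ξ
  have h2 := weyl_comp_neg (ħ := ħ) ξ
  calc _ = ContinuousLinearMap.adjoint (weyl ħ ξ) ∘L (weyl ħ ξ ∘L weyl ħ (-ξ)) := by
        rw [h2]
        rfl
    _ = _ := by
        rw [← ContinuousLinearMap.comp_assoc, h1]
        rfl

/-- The Weyl operators as unitary operators. -/
def weylEquiv (ħ : ℝ) (ξ : Fin 2 → ℝ) : L2 ≃ₗᵢ[ℂ] L2 where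
  toFun := weyl ħ ξ
  map_add' := map_add _
  map_smul' := map_smul _
  invFun := weyl ħ (-ξ)
  left_inv x := by
    have h := weyl_comp_neg (ħ := ħ) (-ξ)
    rw [neg_neg] at h
    exact congrArg (fun T : L2 →L[ℂ] L2 => T x) h
  right_inv x := congrArg (fun T : L2 →L[ℂ] L2 => T x) (weyl_comp_neg (ħ := ħ) ξ)
  norm_map' := norm_weyl ξ

/-- Moving the Weyl operator to the left turns `b` into a second orthonormal basis, and `ρ` has
trace one in both. The bound is uniform in `ξ` and `N`, as dominated convergence over phase space
requires. -/
theorem norm_sum_inner_weyl_le {ρ : L2 →L[ℂ] L2} (hρ : IsDensityOperator ρ)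
    (b : HilbertBasis ℕ ℂ L2) (N : ℕ) :
    ‖∑ n ∈ Finset.range N, inner ℂ (b n) (weyl ħ ξ (ρ (b n)))‖ ≤ 1 := by
  have hpos : ∀ u, 0 ≤ (inner ℂ u (ρ u)).re := fun u => hρ.1.re_inner_nonneg_right u
  have hle : ∀ e : HilbertBasis ℕ ℂ L2,
      ∑ n ∈ Finset.range N, (inner ℂ (e n) (ρ (e n))).re ≤ 1 := fun e =>
    sum_le_hasSum _ (fun n _ => hpos _) ((Complex.hasSum_iff _ _).1 (hρ.2.2 ℕ e)).1
  set e : HilbertBasis ℕ ℂ L2 :=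
    HilbertBasis.ofRepr ((weylEquiv ħ (-ξ)).symm.trans b.repr) with he
  have hen : ∀ n, e n = weyl ħ (-ξ) (b n) := by
    intro n
    rw [← HilbertBasis.repr_symm_single, ← HilbertBasis.repr_symm_single]
    rfl
  have h1 := hle b
  have h2 := hle e
  calc _ ≤ ∑ n ∈ Finset.range N, ‖inner ℂ (b n) (weyl ħ ξ (ρ (b n)))‖ := norm_sum_le _ _
    _ ≤ ∑ n ∈ Finset.range N,
        ((inner ℂ (e n) (ρ (e n))).re + (inner ℂ (b n) (ρ (b n))).re) / 2 := by
      refine Finset.sum_le_sum fun n _ => ?_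
      rw [← ContinuousLinearMap.adjoint_inner_left, adjoint_weyl, ← hen]
      exact norm_inner_le_of_isPositive hρ.1 _ _
    _ ≤ 1 := by
      rw [← Finset.sum_div, Finset.sum_add_distrib]
      linarith

/-! ### Gaussian averages of Weyl operators -/

namespace Oscillator

variable (O : Oscillator)

theorem continuous_coh : Continuous fun z => schwartzToL2 (O.coh z) := by
  rw [continuous_iff_continuousAt]
  intro w
  rw [ContinuousAt, tendsto_iff_norm_sub_tendsto_zero]
  have h1 : ∀ z, ‖schwartzToL2 (O.coh z) - schwartzToL2 (O.coh w)‖ =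
      Real.sqrt (Real.exp (‖z‖ ^ 2) - 2 * (Complex.exp ((starRingEnd ℂ) z * w)).re +
        Real.exp (‖w‖ ^ 2)) := by
    intro z
    rw [← Real.sqrt_sq (norm_nonneg _), @norm_sub_sq ℂ, norm_coh_sq, norm_coh_sq, inner_coh]
    rfl
  simp only [h1]
  have h2 : Continuous fun z : ℂ => Real.sqrt (Real.exp (‖z‖ ^ 2) -
      2 * (Complex.exp ((starRingEnd ℂ) z * w)).re + Real.exp (‖w‖ ^ 2)) := by
    fun_prop
  have h3 := h2.tendsto w
  have h4 : Real.exp (‖w‖ ^ 2) - 2 * (Complex.exp ((starRingEnd ℂ) w * w)).re +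
      Real.exp (‖w‖ ^ 2) = 0 := by
    have h5 : Complex.exp ((starRingEnd ℂ) w * w) = (Real.exp (‖w‖ ^ 2) : ℂ) := by
      rw [Complex.conj_mul']
      push_cast
      rfl
    rw [h5, Complex.ofReal_re]
    ring
  rwa [h4, Real.sqrt_zero] at h3

theorem weyl_coh (z : ℂ) : weyl O.ħ ξ (schwartzToL2 (O.coh z)) =
    Complex.exp (-(starRingEnd ℂ) (O.disp ξ) * z -
      (starRingEnd ℂ) (O.disp ξ) * O.disp ξ / 2) • schwartzToL2 (O.coh (z + O.disp ξ)) := by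
  rw [weyl_schwartz, weylS_coh, map_smul]

theorem continuous_weyl (y : L2) : Continuous fun ξ => weyl O.ħ ξ y := by
  rw [continuous_iff_continuousAt]
  intro ξ
  refine tendsto_clm_of_total (C := 1) (Eventually.of_forall fun η => ?_) O.total_coh ?_ y
  · exact ContinuousLinearMap.opNorm_le_bound _ zero_le_one fun x => by rw [norm_weyl, one_mul]
  · rintro _ ⟨z, rfl⟩
    simp only [weyl_coh]
    have h1 : Continuous fun η => O.disp η := by
      unfold disp
      fun_prop
    have h2 := O.continuous_coh.comp ((continuous_const (y := z)).add h1)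
    have h3 : Continuous fun η => Complex.exp (-(starRingEnd ℂ) (O.disp η) * z -
      (starRingEnd ℂ) (O.disp η) * O.disp η / 2) := by fun_prop
    exact (h3.smul h2).tendsto ξ

/-- The phase space point with displacement `v 0 + i v 1`. -/
def undisp (v : Fin 2 → ℝ) : Fin 2 → ℝ :=
  ![-(O.s * v 0 / O.ν.re), O.s * v 1 - O.ν.im * (O.s * v 0 / O.ν.re)]

theorem disp_undisp (v : Fin 2 → ℝ) : O.disp (O.undisp v) = v 0 + v 1 * Complex.I := by
  have hs := O.s_ne
  have hν := O.νre_ne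
  have hνd : O.ν = O.ν.re + O.ν.im * Complex.I := (Complex.re_add_im O.ν).symm
  have h0 : O.undisp v 0 = -(O.s * v 0 / O.ν.re) := rfl
  have h1 : O.undisp v 1 = O.s * v 1 - O.ν.im * (O.s * v 0 / O.ν.re) := rfl
  rw [disp, h0, h1, div_eq_iff hs]
  push_cast
  linear_combination (O.s * v 0 / O.ν.re : ℂ) * hνd +
    (O.s * v 0 : ℂ) * (div_self hν)

theorem continuous_undisp : Continuous O.undisp := by
  unfold undisp
  refine continuous_pi fun i => ?_
  fin_cases i <;> simp <;> fun_prop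

/-- The weight with which the Weyl operators are averaged to a rank one operator. -/
def weight (w z : ℂ) (v : Fin 2 → ℝ) : ℂ :=
  Complex.exp ((starRingEnd ℂ) w * z) * Complex.exp (-(1 / 2 : ℂ) * ∑ i, (v i : ℂ) ^ 2 +
    ∑ i, (![z - (starRingEnd ℂ) w, -Complex.I * (z + (starRingEnd ℂ) w)] i) * v i)

theorem integrable_weight (w z : ℂ) : Integrable (weight w z) :=
  (GaussianFourier.integrable_cexp_neg_mul_sum_add (by norm_num) _).const_mul _

theorem integrable_weight_smul (w z : ℂ) (y : L2) :
    Integrable fun v => weight w z v • weyl O.ħ (O.undisp v) y := by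
  refine (integrable_weight w z).smul_bdd (C := ‖y‖) ?_ ?_
  · exact ((O.continuous_weyl y).comp O.continuous_undisp).aestronglyMeasurable
  · exact Eventually.of_forall fun v => (norm_weyl _ y).le

/-- The weight is chosen so that these matrix elements factor like those of `π |z⟩⟨w|`. It and the
Weyl operator each contribute `e^{-|v|²/2}`, and the remaining linear exponents are arranged to give
the product after integration. -/
theorem integral_weight_coh (w z u a : ℂ) :
    ∫ v, weight w z v * inner ℂ (schwartzToL2 (O.coh u))
      (weyl O.ħ (O.undisp v) (schwartzToL2 (O.coh a))) =
    Real.pi * (Complex.exp ((starRingEnd ℂ) u * z) * Complex.exp ((starRingEnd ℂ) w * a)) := by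
  have h1 : ∀ v : Fin 2 → ℝ, weight w z v * inner ℂ (schwartzToL2 (O.coh u))
      (weyl O.ħ (O.undisp v) (schwartzToL2 (O.coh a))) =
      Complex.exp ((starRingEnd ℂ) w * z + (starRingEnd ℂ) u * a) *
        Complex.exp (-(1 : ℂ) * ∑ i, (v i : ℂ) ^ 2 +
        ∑ i, (![z - (starRingEnd ℂ) w - a + (starRingEnd ℂ) u,
          Complex.I * (-z - (starRingEnd ℂ) w + a + (starRingEnd ℂ) u)] i) * v i) := by
    intro v
    rw [weyl_coh, inner_smul_right, inner_coh, disp_undisp, weight, ← Complex.exp_add,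
      ← Complex.exp_add, ← Complex.exp_add, ← Complex.exp_add]
    congr 1
    simp only [Fin.sum_univ_two, Matrix.cons_val_zero, Matrix.cons_val_one, map_add, map_mul,
      Complex.conj_ofReal, Complex.conj_I]
    linear_combination ((v 1 : ℂ) ^ 2 / 2) * Complex.I_sq
  simp only [h1]
  rw [integral_const_mul, GaussianFourier.integral_cexp_neg_mul_sum_add (by norm_num)]
  simp only [Fin.sum_univ_two, Matrix.cons_val_zero, Matrix.cons_val_one, Fintype.card_fin,
    Nat.cast_ofNat, div_one]
  rw [div_self two_ne_zero, Complex.cpow_one, mul_left_comm, ← Complex.exp_add, ← Complex.exp_add]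
  congr 2
  linear_combination ((-z - (starRingEnd ℂ) w + a + (starRingEnd ℂ) u) ^ 2 / 4) * Complex.I_sq

theorem integral_weight_smul (w z : ℂ) (y : L2) :
    ∫ v, weight w z v • weyl O.ħ (O.undisp v) y =
      ((Real.pi : ℂ) * inner ℂ (schwartzToL2 (O.coh w)) y) • schwartzToL2 (O.coh z) := by
  let I : L2 →ₗ[ℂ] L2 :=
    { toFun := fun y => ∫ v, weight w z v • weyl O.ħ (O.undisp v) y
      map_add' := fun x y => by
        simp only [map_add, smul_add]
        exact integral_add (O.integrable_weight_smul w z x) (O.integrable_weight_smul w z y)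
      map_smul' := fun c y => by
        simp only [map_smul, RingHom.id_apply, smul_comm _ c]
        exact integral_smul c _ }
  have hI : ∀ y, ‖I y‖ ≤ (∫ v, ‖weight w z v‖) * ‖y‖ := by
    intro y
    refine (norm_integral_le_integral_norm _).trans_eq ?_
    simp only [norm_smul, norm_weyl]
    exact integral_mul_const _ _
  have h := clm_ext_of_total (T := I.mkContinuous _ hI)
    (T' := (Real.pi : ℂ) • (innerSL ℂ (schwartzToL2 (O.coh w))).smulRight
      (schwartzToL2 (O.coh z))) O.total_coh ?_
  · have h1 := congrArg (fun T : L2 →L[ℂ] L2 => T y) h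
    exact h1.trans (smul_smul (Real.pi : ℂ) (inner ℂ (schwartzToL2 (O.coh w)) y)
      (schwartzToL2 (O.coh z)))
  · rintro _ ⟨a, rfl⟩
    rw [← sub_eq_zero]
    refine O.eq_zero_of_inner_coh _ fun u => ?_
    rw [inner_sub_right, sub_eq_zero]
    change inner ℂ (schwartzToL2 (O.coh u))
        (∫ v, weight w z v • weyl O.ħ (O.undisp v) (schwartzToL2 (O.coh a))) =
      inner ℂ (schwartzToL2 (O.coh u)) ((Real.pi : ℂ) •
        (inner ℂ (schwartzToL2 (O.coh w)) (schwartzToL2 (O.coh a)) • schwartzToL2 (O.coh z)))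
    rw [← integral_inner (O.integrable_weight_smul w z _)]
    simp only [inner_smul_right]
    rw [integral_weight_coh, inner_coh, inner_coh]
    ring

/-- The matrix elements of a state in coherent states, in terms of its characteristic function. -/
theorem integral_weight_charFun {ρ : L2 →L[ℂ] L2} (hρ : IsDensityOperator ρ)
    {χ : (Fin 2 → ℝ) → ℂ} (hχ : ∀ ξ, HasTrace (weyl O.ħ ξ ∘L ρ) (χ ξ)) (w z : ℂ) :
    ∫ v, weight w z v * χ (O.undisp v) =
      Real.pi * inner ℂ (schwartzToL2 (O.coh w)) (ρ (schwartzToL2 (O.coh z))) := by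
  set b := O.basis
  -- For finite partial sums of the trace the average may be taken termwise, where it is a rank one
  -- operator; letting `N → ∞`, dominated convergence handles the left side and Parseval the right.
  have hsum : ∀ N : ℕ, ∫ v, weight w z v *
      ∑ n ∈ Finset.range N, inner ℂ (b n) (weyl O.ħ (O.undisp v) (ρ (b n))) =
      Real.pi * ∑ n ∈ Finset.range N, inner ℂ (ρ (schwartzToL2 (O.coh w))) (b n) *
        inner ℂ (b n) (schwartzToL2 (O.coh z)) := by
    intro N
    simp only [Finset.mul_sum, ← inner_smul_right]
    rw [integral_finsetSum _ fun n _ => (O.integrable_weight_smul w z _).const_inner (b n)]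
    refine Finset.sum_congr rfl fun n _ => ?_
    rw [integral_inner (O.integrable_weight_smul w z _), integral_weight_smul, inner_smul_right,
      show inner ℂ (ρ (schwartzToL2 (O.coh w))) (b n) = inner ℂ (schwartzToL2 (O.coh w)) (ρ (b n))
        from hρ.1.isSymmetric _ _]
    simp only [inner_smul_right]
    ring
  have hlim1 : Tendsto (fun N : ℕ => ∫ v, weight w z v *
      ∑ n ∈ Finset.range N, inner ℂ (b n) (weyl O.ħ (O.undisp v) (ρ (b n)))) atTop
      (𝓝 (∫ v, weight w z v * χ (O.undisp v))) := by
    refine tendsto_integral_of_dominated_convergence (fun v => ‖weight w z v‖) (fun N => ?_)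
      (integrable_weight w z).norm (fun N => Eventually.of_forall fun v => ?_)
      (Eventually.of_forall fun v => ?_)
    · refine (integrable_weight w z).aestronglyMeasurable.mul
        (Continuous.aestronglyMeasurable ?_)
      refine continuous_finsetSum _ fun n _ => ?_
      exact (continuous_const.inner ((O.continuous_weyl (ρ (b n))).comp O.continuous_undisp))
    · rw [norm_mul]
      exact mul_le_of_le_one_right (norm_nonneg _) (norm_sum_inner_weyl_le _ hρ b N)
    · exact (((hχ (O.undisp v)).2 ℕ b).tendsto_sum_nat).const_mul _
  have hlim2 := ((b.hasSum_inner_mul_inner (ρ (schwartzToL2 (O.coh w)))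
    (schwartzToL2 (O.coh z))).tendsto_sum_nat).const_mul (Real.pi : ℂ)
  simp only [hsum] at hlim1
  rw [tendsto_nhds_unique hlim1 hlim2]
  congr 1
  exact hρ.1.isSymmetric _ _

end Oscillator

/-- A state is determined by its characteristic function. -/
theorem IsDensityOperator.ext (hħ : 0 < ħ) {ρ ρ' : L2 →L[ℂ] L2} {χ : (Fin 2 → ℝ) → ℂ}
    (hρ : IsDensityOperator ρ) (hρ' : IsDensityOperator ρ') (hχ : HasCharFun ħ ρ χ)
    (hχ' : HasCharFun ħ ρ' χ) : ρ = ρ' := by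
  -- Any family of coherent states serves here, since totality is all that is needed; the width `1`
  -- is unrelated to the states being compared.
  set O : Oscillator := ⟨ħ, 1, hħ, by simp⟩ with hO
  have key : ∀ {σ : L2 →L[ℂ] L2}, HasCharFun ħ σ χ → ∀ ξ, HasTrace (weyl O.ħ ξ ∘L σ) (χ ξ) := by
    intro σ hσ ξ
    obtain ⟨V, hV, htr⟩ := hσ ξ
    rwa [(isExp_linearObservable_iff ξ hħ.ne' V).1 hV] at htr
  refine clm_ext_of_total O.total_coh ?_
  rintro _ ⟨z, rfl⟩
  rw [← sub_eq_zero]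
  refine O.eq_zero_of_inner_coh _ fun w => ?_
  rw [inner_sub_right, sub_eq_zero]
  have h1 := O.integral_weight_charFun hρ (key hχ) w z
  have h2 := O.integral_weight_charFun hρ' (key hχ') w z
  exact mul_left_cancel₀ (by exact_mod_cast Real.pi_ne_zero) (h1.symm.trans h2)

end WeylCalculus
end

noncomputable section
namespace WeylCalculus

/-! ### Hyperbolic functions -/

theorem tanh_pos {t : ℝ} (ht : 0 < t) : 0 < Real.tanh t := by
  rw [Real.tanh_eq_sinh_div_cosh]
  exact div_pos (Real.sinh_pos_iff.2 ht) (Real.cosh_pos t)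

/-- Links the ratio of consecutive Gibbs eigenvalues to the parameter `T = tanh t` of the Mehler
symbol. -/
theorem exp_neg_two_mul_eq (t : ℝ) :
    Real.exp (-2 * t) = (1 - Real.tanh t) / (1 + Real.tanh t) := by
  have hc := (Real.cosh_pos t).ne'
  have he := (Real.exp_pos t).ne'
  have h1 : 1 - Real.tanh t = Real.exp (-t) / Real.cosh t := by
    rw [Real.tanh_eq_sinh_div_cosh, ← Real.cosh_sub_sinh]
    field_simp
  have h2 : 1 + Real.tanh t = Real.exp t / Real.cosh t := by
    rw [Real.tanh_eq_sinh_div_cosh, ← Real.cosh_add_sinh]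
    field_simp
  rw [h1, h2, div_div_div_cancel_right₀ hc, ← Real.exp_sub]
  ring_nf

theorem inv_cosh_div_one_add_tanh (t : ℝ) :
    1 / Real.cosh t / (1 + Real.tanh t) = Real.exp (-t) := by
  have hc := (Real.cosh_pos t).ne'
  have he := (Real.exp_pos t).ne'
  have h2 : 1 + Real.tanh t = Real.exp t / Real.cosh t := by
    rw [Real.tanh_eq_sinh_div_cosh, ← Real.cosh_add_sinh]
    field_simp
  rw [h2, Real.exp_neg]
  field_simp

theorem exp_neg_div_one_sub (t : ℝ) :
    Real.exp (-t) / (1 - Real.exp (-2 * t)) = 1 / (2 * Real.sinh t) := by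
  have h1 : 1 - Real.exp (-2 * t) = Real.exp (-t) * (2 * Real.sinh t) := by
    rw [Real.sinh_eq, show -2 * t = -t + -t by ring, Real.exp_add, Real.exp_neg]
    have he := (Real.exp_pos t).ne'
    field_simp
  rw [h1]
  have he := (Real.exp_pos (-t)).ne'
  rw [← div_div, div_self he]

theorem one_add_exp_div_one_sub_exp {t : ℝ} (ht : 0 < t) :
    (1 + Real.exp (-2 * t)) / (1 - Real.exp (-2 * t)) = 1 / Real.tanh t := by
  have hT : 0 < Real.tanh t := tanh_pos ht
  have h1 : 1 + Real.tanh t ≠ 0 := by positivity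
  rw [exp_neg_two_mul_eq]
  have h2 : 1 + (1 - Real.tanh t) / (1 + Real.tanh t) = 2 / (1 + Real.tanh t) := by
    field_simp
    ring
  have h3 : 1 - (1 - Real.tanh t) / (1 + Real.tanh t) = 2 * Real.tanh t / (1 + Real.tanh t) := by
    field_simp
    ring
  rw [h2, h3]
  field_simp

theorem arcoth_pos {z : ℝ} (hz : 1 < z) : 0 < arcoth z := by
  have h1 : 1 < (z + 1) / (z - 1) := by
    rw [one_lt_div (by linarith)]
    linarith
  have := Real.log_pos h1
  rw [arcoth]
  positivity

theorem tanh_arcoth {z : ℝ} (hz : 1 < z) : Real.tanh (arcoth z) = 1 / z := by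
  have h1 : 0 < (z + 1) / (z - 1) := div_pos (by linarith) (by linarith)
  have h2 := exp_neg_two_mul_eq (arcoth z)
  have h3 : -2 * arcoth z = -Real.log ((z + 1) / (z - 1)) := by rw [arcoth]; ring
  have h4 : 0 < Real.tanh (arcoth z) := tanh_pos (arcoth_pos hz)
  rw [h3, Real.exp_neg, Real.exp_log h1, inv_div] at h2
  have h5 : z + 1 ≠ 0 := by linarith
  have h6 : 1 + Real.tanh (arcoth z) ≠ 0 := by positivity
  rw [div_eq_div_iff h5 h6] at h2
  rw [eq_div_iff (by linarith)]
  linarith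

theorem arcoth_one_div_tanh {t : ℝ} (ht : 0 < t) : arcoth (1 / Real.tanh t) = t := by
  have hT : 0 < Real.tanh t := tanh_pos ht
  have hT1 : Real.tanh t < 1 := Real.tanh_lt_one t
  have h2 := exp_neg_two_mul_eq t
  have h3 : (1 / Real.tanh t + 1) / (1 / Real.tanh t - 1) = Real.exp (2 * t) := by
    have h4 : 1 - Real.tanh t ≠ 0 := by linarith
    have h5 : 1 + Real.tanh t ≠ 0 := by positivity
    rw [show 2 * t = -(-2 * t) by ring, Real.exp_neg, h2]
    field_simp
  rw [arcoth, h3, Real.log_exp]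
  ring

theorem one_div_two_sinh_arcoth {z : ℝ} (hz : 1 < z) :
    1 / (2 * Real.sinh (arcoth z)) = 1 / 2 * Real.sqrt (z ^ 2 - 1) := by
  have hs : 0 < Real.sinh (arcoth z) := Real.sinh_pos_iff.2 (arcoth_pos hz)
  have hc := Real.cosh_pos (arcoth z)
  have h1 := tanh_arcoth hz
  rw [Real.tanh_eq_sinh_div_cosh, div_eq_div_iff hc.ne' (by linarith), one_mul] at h1
  have h2 := Real.cosh_sq (arcoth z)
  have h3 : z ^ 2 - 1 = (1 / Real.sinh (arcoth z)) ^ 2 := by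
    rw [← h1] at h2
    field_simp
    linarith
  rw [h3, Real.sqrt_sq (by positivity)]
  field_simp

/-! ### Thermal states -/

theorem weyl_zero (ħ : ℝ) : weyl ħ 0 = 1 := by
  refine clm_ext_schwartz fun f => ?_
  rw [weyl_schwartz, weylS_zero]
  rfl

namespace Oscillator

variable (O : Oscillator)

/-- The trace is the Laguerre generating function at `r`; with `x = |α|²` the exponents combine as
`x/2 + xr/(1 - r) = (x/2)(1 + r)/(1 - r)`. -/
theorem hasTrace_weyl_comp {C r : ℝ} (hC : 0 ≤ C) (hr0 : 0 ≤ r) (hr1 : r < 1) {A : L2 →L[ℂ] L2}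
    (hA : ∀ n, A (O.basis n) = ((C * r ^ n : ℝ) : ℂ) • O.basis n) (ξ : Fin 2 → ℝ) :
    HasTrace (weyl O.ħ ξ ∘L A) ((C / (1 - r) *
      Real.exp (-(‖O.disp ξ‖ ^ 2 / 2) * ((1 + r) / (1 - r))) : ℝ) : ℂ) := by
  have hsum : Summable fun n : ℕ => C * r ^ n :=
    (summable_geometric_of_lt_one hr0 hr1).mul_left C
  have h := hasTrace_comp O.basis hsum (fun n => by positivity) hA (adjoint_weyl_comp (ħ := O.ħ) ξ)
  set x : ℝ := ‖O.disp ξ‖ ^ 2 with hx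
  have h1 := ((hasSum_pow_mul_sum_choose hr0 hr1 (-(x : ℂ))).mul_left
    ((C : ℂ) * Complex.exp (-(x : ℂ) / 2))).tsum_eq
  have h2 : ∀ n : ℕ, ((C * r ^ n : ℝ) : ℂ) * inner ℂ (O.basis n) (weyl O.ħ ξ (O.basis n)) =
      (C : ℂ) * Complex.exp (-(x : ℂ) / 2) * ((r : ℂ) ^ n *
      ∑ k ∈ Finset.range (n + 1), (n.choose k : ℂ) * ((-(x : ℂ)) ^ k / k.factorial)) := by
    intro n
    rw [inner_basis_weyl, ← hx, Complex.ofReal_mul, Complex.ofReal_pow]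
    ring
  simp only [h2] at h
  rw [h1] at h
  convert! h using 1
  have h3 : (1 - r : ℂ) ≠ 0 := by
    have : (1 - r : ℝ) ≠ 0 := by linarith
    exact_mod_cast this
  push_cast
  rw [mul_mul_mul_comm, ← Complex.exp_add, ← div_eq_mul_inv]
  congr 2
  field_simp
  ring

theorem hasTrace_diagonal {C r : ℝ} (hC : 0 ≤ C) (hr0 : 0 ≤ r) (hr1 : r < 1) {A : L2 →L[ℂ] L2}
    (hA : ∀ n, A (O.basis n) = ((C * r ^ n : ℝ) : ℂ) • O.basis n) :
    HasTrace A ((C / (1 - r) : ℝ) : ℂ) := by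
  have h := O.hasTrace_weyl_comp hC hr0 hr1 hA 0
  have h0 : O.disp 0 = 0 := by simp [disp]
  rw [weyl_zero, h0] at h
  simpa [show (1 : L2 →L[ℂ] L2) ∘L A = A from A.id_comp] using h

end Oscillator

section Thermal

variable {ħ : ℝ} {Q : Matrix (Fin 2) (Fin 2) ℝ}

theorem mehlerSymbol_oscillatorOf (hħ : 0 < ħ) (hQ : Q.PosDef) (C T : ℝ) (x : Fin 2 → ℝ) :
    (oscillatorOf hħ hQ).mehlerSymbol C T x =
      C * Real.exp (-(2 * T / (Real.sqrt Q.det * ħ)) * quadForm Q x) := by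
  have h00 := (posDef_diag hQ 0).ne'
  have hω := (posDef_sqrt_det_pos hQ).ne'
  have hsq := posDef_sq_det hQ
  change C * Real.exp (-(T / (ħ * (Real.sqrt Q.det / Q 0 0))) *
    ((x 0 + Q 0 1 / Q 0 0 * x 1) ^ 2 + (Real.sqrt Q.det / Q 0 0) ^ 2 * x 1 ^ 2)) = _
  congr 2
  rw [div_pow, hsq]
  simp only [quadForm, Matrix.mulVec, dotProduct, Fin.sum_univ_two, posDef_symm hQ]
  field_simp
  ring

theorem dotProduct_inv_mulVec (hQ : Q.PosDef) (ξ : Fin 2 → ℝ) :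
    ξ ⬝ᵥ Q⁻¹ *ᵥ ξ =
      (Q 1 1 * ξ 0 ^ 2 - 2 * Q 0 1 * ξ 0 * ξ 1 + Q 0 0 * ξ 1 ^ 2) / Real.sqrt Q.det ^ 2 := by
  rw [Real.sq_sqrt hQ.det_pos.le, Matrix.inv_def, Matrix.adjugate_fin_two, Ring.inverse_eq_inv',
    Matrix.smul_mulVec, dotProduct_smul, smul_eq_mul, div_eq_inv_mul]
  congr 1
  simp [Matrix.mulVec, dotProduct, Fin.sum_univ_two, posDef_symm hQ]
  ring

/-- This is where `Q⁻¹` enters: in terms of the displacement the characteristic function is rotation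
invariant, and the choice of `ν` turns that into the covariance form. -/
theorem norm_disp_sq (hħ : 0 < ħ) (hQ : Q.PosDef) (ξ : Fin 2 → ℝ) :
    ‖(oscillatorOf hħ hQ).disp ξ‖ ^ 2 = Real.sqrt Q.det / (2 * ħ) * (ξ ⬝ᵥ Q⁻¹ *ᵥ ξ) := by
  have h00 := (posDef_diag hQ 0).ne'
  have hω := (posDef_sqrt_det_pos hQ).ne'
  have hsq := posDef_sq_det hQ
  rw [dotProduct_inv_mulVec hQ, Oscillator.disp, norm_div, div_pow, Complex.norm_real,
    Real.norm_eq_abs, sq_abs, (oscillatorOf hħ hQ).s_sq]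
  have h1 : ‖Complex.I * (ξ 1 : ℂ) - (oscillatorOf hħ hQ).ν * ξ 0‖ ^ 2 =
      (Real.sqrt Q.det / Q 0 0 * ξ 0) ^ 2 + (ξ 1 - Q 0 1 / Q 0 0 * ξ 0) ^ 2 := by
    rw [← Complex.normSq_eq_norm_sq, Complex.normSq_apply]
    simp [oscillatorOf]
    ring
  rw [h1]
  change _ / (2 * ħ * (Real.sqrt Q.det / Q 0 0)) = _
  have h2 : (Real.sqrt Q.det / Q 0 0 * ξ 0) ^ 2 + (ξ 1 - Q 0 1 / Q 0 0 * ξ 0) ^ 2 =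
      (Q 1 1 * ξ 0 ^ 2 - 2 * Q 0 1 * ξ 0 * ξ 1 + Q 0 0 * ξ 1 ^ 2) / Q 0 0 := by
    rw [mul_pow, div_pow, hsq]
    field_simp
    ring
  rw [h2]
  field_simp

theorem exp_energy (β : ℝ) (n : ℕ) : Real.exp (-β * energy ħ Q n) =
    Real.exp (-(Real.sqrt Q.det * ħ * β / 2)) *
      Real.exp (-2 * (Real.sqrt Q.det * ħ * β / 2)) ^ n := by
  rw [← Real.exp_nat_mul, ← Real.exp_add, energy]
  congr 1
  ring

theorem energy_nonneg (hħ : 0 < ħ) (n : ℕ) : 0 ≤ energy ħ Q n := by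
  rw [energy]
  positivity

/-- The properties of the Gibbs operator `e^{-βĤ}` and of the thermal state. -/
theorem exists_gibbs (hħ : 0 < ħ) (hQ : Q.PosDef) {β Z : ℝ} (hβ : 0 < β)
    (hZ : Z = 1 / (2 * Real.sinh (Real.sqrt Q.det * ħ * β / 2))) :
    ∃ A : L2 →L[ℂ] L2,
      (∀ n, A ((oscillatorOf hħ hQ).basis n) =
        (Real.exp (-β * energy ħ Q n) : ℂ) • (oscillatorOf hħ hQ).basis n) ∧
      (∀ A' : L2 →L[ℂ] L2, IsExp ((-(β : ℂ)) • hamiltonian ħ Q) A' ↔ A' = A) ∧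
      HasWeylSymbol ħ A (fun x => ((1 / Real.cosh (Real.sqrt Q.det * ħ * β / 2) *
        Real.exp (-(2 * Real.tanh (Real.sqrt Q.det * ħ * β / 2) / (Real.sqrt Q.det * ħ)) *
          quadForm Q x) : ℝ) : ℂ)) ∧
      HasTrace A (Z : ℂ) ∧
      IsDensityOperator ((Z : ℂ)⁻¹ • A) ∧
      HasCharFun ħ (((Z : ℂ)⁻¹) • A) (fun ξ =>
        ((Real.exp (-(1 / (4 * ħ)) * (Real.sqrt Q.det / Real.tanh (Real.sqrt Q.det * ħ * β / 2) *
          (ξ ⬝ᵥ Q⁻¹ *ᵥ ξ))) : ℝ) : ℂ)) := by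
  set O := oscillatorOf hħ hQ with hO
  set ω := Real.sqrt Q.det with hω
  have hω0 : 0 < ω := posDef_sqrt_det_pos hQ
  set τ := ω * ħ * β / 2 with hτ
  have hτ0 : 0 < τ := by positivity
  have hZ0 : 0 < Z := by
    have := Real.sinh_pos_iff.2 hτ0
    rw [hZ]
    positivity
  set r := Real.exp (-2 * τ) with hr
  have hr0 : 0 ≤ r := (Real.exp_pos _).le
  have hr1 : r < 1 := (Real.exp_lt_exp.2 (by linarith)).trans_eq Real.exp_zero
  have hdiag := (isDiagonal_hamiltonian hħ hQ).smul (c := -β) (by linarith)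
  have hbd : ∀ n, -β * energy ħ Q n ≤ 0 := fun n => by
    have := mul_nonneg hβ.le (energy_nonneg (Q := Q) hħ n)
    linarith
  obtain ⟨A, hAexp⟩ : ∃ A : L2 →L[ℂ] L2, ∀ A' : L2 →L[ℂ] L2,
      IsExp (((-β : ℝ) : ℂ) • hamiltonian ħ Q) A' ↔ A' = A := ⟨_, hdiag.isExp_iff hbd⟩
  have hA : ∀ n, A (O.basis n) = (Real.exp (-β * energy ħ Q n) : ℂ) • O.basis n := by
    intro n
    rw [(hdiag.isExp_iff_apply hbd A).1 ((hAexp A).2 rfl) n]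
    norm_cast
  have hA' : ∀ n, A (O.basis n) = ((Real.exp (-τ) * r ^ n : ℝ) : ℂ) • O.basis n := by
    intro n
    rw [hA, exp_energy]
  have hAZ : ∀ n, ((Z : ℂ)⁻¹ • A) (O.basis n) =
      ((Z⁻¹ * Real.exp (-τ) * r ^ n : ℝ) : ℂ) • O.basis n := by
    intro n
    rw [smul_apply, hA', smul_smul]
    push_cast
    ring_nf
  have htr : Real.exp (-τ) / (1 - r) = Z := by
    rw [hZ, hr]
    exact exp_neg_div_one_sub τ
  have htrZ : Z⁻¹ * Real.exp (-τ) / (1 - r) = 1 := by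
    rw [mul_div_assoc, htr, inv_mul_cancel₀ hZ0.ne']
  have hC : 0 ≤ Z⁻¹ * Real.exp (-τ) := by positivity
  refine ⟨A, hA, ?_, ?_, ?_, ⟨?_, ?_⟩, fun ξ => ⟨weyl ħ ξ, ?_, ?_⟩⟩
  · intro A'
    rw [← hAexp A', Complex.ofReal_neg]
  -- With `T = tanh τ` the ratio `(1 - T)/(1 + T)` is `r`, and the prefactor `1/cosh τ` makes the
  -- lowest eigenvalue `e^{-τ}`.
  · have h := O.hasWeylSymbol_mehler (1 / Real.cosh τ) (tanh_pos hτ0) (A := A) fun n => by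
      rw [hA', hr, exp_neg_two_mul_eq, inv_cosh_div_one_add_tanh]
    simp only [hO, mehlerSymbol_oscillatorOf] at h
    exact h
  · have h := O.hasTrace_diagonal (Real.exp_pos _).le hr0 hr1 hA'
    rwa [htr] at h
  · exact isPositive_of_diagonal O.basis (c := fun n => Z⁻¹ * Real.exp (-τ) * r ^ n)
      (fun n => by positivity) hAZ
  · have h := O.hasTrace_diagonal hC hr0 hr1 hAZ
    rwa [htrZ, Complex.ofReal_one] at h
  · exact (isExp_linearObservable_iff ξ hħ.ne' _).2 rfl
  · have h := O.hasTrace_weyl_comp hC hr0 hr1 hAZ ξ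
    rw [htrZ, one_mul, hr, one_add_exp_div_one_sub_exp hτ0, norm_disp_sq, ← hω] at h
    have e : -(1 / (4 * ħ)) * (ω / Real.tanh τ * (ξ ⬝ᵥ Q⁻¹ *ᵥ ξ)) =
        -(ω / (2 * ħ) * (ξ ⬝ᵥ Q⁻¹ *ᵥ ξ) / 2) * (1 / Real.tanh τ) := by
      field_simp
      ring
    beta_reduce
    rw [e]
    exact h

end Thermal

/-! ### Covariance matrices -/

/-- The imaginary part `Ω` has zero diagonal, so semidefiniteness yields nonnegative diagonal
entries of `G`, and hermiticity its symmetry. With positive determinant, completing the square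
finishes. -/
theorem UncertaintyRelation.posDef {G : Matrix (Fin 2) (Fin 2) ℝ} (h : UncertaintyRelation G)
    (hdet : 0 < G.det) : G.PosDef := by
  have hsymm : G 1 0 = G 0 1 := by
    have h1 := congrArg Complex.re (h.isHermitian.apply 0 1)
    simpa [Ω] using h1
  have h00 : 0 ≤ G 0 0 := by
    have h1 := (Complex.le_def.1 (h.diag_nonneg (i := 0))).1
    simpa [Ω] using h1
  rw [Matrix.det_fin_two, hsymm] at hdet
  have h00' : 0 < G 0 0 := by
    refine lt_of_le_of_ne h00 fun e => ?_
    rw [← e] at hdet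
    nlinarith [sq_nonneg (G 0 1)]
  refine Matrix.PosDef.of_dotProduct_mulVec_pos ?_ fun x hx => ?_
  · ext i j
    fin_cases i <;> fin_cases j <;> simp [hsymm]
  · have e : G 0 0 * (star x ⬝ᵥ G *ᵥ x) =
        (G 0 0 * x 0 + G 0 1 * x 1) ^ 2 + (G 0 0 * G 1 1 - G 0 1 * G 0 1) * x 1 ^ 2 := by
      simp [Matrix.mulVec, dotProduct, Fin.sum_univ_two, hsymm]
      ring
    refine pos_of_mul_pos_right (b := _) ?_ h00'.le
    rw [e]
    by_cases h1 : x 1 = 0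
    · have h0 : x 0 ≠ 0 := by
        intro h0
        apply hx
        ext i
        fin_cases i <;> assumption
      have : G 0 0 * x 0 ≠ 0 := mul_ne_zero h00'.ne' h0
      rw [h1, mul_zero, add_zero, zero_pow two_ne_zero, mul_zero, add_zero]
      positivity
    · have : 0 < x 1 ^ 2 := by positivity
      have := mul_pos hdet this
      nlinarith [sq_nonneg (G 0 0 * x 0 + G 0 1 * x 1)]

theorem inv_smul_inv {k : ℝ} (hk : k ≠ 0) {G : Matrix (Fin 2) (Fin 2) ℝ} (hG : 0 < G.det) :
    (k • G⁻¹)⁻¹ = k⁻¹ • G := by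
  have hu : IsUnit G.det := hG.ne'.isUnit
  refine Matrix.inv_eq_right_inv ?_
  rw [smul_mul_smul_comm, mul_inv_cancel₀ hk, Matrix.nonsing_inv_mul _ hu, one_smul]

theorem sqrt_det_smul_inv {k : ℝ} (hk : 0 < k) (G : Matrix (Fin 2) (Fin 2) ℝ) :
    Real.sqrt (k • G⁻¹).det = k / Real.sqrt G.det := by
  rw [Matrix.det_smul, Matrix.det_nonsing_inv, Ring.inverse_eq_inv', Fintype.card_fin,
    Real.sqrt_mul (by positivity), Real.sqrt_sq hk.le, Real.sqrt_inv, div_eq_mul_inv]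

theorem neg_eq_smul (L : L2 →ₗ.[ℂ] L2) : -L = ((-1 : ℝ) : ℂ) • L := by
  refine LinearPMap.ext rfl fun x h h' => ?_
  rw [LinearPMap.neg_apply, LinearPMap.smul_apply]
  simp

end WeylCalculus
end

/-! ### Thermal states and logarithms of Gaussian states -/

noncomputable section
namespace WeylCalculus

variable {ħ : ℝ}

theorem isGaussianState_of_hasCharFun {Q : Matrix (Fin 2) (Fin 2) ℝ} {ρ : L2 →L[ℂ] L2} {c : ℝ}
    (hρ : IsDensityOperator ρ) (h : HasCharFun ħ ρ (fun ξ =>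
      ((Real.exp (-(1 / (4 * ħ)) * (c * (ξ ⬝ᵥ Q⁻¹ *ᵥ ξ))) : ℝ) : ℂ))) :
    IsGaussianState ħ (c • Q⁻¹) ρ := by
  refine ⟨hρ, ?_⟩
  simpa only [Matrix.smul_mulVec, dotProduct_smul, smul_eq_mul] using h

/-- Weyl symbol, trace and characteristic function of the thermal state of a quadratic Hamiltonian. -/
theorem gibbs_properties (hħ : 0 < ħ) {Q : Matrix (Fin 2) (Fin 2) ℝ} (hQ : Q.PosDef) {β ω Z : ℝ}
    (hβ : 0 < β) (hω : ω = Real.sqrt Q.det) (hZ : Z = 1 / (2 * Real.sinh (ħ * ω * β / 2))) :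
    ∃ A : L2 →L[ℂ] L2,
      (∀ A' : L2 →L[ℂ] L2, IsExp ((-(β : ℂ)) • hamiltonian ħ Q) A' ↔ A' = A) ∧
      HasWeylSymbol ħ A (fun x => ((1 / Real.cosh (ω * ħ * β / 2) *
        Real.exp (-(2 * Real.tanh (ω * ħ * β / 2) / (ω * ħ)) * quadForm Q x) : ℝ) : ℂ)) ∧
      HasTrace A (Z : ℂ) ∧
      HasCharFun ħ (((Z : ℂ)⁻¹) • A) (fun ξ =>
        ((Real.exp (-(1 / (4 * ħ)) * (ω / Real.tanh (ω * ħ * β / 2)) *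
          (ξ ⬝ᵥ Q⁻¹ *ᵥ ξ)) : ℝ) : ℂ)) ∧
      IsGaussianState ħ ((ω / Real.tanh (ω * ħ * β / 2)) • Q⁻¹) (((Z : ℂ)⁻¹) • A) := by
  rw [mul_comm ħ ω] at hZ
  subst hω
  obtain ⟨A, -, h1, h2, h3, h4, h5⟩ := exists_gibbs hħ hQ hβ hZ
  refine ⟨A, h1, h2, h3, ?_, isGaussianState_of_hasCharFun h4 h5⟩
  simpa only [mul_assoc] using h5

/-- A Gaussian state is the thermal state of a quadratic Hamiltonian, which is its logarithm. -/
theorem log_gaussianState (hħ : 0 < ħ) {G Q : Matrix (Fin 2) (Fin 2) ℝ} {ρ : L2 →L[ℂ] L2}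
    {z ω Z : ℝ} (hG : UncertaintyRelation G) (hdet : 1 < G.det) (hρ : IsGaussianState ħ G ρ)
    (hz : z = Real.sqrt G.det) (hQ : Q = (2 * z / ħ * arcoth z) • G⁻¹)
    (hω : ω = Real.sqrt Q.det) (hZ : Z = 1 / (2 * Real.sinh (ħ * ω / 2))) :
    Q.PosDef ∧
    (∀ R : Matrix (Fin 2) (Fin 2) ℝ, R.PosDef →
      (G = (Real.sqrt R.det / Real.tanh (Real.sqrt R.det * ħ / 2)) • R⁻¹ ↔ R = Q)) ∧
    z = 1 / Real.tanh (ω * ħ / 2) ∧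
    Z = 1 / 2 * Real.sqrt (z ^ 2 - 1) ∧
    IsExp (-hamiltonian ħ Q) ((Z : ℂ) • ρ) ∧
    (∀ B : L2 →ₗ.[ℂ] L2, IsLog ρ B ↔
      B = addScalar (-hamiltonian ħ Q) (-(Real.log Z : ℂ))) := by
  have hdet0 : 0 < G.det := one_pos.trans hdet
  have hGpos : G.PosDef := hG.posDef hdet0
  have hz1 : 1 < z := by
    rw [hz]
    exact Real.lt_sqrt_of_sq_lt (by linarith)
  have hz0 : 0 < z := one_pos.trans hz1
  have har := arcoth_pos hz1
  set k := 2 * z / ħ * arcoth z with hk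
  have hk0 : 0 < k := by positivity
  have hQpos : Q.PosDef := hQ ▸ hGpos.inv.smul hk0
  -- In dimension two the square root of the determinant is homogeneous of degree one, so the factor
  -- in `Q` is exactly what makes `ωħ/2 = arcoth z`.
  have hωk : ω = k / z := by rw [hω, hQ, sqrt_det_smul_inv hk0, hz]
  have hωar : ω * ħ / 2 = arcoth z := by
    rw [hωk, hk]
    field_simp
  have htanh : Real.tanh (ω * ħ / 2) = 1 / z := by rw [hωar, tanh_arcoth hz1]
  have hzt : z = 1 / Real.tanh (ω * ħ / 2) := by rw [htanh, one_div_one_div]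
  have hcov : (ω / Real.tanh (ω * ħ / 2)) • Q⁻¹ = G := by
    rw [htanh, hQ, inv_smul_inv hk0.ne' hdet0, smul_smul, hωk]
    have : k / z / (1 / z) * k⁻¹ = 1 := by field_simp
    rw [this, one_smul]
  refine ⟨hQpos, fun R hR => ⟨fun h => ?_, ?_⟩, hzt, ?_, ?_⟩
  -- Taking determinants in the equation for `R` gives `z = coth (wħ/2)`, which fixes `w`, then the
  -- scalar factor `c`, and finally `R = c • G⁻¹`.
  · set w := Real.sqrt R.det with hw
    have hw0 : 0 < w := posDef_sqrt_det_pos hR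
    have ht0 : 0 < w * ħ / 2 := by positivity
    have htp := tanh_pos ht0
    set c := w / Real.tanh (w * ħ / 2) with hc
    have hc0 : 0 < c := by positivity
    have hzw : z = 1 / Real.tanh (w * ħ / 2) := by
      rw [hz, h, sqrt_det_smul_inv hc0, ← hw, hc]
      field_simp
    have hck : c = k := by
      have h1 := arcoth_one_div_tanh ht0
      rw [← hzw] at h1
      rw [hk, h1, hc, hzw]
      field_simp
    rw [hQ, ← hck, h, inv_smul_inv hc0.ne' hR.det_pos, smul_smul, mul_inv_cancel₀ hc0.ne', one_smul]
  · rintro rfl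
    rw [← hω, hcov]
  · rw [hZ, mul_comm ħ ω, hωar, one_div_two_sinh_arcoth hz1]
  subst hω
  have hZ' : Z = 1 / (2 * Real.sinh (Real.sqrt Q.det * ħ * 1 / 2)) := by
    rw [hZ, mul_one, mul_comm ħ]
  have hZ0 : 0 < Z := by
    have : 0 < Real.sinh (ħ * Real.sqrt Q.det / 2) := by
      rw [mul_comm ħ, hωar]
      exact Real.sinh_pos_iff.2 har
    rw [hZ]
    positivity
  have hZc : (Z : ℂ) ≠ 0 := by exact_mod_cast hZ0.ne'
  obtain ⟨A, hA, hexp, -, -, hdens, hchar⟩ := exists_gibbs hħ hQpos one_pos hZ'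
  have hgauss := isGaussianState_of_hasCharFun hdens hchar
  rw [mul_one, hcov] at hgauss
  -- The thermal state of `Q` has the same characteristic function as `ρ`, so the two coincide.
  have hρA : ρ = (Z : ℂ)⁻¹ • A := hρ.1.ext hħ hgauss.1 hρ.2 hgauss.2
  have hneg := neg_eq_smul (hamiltonian ħ Q)
  refine ⟨?_, fun B => ?_⟩
  · rw [hρA, smul_smul, mul_inv_cancel₀ hZc, one_smul, hneg]
    have h := (hexp A).2 rfl
    simpa using h
  · have hdiag := ((isDiagonal_hamiltonian hħ hQpos).smul (c := -1) (by norm_num)).addScalar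
      (-Real.log Z)
    rw [← hneg, Complex.ofReal_neg] at hdiag
    -- The eigenvalues `-ħω(n + ½) - ln Z` are bounded above and, since `ħω > 0`, pairwise distinct,
    -- as uniqueness of the logarithm requires.
    refine hdiag.isLog_iff (M := -Real.log Z) (fun n => ?_) (fun m n h => ?_) (fun n => ?_) B
    · have := energy_nonneg (Q := Q) hħ n
      linarith
    · have hpos : 0 < ħ * Real.sqrt Q.det := mul_pos hħ (posDef_sqrt_det_pos hQpos)
      simp only [energy, neg_mul, one_mul, add_left_inj, neg_inj] at h
      have h1 := mul_left_cancel₀ hpos.ne' h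
      exact_mod_cast add_right_cancel h1
    · rw [hρA, smul_apply, hA, smul_smul]
      congr 1
      rw [← Complex.ofReal_exp, ← Complex.ofReal_inv, ← Complex.ofReal_mul]
      congr 1
      rw [Real.exp_add, Real.exp_neg (Real.log Z), Real.exp_log hZ0, mul_comm]

end WeylCalculus
end

theorem mainTheorem6 (ħ : ℝ) (hħ : 0 < ħ) :
    -- Weyl symbol, trace and characteristic function of the thermal state
    (∀ Q : Matrix (Fin 2) (Fin 2) ℝ, Q.PosDef →
      IsSelfAdjoint (WeylCalculus.hamiltonian ħ Q) ∧
      WeylCalculus.ActsAsWeylQuantization ħ (WeylCalculus.hamiltonian ħ Q)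
        (fun x => (WeylCalculus.quadForm Q x : ℂ)) ∧
      ∀ β ω Z : ℝ, 0 < β → ω = Real.sqrt Q.det → Z = 1 / (2 * Real.sinh (ħ * ω * β / 2)) →
        ∃ A : WeylCalculus.L2 →L[ℂ] WeylCalculus.L2,
          (∀ A' : WeylCalculus.L2 →L[ℂ] WeylCalculus.L2,
            WeylCalculus.IsExp ((-(β : ℂ)) • WeylCalculus.hamiltonian ħ Q) A' ↔ A' = A) ∧
          WeylCalculus.HasWeylSymbol ħ A (fun x =>
            ((1 / Real.cosh (ω * ħ * β / 2) *
              Real.exp (-(2 * Real.tanh (ω * ħ * β / 2) / (ω * ħ)) *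
                WeylCalculus.quadForm Q x) : ℝ) : ℂ)) ∧
          WeylCalculus.HasTrace A (Z : ℂ) ∧
          WeylCalculus.HasCharFun ħ (((Z : ℂ)⁻¹) • A) (fun ξ =>
            ((Real.exp (-(1 / (4 * ħ)) * (ω / Real.tanh (ω * ħ * β / 2)) *
              (ξ ⬝ᵥ Q⁻¹ *ᵥ ξ)) : ℝ) : ℂ)) ∧
          WeylCalculus.IsGaussianState ħ ((ω / Real.tanh (ω * ħ * β / 2)) • Q⁻¹)
            (((Z : ℂ)⁻¹) • A)) ∧
    -- the logarithm of a Gaussian state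
    (∀ (G Q : Matrix (Fin 2) (Fin 2) ℝ) (ρ : WeylCalculus.L2 →L[ℂ] WeylCalculus.L2)
      (z ω Z : ℝ),
      WeylCalculus.UncertaintyRelation G → 1 < G.det → WeylCalculus.IsGaussianState ħ G ρ →
      z = Real.sqrt G.det → Q = (2 * z / ħ * WeylCalculus.arcoth z) • G⁻¹ →
      ω = Real.sqrt Q.det → Z = 1 / (2 * Real.sinh (ħ * ω / 2)) →
        Q.PosDef ∧
        (∀ R : Matrix (Fin 2) (Fin 2) ℝ, R.PosDef →
          (G = (Real.sqrt R.det / Real.tanh (Real.sqrt R.det * ħ / 2)) • R⁻¹ ↔ R = Q)) ∧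
        z = 1 / Real.tanh (ω * ħ / 2) ∧
        Z = 1 / 2 * Real.sqrt (z ^ 2 - 1) ∧
        WeylCalculus.IsExp (-WeylCalculus.hamiltonian ħ Q) ((Z : ℂ) • ρ) ∧
        (∀ B : WeylCalculus.L2 →ₗ.[ℂ] WeylCalculus.L2, WeylCalculus.IsLog ρ B ↔
          B = WeylCalculus.addScalar (-WeylCalculus.hamiltonian ħ Q) (-(Real.log Z : ℂ)))) := by
  refine ⟨fun Q hQ => ⟨(WeylCalculus.isDiagonal_hamiltonian hħ hQ).isSelfAdjoint,
    WeylCalculus.actsAsWeylQuantization_hamiltonian hħ hQ,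
    fun β ω Z hβ hω hZ => WeylCalculus.gibbs_properties hħ hQ hβ hω hZ⟩,
    fun G Q ρ z ω Z hG hdet hρ hz hQ hω hZ =>
      WeylCalculus.log_gaussianState hħ hG hdet hρ hz hQ hω hZ⟩
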